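/- \textbf{Theorem (law of large numbers for discovered sites).} For $N\ge 1$ let $V_N=\{0,1\}^N$ be the hypercube with the Hamming distance $|x-y|$, and write $x\sim y$ if $|x-y|=1$. Let $(E_x)_{x\in V_N}$ be i.i.d.\ random variables distributed as the positive part of a standard Gaussian, with joint law $\mathbb P$. Let $(a_N)$ be real numbers such that, for some $\overline a<1/20$ and all $N$ large enough, $1\le a_N\le \overline a\sqrt{2\log N}$. Given $(E_x)$, let $X=(X_s)_{s\ge0}$ be the continuous-time Markov chain on $V_N$ (with c\`adl\`ag paths) whose jump rate from $x$ to $y$ is $e^{a_N(E_x+E_y)}$ if $x\sim y$ and $0$ for every other $y\neq x$, started from the uniform distribution on $V_N$. Let $\overline{\mathbb P}_N$ be the resulting joint law of $(E_x)$ and $X$ (averaged over the $E_x$'s), and $\overline{\mathbb E}_N$ its expectation. For $t\ge0$ let $$D_N(t)=\bigl|\{x\in V_N:\ \exists\, s\le t \text{ such that } |X_s-x|\le 1\}\bigr|$$ be the number of sites discovered before time $t$. Let $\overline c\in(0,\log 2)$, let $(\mathsf t_N)$ be positive real numbers such that $\log \mathsf t_N\sim\overline c N$ as $N\to\infty$,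 and let $\mathsf d_N=\overline{\mathbb E}_N[D_N(\mathsf t_N)]$. Then for every $t>0$ and every $\varepsilon>0$, $$\overline{\mathbb P}_N\left[\,\left|\frac{D_N(t\,\mathsf t_N)}{t\,\mathsf d_N}-1\right|\ge\varepsilon\right]\xrightarrow[N\to\infty]{}0 .$$ Moreover, $\log \mathsf d_N\sim\overline c N$ as $N\to\infty$. -/

import Mathlib

open MeasureTheory ProbabilityTheory Filter Topology Asymptotics
open scoped NNReal ENNReal

namespace REM

noncomputable section

/-- The hypercube `{0,1}^N`; its graph distance is Mathlib's `hammingDist`. -/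
abbrev V (N : ℕ) : Type := Fin N → Bool

/-- The law of the positive part of a standard Gaussian random variable. -/
def posGaussian : Measure ℝ := (gaussianReal 0 1).map (fun u => max u 0)

/-- The joint law of the energies `(E_x)`, i.i.d. with marginal `posGaussian`. -/
def envLaw (N : ℕ) : Measure (V N → ℝ) := Measure.pi (fun _ => posGaussian)

/-- Jump rate of the accelerated walk from `x` to `y` in the environment `e`:
`exp (a (e x + e y))` if `x` and `y` are neighbours, and `0` otherwise. -/
def rate {N : ℕ} (a : ℝ) (e : V N → ℝ) (x y : V N) : ℝ :=
  if hammingDist x y = 1 then Real.exp (a * (e x + e y)) else 0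

/-- Generator (`Q`-matrix) of the continuous-time Markov chain with jump rates `rate a e`. -/
def generator {N : ℕ} (a : ℝ) (e : V N → ℝ) : Matrix (V N) (V N) ℝ :=
  Matrix.of fun x y => if x = y then -∑ z, rate a e x z else rate a e x y

/-- Transition matrix at time `t` of the chain in the environment `e`: `exp (t Q)`. -/
def transition {N : ℕ} (a : ℝ) (e : V N → ℝ) (t : ℝ) : Matrix (V N) (V N) ℝ :=
  NormedSpace.exp (t • generator a e)

/-- Quenched finite-dimensional distributions of the chain started from the uniform
distribution: for `0 = s 0 ≤ s 1 ≤ ... ≤ s n`, the probability in the environment `e` of being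
at `x i` at time `s i` for every `i`. -/
def quenchedProb {N : ℕ} (a : ℝ) (e : V N → ℝ) (n : ℕ) (s : Fin (n + 1) → ℝ≥0)
    (x : Fin (n + 1) → V N) : ℝ :=
  ((2 : ℝ) ^ N)⁻¹ * ∏ i : Fin n,
    transition a e ((s i.succ : ℝ) - (s i.castSucc : ℝ)) (x i.castSucc) (x i.succ)

/-- On the probability space `(Ω, P)`, the pair `(E, X)` has the annealed law: the energies
`E` have law `envLaw N` and, given `E = e`, the process `X` is the continuous-time Markov chain
with jump rates `rate a e`, started from the uniform distribution, with càdlàg paths (that is,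
piecewise constant and right-continuous ones, as the state space is finite). -/
structure IsAnnealedWalk {N : ℕ} (a : ℝ) {Ω : Type*} [MeasurableSpace Ω] (P : Measure Ω)
    (E : Ω → V N → ℝ) (X : ℝ≥0 → Ω → V N) : Prop where
  measurable_env : Measurable E
  measurable_walk : ∀ s, Measurable (X s)
  map_env : P.map E = envLaw N
  /-- The joint law of `E` and of finitely many positions of `X`. -/
  finite_dim : ∀ (A : Set (V N → ℝ)), MeasurableSet A →
    ∀ (n : ℕ) (s : Fin (n + 1) → ℝ≥0), s 0 = 0 → Monotone s → ∀ x : Fin (n + 1) → V N,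
      P {ω | E ω ∈ A ∧ ∀ i, X (s i) ω = x i}
        = ∫⁻ e in A, ENNReal.ofReal (quenchedProb a e n s x) ∂(envLaw N)
  right_continuous : ∀ᵐ ω ∂P, ∀ s, ∀ᶠ r in 𝓝[≥] s, X r ω = X s ω
  left_limits : ∀ᵐ ω ∂P, ∀ s, ∃ x, ∀ᶠ r in 𝓝[<] s, X r ω = x

/-- The set of sites discovered before time `t` along the path `p`: those within distance `1` of
a position of the path at some time `s ≤ t`. -/
def discovered {N : ℕ} (p : ℝ≥0 → V N) (t : ℝ) : Set (V N) :=
  {x | ∃ s : ℝ≥0, (s : ℝ) ≤ t ∧ hammingDist (p s) x ≤ 1}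

/-- The number `D_N(t)` of sites discovered before time `t` by the walk `X`. -/
def numDiscovered {N : ℕ} {Ω : Type*} (X : ℝ≥0 → Ω → V N) (t : ℝ) (ω : Ω) : ℕ :=
  (discovered (fun s => X s ω) t).ncard

/-- The annealed mean of the number of sites discovered before time `t`. -/
def meanDiscovered {N : ℕ} {Ω : Type*} [MeasurableSpace Ω] (P : Measure Ω)
    (X : ℝ≥0 → Ω → V N) (t : ℝ) : ℝ :=
  ∫ ω, (numDiscovered X t ω : ℝ) ∂P

end

end REM

/-!
Replace the walk by its lazy discretization with time step `1 / q`, whose transition matrix is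
symmetric. Since `a ≥ 0` and the energies are nonnegative, all jump rates are at least `1`, so a
Poincaré inequality on the hypercube shows that the walk is stationary up to a relative error
`2 ^ (-N)` after time `2 * N`, whatever the environment. Cut the time into blocks, each consisting
of an active part followed by a gap of length `2 * N`. In a fixed environment the gaps decorrelate
the sets discovered in different blocks, whose sum is therefore concentrated, and overlaps between
blocks are rare; an Efron-Stein bound over the environment shows that the quenched mean of a block
is close to its annealed mean. Letting `q → ∞` gives an error bound for the walk itself in terms of
a moment bound that is subexponential in `N` as soon as `a ^ 2 = o(N)`, so blocks of subexponential
length suffice.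
-/

namespace REM

noncomputable section

/-! ### Path functionals of a finite Markov chain -/

section Chain

variable {S : Type*}

/-- The path `ω` preceded by the state `y`. -/
def consPath (y : S) (ω : ℕ → S) : ℕ → S
  | 0 => y
  | n + 1 => ω n

/-- The path `ω` seen from time `i` on. -/
def shiftPath (i : ℕ) (ω : ℕ → S) : ℕ → S := fun l => ω (i + l)

@[simp] lemma consPath_zero (y : S) (ω : ℕ → S) : consPath y ω 0 = y := rfl

@[simp] lemma consPath_succ (y : S) (ω : ℕ → S) (n : ℕ) : consPath y ω (n + 1) = ω n := rfl

lemma shiftPath_apply (i : ℕ) (ω : ℕ → S) (l : ℕ) : shiftPath i ω l = ω (i + l) := rfl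

lemma shiftPath_shiftPath (i j : ℕ) (ω : ℕ → S) :
    shiftPath i (shiftPath j ω) = shiftPath (j + i) ω := by
  funext l; simp [shiftPath, add_assoc]

lemma shiftPath_zero (ω : ℕ → S) : shiftPath 0 ω = ω := by
  funext l; simp [shiftPath]

lemma shiftPath_succ_consPath (i : ℕ) (y : S) (ω : ℕ → S) :
    shiftPath (i + 1) (consPath y ω) = shiftPath i ω := by
  funext l
  simp only [shiftPath]
  rw [show i + 1 + l = (i + l) + 1 by ring, consPath_succ]

lemma dependsOn_consPath {β : Type*} {G : (ℕ → S) → β} {k : ℕ}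
    (hG : DependsOn G (Set.Iic (k + 1))) (y : S) :
    DependsOn (fun ω => G (consPath y ω)) (Set.Iic k) := by
  intro ω ω' h
  refine hG fun i hi => ?_
  cases i with
  | zero => rfl
  | succ i => exact h i (by simpa using hi)

lemma consPath_of_dependsOn {β : Type*} {G : (ℕ → S) → β} (hG : DependsOn G (Set.Iic 0)) (y : S)
    (ω : ℕ → S) : G (consPath y ω) = G fun _ => y :=
  hG fun i hi => by
    obtain rfl : i = 0 := Nat.le_zero.1 hi
    rfl

lemma dependsOn_shiftPath {β : Type*} {G : (ℕ → S) → β} {k : ℕ}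
    (hG : DependsOn G (Set.Iic k)) (i : ℕ) :
    DependsOn (fun ω => G (shiftPath i ω)) (Set.Iic (i + k)) := by
  intro ω ω' h
  refine hG fun l hl => h (i + l) ?_
  simp only [Set.mem_Iic] at hl ⊢
  omega

lemma dependsOn_mul {F G : (ℕ → S) → ℝ} {s : Set ℕ}
    (hF : DependsOn F s) (hG : DependsOn G s) : DependsOn (fun ω => F ω * G ω) s :=
  fun _ _ h => by simp only [hF h, hG h]

variable [Fintype S]

/-- The mean, for the chain with transition matrix `A` started from `y`, of the functional `G`
of the path stopped after `n` steps. -/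
def pathExp (A : Matrix S S ℝ) : ℕ → ((ℕ → S) → ℝ) → S → ℝ
  | 0, G, y => G (fun _ => y)
  | n + 1, G, y => ∑ z, A y z * pathExp A n (fun ω => G (consPath y ω)) z

/-- The mean of `G` for the chain started from the uniform distribution. -/
def statExp (A : Matrix S S ℝ) (n : ℕ) (G : (ℕ → S) → ℝ) : ℝ :=
  (Fintype.card S : ℝ)⁻¹ * ∑ y, pathExp A n G y

/-- Symmetric stochastic matrices. -/
structure IsSymmStochastic (A : Matrix S S ℝ) : Prop where
  nonneg : ∀ x y, 0 ≤ A x y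
  row_sum : ∀ x, ∑ y, A x y = 1
  symm : ∀ x y, A x y = A y x

lemma pathExp_mono {A : Matrix S S ℝ} (hA : ∀ x y, 0 ≤ A x y) :
    ∀ (n : ℕ) {G G' : (ℕ → S) → ℝ}, (∀ ω, G ω ≤ G' ω) → ∀ y, pathExp A n G y ≤ pathExp A n G' y
  | 0, _, _, h, _ => h _
  | n + 1, _, _, h, y => Finset.sum_le_sum fun z _ =>
      mul_le_mul_of_nonneg_left (pathExp_mono hA n (fun _ => h _) z) (hA y z)

lemma pathExp_add (A : Matrix S S ℝ) : ∀ (n : ℕ) (G G' : (ℕ → S) → ℝ) (y : S),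
    pathExp A n (fun ω => G ω + G' ω) y = pathExp A n G y + pathExp A n G' y
  | 0, _, _, _ => rfl
  | n + 1, G, G', y => by
      simp only [pathExp, pathExp_add A n, mul_add, Finset.sum_add_distrib]

lemma pathExp_const_mul (A : Matrix S S ℝ) (c : ℝ) : ∀ (n : ℕ) (G : (ℕ → S) → ℝ) (y : S),
    pathExp A n (fun ω => c * G ω) y = c * pathExp A n G y
  | 0, _, _ => rfl
  | n + 1, G, y => by
      simp only [pathExp, pathExp_const_mul A c n, Finset.mul_sum]
      exact Finset.sum_congr rfl fun z _ => by ring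

lemma pathExp_const {A : Matrix S S ℝ} (hA : ∀ x, ∑ y, A x y = 1) (c : ℝ) :
    ∀ (n : ℕ) (y : S), pathExp A n (fun _ => c) y = c
  | 0, _ => rfl
  | n + 1, y => by
      simp only [pathExp, pathExp_const hA c n, ← Finset.sum_mul, hA y, one_mul]

lemma pathExp_nonneg {A : Matrix S S ℝ} (hA : ∀ x y, 0 ≤ A x y) :
    ∀ (n : ℕ) {G : (ℕ → S) → ℝ}, (∀ ω, 0 ≤ G ω) → ∀ y, 0 ≤ pathExp A n G y
  | 0, _, h, _ => h _
  | n + 1, _, h, y => Finset.sum_nonneg fun z _ =>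
      mul_nonneg (hA y z) (pathExp_nonneg hA n (fun _ => h _) z)

lemma abs_pathExp_le {A : Matrix S S ℝ} (hA : ∀ x y, 0 ≤ A x y) (hA1 : ∀ x, ∑ y, A x y = 1)
    (n : ℕ) {G : (ℕ → S) → ℝ} {c : ℝ} (hG : ∀ ω, |G ω| ≤ c) (y : S) : |pathExp A n G y| ≤ c := by
  rw [abs_le]
  constructor
  · rw [← pathExp_const hA1 (-c) n y]
    exact pathExp_mono hA n (fun ω => (abs_le.1 (hG ω)).1) y
  · rw [← pathExp_const hA1 c n y]
    exact pathExp_mono hA n (fun ω => (abs_le.1 (hG ω)).2) y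

lemma abs_pathExp_sub_le {A B : Matrix S S ℝ} (hA : ∀ x y, 0 ≤ A x y)
    (hA1 : ∀ x, ∑ y, A x y = 1) (hB : ∀ x y, 0 ≤ B x y) (hB1 : ∀ x, ∑ y, B x y = 1)
    {δ : ℝ} (hδ : ∀ x, ∑ y, |A x y - B x y| ≤ δ) {c : ℝ} (hc : 0 ≤ c) :
    ∀ (n : ℕ) {G : (ℕ → S) → ℝ}, (∀ ω, |G ω| ≤ c) → ∀ y,
      |pathExp A n G y - pathExp B n G y| ≤ n * δ * c
  | 0, _, _, y => by simp [pathExp]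
  | n + 1, G, hG, y => by
      have e : pathExp A (n + 1) G y - pathExp B (n + 1) G y
          = ∑ z, (A y z - B y z) * pathExp A n (fun ω => G (consPath y ω)) z
            + ∑ z, B y z * (pathExp A n (fun ω => G (consPath y ω)) z
                - pathExp B n (fun ω => G (consPath y ω)) z) := by
        simp only [pathExp]
        rw [← Finset.sum_add_distrib, ← Finset.sum_sub_distrib]
        exact Finset.sum_congr rfl fun z _ => by ring
      rw [e]
      refine (abs_add_le _ _).trans ?_
      have h1 : |∑ z, (A y z - B y z) * pathExp A n (fun ω => G (consPath y ω)) z| ≤ δ * c := by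
        refine (Finset.abs_sum_le_sum_abs _ _).trans ?_
        refine le_trans (Finset.sum_le_sum fun z _ => ?_)
          ((Finset.sum_mul (Finset.univ) (fun z => |A y z - B y z|) c).symm.le.trans
            (mul_le_mul_of_nonneg_right (hδ y) hc))
        rw [abs_mul]
        exact mul_le_mul_of_nonneg_left (abs_pathExp_le hA hA1 n (fun ω => hG _) z) (abs_nonneg _)
      have h2 : |∑ z, B y z * (pathExp A n (fun ω => G (consPath y ω)) z
                - pathExp B n (fun ω => G (consPath y ω)) z)| ≤ n * δ * c := by
        refine (Finset.abs_sum_le_sum_abs _ _).trans ?_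
        calc ∑ z, |B y z * (pathExp A n (fun ω => G (consPath y ω)) z
                - pathExp B n (fun ω => G (consPath y ω)) z)|
            ≤ ∑ z, B y z * (n * δ * c) := Finset.sum_le_sum fun z _ => by
              rw [abs_mul, abs_of_nonneg (hB y z)]
              exact mul_le_mul_of_nonneg_left
                (abs_pathExp_sub_le hA hA1 hB hB1 hδ hc n (fun ω => hG _) z) (hB y z)
          _ = n * δ * c := by rw [← Finset.sum_mul, hB1, one_mul]
      push_cast
      linarith

lemma pathExp_of_dependsOn {A : Matrix S S ℝ} (hA : ∀ x, ∑ y, A x y = 1) :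
    ∀ (k n : ℕ) {G : (ℕ → S) → ℝ}, DependsOn G (Set.Iic k) → k ≤ n → ∀ y,
      pathExp A n G y = pathExp A k G y
  | 0, 0, _, _, _, _ => rfl
  | 0, n + 1, G, hG, _, y => by
      simp only [pathExp, consPath_of_dependsOn hG, pathExp_const hA, ← Finset.sum_mul, hA y,
        one_mul]
  | k + 1, 0, _, _, h, _ => by omega
  | k + 1, n + 1, G, hG, h, y => by
      simp only [pathExp]
      exact Finset.sum_congr rfl fun z _ => by
        rw [pathExp_of_dependsOn hA k n (dependsOn_consPath hG y) (by omega)]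

lemma pathExp_mul_of_dependsOn_zero (A : Matrix S S ℝ) {F : (ℕ → S) → ℝ}
    (hF : DependsOn F (Set.Iic 0)) (n : ℕ) (G : (ℕ → S) → ℝ) (y : S) :
    pathExp A n (fun ω => F ω * G ω) y = F (fun _ => y) * pathExp A n G y := by
  cases n with
  | zero => rfl
  | succ n =>
    simp only [pathExp, consPath_of_dependsOn hF, pathExp_const_mul, Finset.mul_sum]
    exact Finset.sum_congr rfl fun z _ => mul_left_comm _ _ _

lemma pathExp_zero (A : Matrix S S ℝ) (n : ℕ) (y : S) : pathExp A n (fun _ => 0) y = 0 := by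
  simpa using pathExp_const_mul A 0 n (fun _ => 0) y

lemma pathExp_eq_of_avoid {A A' : Matrix S S ℝ} {B : Set S}
    (hAA : ∀ x, x ∉ B → ∀ y, A x y = A' x y) :
    ∀ (n : ℕ) {G : (ℕ → S) → ℝ}, (∀ ω, (∃ i < n, ω i ∈ B) → G ω = 0) → ∀ y,
      pathExp A n G y = pathExp A' n G y
  | 0, _, _, _ => rfl
  | n + 1, G, hG, y => by
      by_cases hy : y ∈ B
      · have h : ∀ ω, G (consPath y ω) = 0 := fun ω => hG _ ⟨0, by omega, by simpa using hy⟩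
        simp only [pathExp, h, pathExp_zero, mul_zero]
      · simp only [pathExp]
        refine Finset.sum_congr rfl fun z _ => ?_
        rw [hAA y hy z, pathExp_eq_of_avoid hAA n (fun ω hω => ?_) z]
        obtain ⟨i, hi, hB⟩ := hω
        exact hG _ ⟨i + 1, by omega, by simpa using hB⟩

lemma measurable_pathExp {E : Type*} [MeasurableSpace E] {A : E → Matrix S S ℝ}
    (hA : ∀ x y, Measurable fun e => A e x y) :
    ∀ (n : ℕ) (G : (ℕ → S) → ℝ) (y : S), Measurable fun e => pathExp (A e) n G y
  | 0, _, _ => measurable_const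
  | n + 1, G, y => by
      simp only [pathExp]
      exact Finset.measurable_sum _ fun z _ => (hA y z).mul (measurable_pathExp hA n _ z)

lemma IsSymmStochastic.sum_mul_mulVec {A : Matrix S S ℝ} (hA : IsSymmStochastic A)
    (f g : S → ℝ) : ∑ y, f y * (A.mulVec g) y = ∑ y, (A.mulVec f) y * g y := by
  simp only [Matrix.mulVec, dotProduct, Finset.mul_sum, Finset.sum_mul]
  rw [Finset.sum_comm]
  exact Finset.sum_congr rfl fun x _ => Finset.sum_congr rfl fun y _ => by
    rw [hA.symm y x]; ring

lemma IsSymmStochastic.mulVec_const {A : Matrix S S ℝ} (hA : IsSymmStochastic A) (c : ℝ)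
    (x : S) : (A.mulVec fun _ => c) x = c := by
  simp only [Matrix.mulVec, dotProduct, ← Finset.sum_mul, hA.row_sum, one_mul]

lemma IsSymmStochastic.sum_mulVec {A : Matrix S S ℝ} (hA : IsSymmStochastic A)
    (f : S → ℝ) : ∑ y, (A.mulVec f) y = ∑ y, f y := by
  have h := hA.sum_mul_mulVec (fun _ => 1) f
  simpa [hA.mulVec_const] using h

lemma IsSymmStochastic.mulVec_pow_le {A : Matrix S S ℝ} (hA : IsSymmStochastic A)
    {f : S → ℝ} (hf : ∀ x, 0 ≤ f x) (p : ℕ) (x : S) :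
    (A.mulVec f x) ^ p ≤ A.mulVec (fun y => f y ^ p) x :=
  Real.pow_arith_mean_le_arith_mean_pow _ _ _ (fun y _ => hA.nonneg x y) (hA.row_sum x)
    (fun y _ => hf y) p

lemma IsSymmStochastic.mulVec_nonneg {A : Matrix S S ℝ} (hA : IsSymmStochastic A)
    {f : S → ℝ} (hf : ∀ x, 0 ≤ f x) (x : S) : 0 ≤ A.mulVec f x :=
  Finset.sum_nonneg fun y _ => mul_nonneg (hA.nonneg x y) (hf y)

variable [DecidableEq S]

lemma pathExp_shiftPath (A : Matrix S S ℝ) (n : ℕ) (G : (ℕ → S) → ℝ) :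
    ∀ (m : ℕ) (y : S), pathExp A (m + n) (fun ω => G (shiftPath m ω)) y
      = ((A ^ m).mulVec (pathExp A n G)) y
  | 0, y => by
      simp only [shiftPath_zero, pow_zero, Matrix.one_mulVec, zero_add]
  | m + 1, y => by
      rw [show m + 1 + n = (m + n) + 1 by ring, pow_succ', ← Matrix.mulVec_mulVec]
      simp only [pathExp, shiftPath_succ_consPath, pathExp_shiftPath A n G m]
      rfl

lemma pathExp_mul_shiftPath (A : Matrix S S ℝ) (j n : ℕ) (G : (ℕ → S) → ℝ) :
    ∀ (m : ℕ) {F : (ℕ → S) → ℝ}, DependsOn F (Set.Iic m) → ∀ y,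
      pathExp A (m + (j + n)) (fun ω => F ω * G (shiftPath (m + j) ω)) y
        = pathExp A m (fun ω => F ω * ((A ^ j).mulVec (pathExp A n G)) (ω m)) y
  | 0, F, hF, y => by
      simp only [zero_add]
      rw [pathExp_mul_of_dependsOn_zero A hF, pathExp_shiftPath]
      rfl
  | m + 1, F, hF, y => by
      rw [show m + 1 + (j + n) = (m + (j + n)) + 1 by ring]
      simp only [pathExp]
      refine Finset.sum_congr rfl fun z _ => ?_
      congr 1
      have h := pathExp_mul_shiftPath A j n G m (dependsOn_consPath hF y) z
      rw [show m + 1 + j = (m + j) + 1 by ring]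
      simp only [shiftPath_succ_consPath, consPath_succ]
      exact h

lemma IsSymmStochastic.mem_rowStochastic {A : Matrix S S ℝ} (hA : IsSymmStochastic A) :
    A ∈ Matrix.rowStochastic ℝ S :=
  Matrix.mem_rowStochastic_iff_sum.2 ⟨hA.nonneg, hA.row_sum⟩

lemma IsSymmStochastic.pow {A : Matrix S S ℝ} (hA : IsSymmStochastic A) (k : ℕ) :
    IsSymmStochastic (A ^ k) := by
  have hpow := Matrix.mem_rowStochastic_iff_sum.1 (pow_mem hA.mem_rowStochastic k)
  have hsymm : A.IsSymm := Matrix.IsSymm.ext fun x y => hA.symm y x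
  exact ⟨hpow.1, hpow.2, fun x y => ((hsymm.pow k).apply x y).symm⟩

end Chain

/-! ### Jumps and hitting -/

section Paths

variable {S : Type*}

lemma exists_jumpInto {z : S} {ω : ℕ → S} {m : ℕ} (h : ω m = z) (h0 : ω 0 ≠ z) :
    ∃ j < m, ω j ≠ ω (j + 1) ∧ ω (j + 1) = z := by
  induction m with
  | zero => exact absurd h h0
  | succ m ih =>
    by_cases hm : ω m = z
    · obtain ⟨j, hj, h'⟩ := ih hm
      exact ⟨j, by omega, h'⟩
    · exact ⟨m, by omega, by rwa [h], h⟩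

lemma exists_jumpOutOf {z : S} {ω : ℕ → S} {m n : ℕ} (hmn : m ≤ n) (h : ω m = z) (hn : ω n ≠ z) :
    ∃ j, m ≤ j ∧ j < n ∧ ω j ≠ ω (j + 1) ∧ ω j = z := by
  induction n, hmn using Nat.le_induction with
  | base => exact absurd h hn
  | succ n hmn ih =>
    by_cases h' : ω n = z
    · exact ⟨n, hmn, by omega, by rw [h']; exact hn.symm, h'⟩
    · obtain ⟨j, h1, h2, h3⟩ := ih h'
      exact ⟨j, h1, by omega, h3⟩

variable [DecidableEq S]

/-- Indicator of a jump at step `i`. -/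
def jumpAt (i : ℕ) (ω : ℕ → S) : ℝ := if ω i = ω (i + 1) then 0 else 1

/-- Indicator of a jump into `z` at step `i`. -/
def jumpInto (z : S) (i : ℕ) (ω : ℕ → S) : ℝ := if ω i ≠ ω (i + 1) ∧ ω (i + 1) = z then 1 else 0

/-- Indicator of a jump out of `z` at step `i`. -/
def jumpOutOf (z : S) (i : ℕ) (ω : ℕ → S) : ℝ := if ω i ≠ ω (i + 1) ∧ ω i = z then 1 else 0

/-- Indicator of being at `z` at step `i`. -/
def atSite (z : S) (i : ℕ) (ω : ℕ → S) : ℝ := if ω i = z then 1 else 0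

/-- The number of jumps in the first `n` steps. -/
def numJumps (n : ℕ) (ω : ℕ → S) : ℝ := ∑ i ∈ Finset.range n, jumpAt i ω

open Classical in
/-- Indicator of a visit to `z` in the first `n` steps. -/
def hits (z : S) (n : ℕ) (ω : ℕ → S) : ℝ := if ∃ i ≤ n, ω i = z then 1 else 0

lemma jumpAt_nonneg (i : ℕ) (ω : ℕ → S) : 0 ≤ jumpAt i ω := by
  unfold jumpAt; split_ifs <;> norm_num

lemma atSite_nonneg (z : S) (i : ℕ) (ω : ℕ → S) : 0 ≤ atSite z i ω := by
  unfold atSite; split_ifs <;> norm_num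

lemma jumpInto_nonneg (z : S) (i : ℕ) (ω : ℕ → S) : 0 ≤ jumpInto z i ω := by
  unfold jumpInto; split_ifs <;> norm_num

lemma jumpOutOf_nonneg (z : S) (i : ℕ) (ω : ℕ → S) : 0 ≤ jumpOutOf z i ω := by
  unfold jumpOutOf; split_ifs <;> norm_num

lemma numJumps_nonneg (n : ℕ) (ω : ℕ → S) : 0 ≤ numJumps n ω :=
  Finset.sum_nonneg fun i _ => jumpAt_nonneg i ω

lemma hits_nonneg (z : S) (n : ℕ) (ω : ℕ → S) : 0 ≤ hits z n ω := by
  unfold hits; split_ifs <;> norm_num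

lemma dependsOn_jumpAt_zero : DependsOn (jumpAt (S := S) 0) (Set.Iic 1) := fun ω ω' h => by
  simp only [jumpAt, h 0 (by simp), h (0 + 1) (by simp)]

lemma dependsOn_jumpInto_zero (z : S) : DependsOn (jumpInto z 0) (Set.Iic 1) := fun ω ω' h => by
  simp only [jumpInto, h 0 (by simp), h (0 + 1) (by simp)]

lemma dependsOn_jumpOutOf_zero (z : S) : DependsOn (jumpOutOf z 0) (Set.Iic 1) :=
  fun ω ω' h => by simp only [jumpOutOf, h 0 (by simp), h (0 + 1) (by simp)]

lemma dependsOn_atSite_zero (z : S) : DependsOn (atSite z 0) (Set.Iic 0) := fun ω ω' h => by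
  simp only [atSite, h 0 (by simp)]

lemma jumpAt_shiftPath (i j : ℕ) (ω : ℕ → S) : jumpAt j (shiftPath i ω) = jumpAt (i + j) ω := rfl

lemma jumpInto_shiftPath (z : S) (i j : ℕ) (ω : ℕ → S) :
    jumpInto z j (shiftPath i ω) = jumpInto z (i + j) ω := rfl

lemma jumpOutOf_shiftPath (z : S) (i j : ℕ) (ω : ℕ → S) :
    jumpOutOf z j (shiftPath i ω) = jumpOutOf z (i + j) ω := rfl

lemma atSite_shiftPath (z : S) (i j : ℕ) (ω : ℕ → S) :
    atSite z j (shiftPath i ω) = atSite z (i + j) ω := rfl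

lemma hits_le (z : S) (n : ℕ) (ω : ℕ → S) :
    hits z n ω ≤ atSite z 0 ω + ∑ j ∈ Finset.range n, jumpInto z j ω := by
  have hs : 0 ≤ ∑ j ∈ Finset.range n, jumpInto z j ω :=
    Finset.sum_nonneg fun j _ => jumpInto_nonneg z j ω
  unfold hits
  split_ifs with h
  · obtain ⟨m, hm, h⟩ := h
    by_cases h0 : ω 0 = z
    · simp only [atSite, h0, if_true]; linarith
    · obtain ⟨j, hj, h'⟩ := exists_jumpInto h h0
      have := Finset.single_le_sum (f := fun j => jumpInto z j ω)
        (fun j _ => jumpInto_nonneg z j ω) (Finset.mem_range.2 (by omega : j < n))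
      have e : jumpInto z j ω = 1 := by simp only [jumpInto]; exact if_pos h'
      have := atSite_nonneg z 0 ω
      linarith
  · have := atSite_nonneg z 0 ω
    linarith

/-- A visit to `z` before step `i` is charged to a jump into `z`, a later one to a jump out of `z`:
then the jump at step `i` comes after the former and before the latter, and the Markov property
applies to both products. -/
lemma hits_le_add (z : S) (i n : ℕ) (ω : ℕ → S) :
    hits z n ω ≤ (atSite z 0 ω + ∑ j ∈ Finset.range i, jumpInto z j ω)
      + (∑ j ∈ Finset.Ico (i + 1) n, jumpOutOf z j ω + atSite z n ω) := by
  have h1 : 0 ≤ ∑ j ∈ Finset.range i, jumpInto z j ω :=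
    Finset.sum_nonneg fun j _ => jumpInto_nonneg z j ω
  have h2 : 0 ≤ ∑ j ∈ Finset.Ico (i + 1) n, jumpOutOf z j ω :=
    Finset.sum_nonneg fun j _ => jumpOutOf_nonneg z j ω
  have h3 := atSite_nonneg z 0 ω
  have h4 := atSite_nonneg z n ω
  by_cases h : ∃ m ≤ n, ω m = z
  · have e : hits z n ω = 1 := by unfold hits; exact if_pos h
    obtain ⟨m, hm, h⟩ := h
    rcases Nat.lt_or_ge i m with him | him
    · by_cases hn : ω n = z
      · have : atSite z n ω = 1 := if_pos hn
        linarith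
      · obtain ⟨j, hj1, hj2, h'⟩ := exists_jumpOutOf hm h hn
        have := Finset.single_le_sum (f := fun j => jumpOutOf z j ω)
          (fun j _ => jumpOutOf_nonneg z j ω)
          (Finset.mem_Ico.2 ⟨by omega, hj2⟩ : j ∈ Finset.Ico (i + 1) n)
        have e' : jumpOutOf z j ω = 1 := if_pos h'
        linarith
    · have e2 : hits z i ω = 1 := by unfold hits; exact if_pos ⟨m, him, h⟩
      have := hits_le z i ω
      linarith
  · have e : hits z n ω = 0 := by unfold hits; exact if_neg h
    linarith

end Paths

section Stationary

variable {S : Type*} [Fintype S] {A : Matrix S S ℝ}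

lemma statExp_mono (hA : IsSymmStochastic A) (n : ℕ) {G G' : (ℕ → S) → ℝ}
    (h : ∀ ω, G ω ≤ G' ω) : statExp A n G ≤ statExp A n G' :=
  mul_le_mul_of_nonneg_left (Finset.sum_le_sum fun y _ => pathExp_mono hA.nonneg n h y)
    (by positivity)

lemma statExp_nonneg (hA : IsSymmStochastic A) (n : ℕ) {G : (ℕ → S) → ℝ}
    (h : ∀ ω, 0 ≤ G ω) : 0 ≤ statExp A n G :=
  mul_nonneg (by positivity) (Finset.sum_nonneg fun y _ => pathExp_nonneg hA.nonneg n h y)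

lemma statExp_add (A : Matrix S S ℝ) (n : ℕ) (G G' : (ℕ → S) → ℝ) :
    statExp A n (fun ω => G ω + G' ω) = statExp A n G + statExp A n G' := by
  simp only [statExp, pathExp_add, Finset.sum_add_distrib, mul_add]

lemma statExp_const_mul (A : Matrix S S ℝ) (n : ℕ) (c : ℝ) (G : (ℕ → S) → ℝ) :
    statExp A n (fun ω => c * G ω) = c * statExp A n G := by
  simp only [statExp, pathExp_const_mul, ← Finset.mul_sum]
  ring

lemma statExp_sub (A : Matrix S S ℝ) (n : ℕ) (G G' : (ℕ → S) → ℝ) :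
    statExp A n (fun ω => G ω - G' ω) = statExp A n G - statExp A n G' := by
  have h := statExp_add A n G (fun ω => (-1) * G' ω)
  rw [statExp_const_mul] at h
  rw [show (fun ω => G ω - G' ω) = fun ω => G ω + (-1) * G' ω by funext ω; ring, h]
  ring

lemma statExp_sum (A : Matrix S S ℝ) (n : ℕ) {ι : Type*} (s : Finset ι)
    (G : ι → (ℕ → S) → ℝ) :
    statExp A n (fun ω => ∑ i ∈ s, G i ω) = ∑ i ∈ s, statExp A n (G i) := by
  classical
  induction s using Finset.induction_on with
  | empty => simpa using statExp_const_mul A n 0 (fun _ => 0)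
  | insert i s hi ih => simp only [Finset.sum_insert hi, statExp_add, ih]

lemma statExp_const [Nonempty S] (hA : IsSymmStochastic A) (n : ℕ) (c : ℝ) :
    statExp A n (fun _ => c) = c := by
  simp only [statExp, pathExp_const hA.row_sum]
  simp

lemma statExp_of_dependsOn (hA : IsSymmStochastic A) {k n : ℕ} {G : (ℕ → S) → ℝ}
    (hG : DependsOn G (Set.Iic k)) (hkn : k ≤ n) : statExp A n G = statExp A k G := by
  simp only [statExp, pathExp_of_dependsOn hA.row_sum k n hG hkn]

lemma abs_statExp_le [Nonempty S] (hA : ∀ x y, 0 ≤ A x y) (hA1 : ∀ x, ∑ y, A x y = 1) (n : ℕ)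
    {G : (ℕ → S) → ℝ} {c : ℝ} (hG : ∀ ω, |G ω| ≤ c) : |statExp A n G| ≤ c := by
  rw [statExp, abs_mul, abs_of_nonneg (by positivity : (0 : ℝ) ≤ (Fintype.card S : ℝ)⁻¹)]
  calc (Fintype.card S : ℝ)⁻¹ * |∑ y, pathExp A n G y|
      ≤ (Fintype.card S : ℝ)⁻¹ * ∑ _y : S, c :=
        mul_le_mul_of_nonneg_left ((Finset.abs_sum_le_sum_abs _ _).trans
          (Finset.sum_le_sum fun y _ => abs_pathExp_le hA hA1 n hG y)) (by positivity)
    _ = c := by simp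

lemma measurable_statExp {E : Type*} [MeasurableSpace E] {A : E → Matrix S S ℝ}
    (hA : ∀ x y, Measurable fun e => A e x y) (n : ℕ) (G : (ℕ → S) → ℝ) :
    Measurable fun e => statExp (A e) n G :=
  (Finset.measurable_sum _ fun y _ => measurable_pathExp hA n G y).const_mul _

lemma statExp_shiftPath (hA : IsSymmStochastic A) {i k n : ℕ} {G : (ℕ → S) → ℝ}
    (hG : DependsOn G (Set.Iic k)) (hn : i + k ≤ n) :
    statExp A n (fun ω => G (shiftPath i ω)) = statExp A k G := by
  classical
  rw [statExp_of_dependsOn hA (dependsOn_shiftPath hG i) hn]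
  simp only [statExp, pathExp_shiftPath, (hA.pow i).sum_mulVec]

variable [DecidableEq S]

lemma statExp_mul_shiftPath (hA : IsSymmStochastic A) {i m j k n : ℕ} {F G : (ℕ → S) → ℝ}
    (hF : DependsOn F (Set.Iic m)) (hG : DependsOn G (Set.Iic k)) (hn : i + m + j + k ≤ n) :
    statExp A n (fun ω => F (shiftPath i ω) * G (shiftPath (i + m + j) ω))
      = statExp A m (fun ω => F ω * ((A ^ j).mulVec (pathExp A k G)) (ω m)) := by
  have hFG : DependsOn (fun ω => F ω * G (shiftPath (m + j) ω)) (Set.Iic (m + j + k)) :=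
    dependsOn_mul (hF.mono (Set.Iic_subset_Iic.2 (by omega))) (dependsOn_shiftPath hG _)
  have h1 := statExp_shiftPath hA (i := i) (n := n) hFG (by omega)
  simp only [shiftPath_shiftPath] at h1
  rw [show i + m + j = i + (m + j) by ring, h1, statExp, statExp, add_assoc]
  simp only [pathExp_mul_shiftPath A j k G m hF]

lemma statExp_mul_shiftPath_le (hA : IsSymmStochastic A) {i m j k n : ℕ}
    {F G : (ℕ → S) → ℝ} (hF : DependsOn F (Set.Iic m)) (hG : DependsOn G (Set.Iic k))
    (hF0 : ∀ ω, 0 ≤ F ω) (hG0 : ∀ ω, 0 ≤ G ω) {η : ℝ}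
    (hη : ∀ x y, (A ^ j) x y ≤ (Fintype.card S : ℝ)⁻¹ * (1 + η)) (hn : i + m + j + k ≤ n) :
    statExp A n (fun ω => F (shiftPath i ω) * G (shiftPath (i + m + j) ω))
      ≤ (1 + η) * (statExp A m F * statExp A k G) := by
  rw [statExp_mul_shiftPath hA hF hG hn]
  calc statExp A m (fun ω => F ω * ((A ^ j).mulVec (pathExp A k G)) (ω m))
      ≤ statExp A m (fun ω => ((1 + η) * statExp A k G) * F ω) := by
        refine statExp_mono hA m fun ω => ?_
        rw [mul_comm]
        refine mul_le_mul_of_nonneg_right ?_ (hF0 ω)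
        simp only [Matrix.mulVec, dotProduct, statExp, Finset.mul_sum]
        refine Finset.sum_le_sum fun y _ => ?_
        calc (A ^ j) (ω m) y * pathExp A k G y
            ≤ (Fintype.card S : ℝ)⁻¹ * (1 + η) * pathExp A k G y :=
              mul_le_mul_of_nonneg_right (hη _ _) (pathExp_nonneg hA.nonneg k hG0 y)
          _ = _ := by ring
    _ = _ := by rw [statExp_const_mul]; ring

/-- The probability to leave `x` in one step. -/
def escape (A : Matrix S S ℝ) (x : S) : ℝ := ∑ y, if x = y then 0 else A x y

lemma escape_nonneg (hA : IsSymmStochastic A) (x : S) : 0 ≤ escape A x :=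
  Finset.sum_nonneg fun y _ => by split_ifs; exacts [le_rfl, hA.nonneg x y]

lemma pathExp_jumpAt (x : S) : pathExp A 1 (jumpAt 0) x = escape A x := by
  simp only [pathExp, jumpAt, escape, consPath_zero, consPath_succ]
  exact Finset.sum_congr rfl fun y _ => by by_cases h : x = y <;> simp [h]

lemma pathExp_jumpOutOf (z x : S) :
    pathExp A 1 (jumpOutOf z 0) x = if x = z then escape A z else 0 := by
  simp only [pathExp, jumpOutOf, escape, consPath_zero, consPath_succ]
  by_cases h : x = z
  · subst h
    simp only [and_true, if_true]
    exact Finset.sum_congr rfl fun y _ => by by_cases hy : x = y <;> simp [hy]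
  · simp [h]

lemma pathExp_atSite (z x : S) : pathExp A 0 (atSite z 0) x = if x = z then 1 else 0 := rfl

lemma statExp_jumpAt_mul (hA : IsSymmStochastic A) (f : S → ℝ) :
    statExp A 1 (fun ω => jumpAt 0 ω * f (ω 1))
      = (Fintype.card S : ℝ)⁻¹ * ∑ y, escape A y * f y := by
  simp only [statExp, pathExp, jumpAt, escape, consPath_zero, consPath_succ, Finset.sum_mul]
  congr 1
  rw [Finset.sum_comm]
  refine Finset.sum_congr rfl fun y _ => Finset.sum_congr rfl fun x _ => ?_
  rw [hA.symm x y]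
  by_cases h : x = y
  · simp [h]
  · simp [h, Ne.symm h]

lemma statExp_jumpInto_mul (hA : IsSymmStochastic A) (z : S) (f : S → ℝ) :
    statExp A 1 (fun ω => jumpInto z 0 ω * f (ω 1))
      = (Fintype.card S : ℝ)⁻¹ * (escape A z * f z) := by
  simp only [statExp, pathExp, jumpInto, escape, consPath_zero, consPath_succ, Finset.sum_mul]
  congr 1
  refine Finset.sum_congr rfl fun y _ => ?_
  rw [Finset.sum_eq_single z]
  · rw [hA.symm y z]
    by_cases h : y = z
    · simp [h]
    · simp [h, Ne.symm h]
  · intro x _ hx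
    simp [hx]
  · simp

lemma statExp_jumpInto (hA : IsSymmStochastic A) (z : S) {i n : ℕ} (h : i < n) :
    statExp A n (jumpInto z i) = (Fintype.card S : ℝ)⁻¹ * escape A z := by
  have h1 := statExp_shiftPath hA (i := i) (n := n) (dependsOn_jumpInto_zero z) (by omega)
  simp only [jumpInto_shiftPath, add_zero] at h1
  have h2 := statExp_jumpInto_mul hA z (fun _ => 1)
  simp only [mul_one] at h2
  exact h1.trans h2

lemma statExp_atSite (hA : IsSymmStochastic A) (z : S) {i n : ℕ} (h : i ≤ n) :
    statExp A n (atSite z i) = (Fintype.card S : ℝ)⁻¹ := by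
  have h1 := statExp_shiftPath hA (i := i) (n := n) (dependsOn_atSite_zero z) (by omega)
  simp only [atSite_shiftPath, add_zero] at h1
  refine h1.trans ?_
  simp [statExp, pathExp, atSite]

lemma statExp_jumpInto_mul_jumpAt (hA : IsSymmStochastic A) (z : S) {i k n : ℕ}
    (h : i + 1 + k < n) : statExp A n (fun ω => jumpInto z i ω * jumpAt (i + 1 + k) ω)
      = (Fintype.card S : ℝ)⁻¹ * (escape A z * ((A ^ k).mulVec (escape A)) z) := by
  have h1 := statExp_mul_shiftPath hA (i := i) (j := k) (n := n)
    (dependsOn_jumpInto_zero z) dependsOn_jumpAt_zero (by omega)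
  simp only [jumpInto_shiftPath, jumpAt_shiftPath, add_zero] at h1
  rw [h1, statExp_jumpInto_mul hA,
    show pathExp A 1 (jumpAt 0) = escape A from funext pathExp_jumpAt]

lemma statExp_jumpAt_mul_jumpOutOf (hA : IsSymmStochastic A) (z : S) {i k n : ℕ}
    (h : i + 1 + k < n) : statExp A n (fun ω => jumpAt i ω * jumpOutOf z (i + 1 + k) ω)
      = (Fintype.card S : ℝ)⁻¹ * (escape A z * ((A ^ k).mulVec (escape A)) z) := by
  have h1 := statExp_mul_shiftPath hA (i := i) (j := k) (n := n)
    dependsOn_jumpAt_zero (dependsOn_jumpOutOf_zero z) (by omega)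
  simp only [jumpOutOf_shiftPath, jumpAt_shiftPath, add_zero] at h1
  rw [h1, statExp_jumpAt_mul hA, (hA.pow k).sum_mul_mulVec]
  simp [pathExp_jumpOutOf, mul_comm]

lemma statExp_atSite_zero_mul_jumpAt (hA : IsSymmStochastic A) (z : S) {k n : ℕ}
    (h : k < n) : statExp A n (fun ω => atSite z 0 ω * jumpAt k ω)
      = (Fintype.card S : ℝ)⁻¹ * ((A ^ k).mulVec (escape A)) z := by
  have h1 := statExp_mul_shiftPath hA (i := 0) (j := k) (n := n)
    (dependsOn_atSite_zero z) dependsOn_jumpAt_zero (by omega)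
  simp only [atSite_shiftPath, jumpAt_shiftPath, add_zero, zero_add] at h1
  rw [h1, show pathExp A 1 (jumpAt 0) = escape A from funext pathExp_jumpAt]
  simp [statExp, pathExp, atSite]

lemma statExp_jumpAt_mul_atSite (hA : IsSymmStochastic A) (z : S) {i k n : ℕ}
    (h : i + 1 + k ≤ n) : statExp A n (fun ω => jumpAt i ω * atSite z (i + 1 + k) ω)
      = (Fintype.card S : ℝ)⁻¹ * ((A ^ k).mulVec (escape A)) z := by
  have h1 := statExp_mul_shiftPath hA (i := i) (j := k) (n := n)
    dependsOn_jumpAt_zero (dependsOn_atSite_zero z) (by omega)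
  simp only [atSite_shiftPath, jumpAt_shiftPath, add_zero] at h1
  rw [h1, statExp_jumpAt_mul hA, (hA.pow k).sum_mul_mulVec]
  simp [pathExp_atSite]

lemma statExp_hits_le (hA : IsSymmStochastic A) (z : S) (n : ℕ) :
    statExp A n (hits z n) ≤ (Fintype.card S : ℝ)⁻¹ * (1 + n * escape A z) := by
  refine (statExp_mono hA n (hits_le z n)).trans ?_
  rw [statExp_add, statExp_sum, statExp_atSite hA z (by omega),
    Finset.sum_congr rfl fun i hi => statExp_jumpInto hA z (Finset.mem_range.1 hi)]
  simp only [Finset.sum_const, Finset.card_range, nsmul_eq_mul]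
  exact le_of_eq (by ring)

/-- The Green function `∑_{k<n} A^k` applied to the escape probability. -/
def greenEscape (A : Matrix S S ℝ) (n : ℕ) (z : S) : ℝ :=
  ∑ k ∈ Finset.range n, ((A ^ k).mulVec (escape A)) z

lemma greenEscape_nonneg (hA : IsSymmStochastic A) (n : ℕ) (z : S) : 0 ≤ greenEscape A n z :=
  Finset.sum_nonneg fun k _ => (hA.pow k).mulVec_nonneg (escape_nonneg hA) z

lemma greenEscape_mono (hA : IsSymmStochastic A) {m n : ℕ} (h : m ≤ n) (z : S) :
    greenEscape A m z ≤ greenEscape A n z :=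
  Finset.sum_le_sum_of_subset_of_nonneg (Finset.range_mono h)
    fun k _ _ => (hA.pow k).mulVec_nonneg (escape_nonneg hA) z

lemma sum_statExp_jumpInto_mul_jumpAt (hA : IsSymmStochastic A) (z : S) {i n : ℕ} (hi : i < n) :
    ∑ j ∈ Finset.range i, statExp A n (fun ω => jumpInto z j ω * jumpAt i ω)
      = (Fintype.card S : ℝ)⁻¹ * (escape A z * greenEscape A i z) := by
  rw [greenEscape, ← Finset.sum_range_reflect, Finset.mul_sum, Finset.mul_sum]
  refine Finset.sum_congr rfl fun j hj => ?_
  have hj := Finset.mem_range.1 hj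
  have h := statExp_jumpInto_mul_jumpAt hA z (i := i - 1 - j) (k := j) (n := n) (by omega)
  rwa [show i - 1 - j + 1 + j = i by omega] at h

lemma sum_statExp_jumpAt_mul_jumpOutOf (hA : IsSymmStochastic A) (z : S) (i n : ℕ) :
    ∑ j ∈ Finset.Ico (i + 1) n, statExp A n (fun ω => jumpAt i ω * jumpOutOf z j ω)
      = (Fintype.card S : ℝ)⁻¹ * (escape A z * greenEscape A (n - (i + 1)) z) := by
  rw [greenEscape, Finset.sum_Ico_eq_sum_range, Finset.mul_sum, Finset.mul_sum]
  refine Finset.sum_congr rfl fun j hj => ?_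
  have hj := Finset.mem_range.1 hj
  exact statExp_jumpAt_mul_jumpOutOf hA z (by omega)

lemma statExp_jumpAt_mul_hits_le (hA : IsSymmStochastic A) (z : S) {i n : ℕ} (hi : i < n) :
    statExp A n (fun ω => jumpAt i ω * hits z n ω) ≤ (Fintype.card S : ℝ)⁻¹ *
      (((A ^ i).mulVec (escape A)) z + escape A z * greenEscape A n z
        + (escape A z * greenEscape A n z + ((A ^ (n - 1 - i)).mulVec (escape A)) z)) := by
  have hρ := escape_nonneg hA z
  calc statExp A n (fun ω => jumpAt i ω * hits z n ω)
      ≤ statExp A n (fun ω => (atSite z 0 ω * jumpAt i ω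
          + ∑ j ∈ Finset.range i, jumpInto z j ω * jumpAt i ω)
          + (∑ j ∈ Finset.Ico (i + 1) n, jumpAt i ω * jumpOutOf z j ω
            + jumpAt i ω * atSite z n ω)) := by
        refine statExp_mono hA n fun ω => ?_
        refine (mul_le_mul_of_nonneg_left (hits_le_add z i n ω) (jumpAt_nonneg i ω)).trans ?_
        rw [← Finset.sum_mul, ← Finset.mul_sum]
        exact le_of_eq (by ring)
    _ ≤ _ := by
        simp only [statExp_add, statExp_sum]
        rw [statExp_atSite_zero_mul_jumpAt hA z hi]
        have hend := statExp_jumpAt_mul_atSite hA z (i := i) (k := n - 1 - i) (n := n) (by omega)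
        rw [show i + 1 + (n - 1 - i) = n by omega] at hend
        rw [sum_statExp_jumpInto_mul_jumpAt hA z hi, sum_statExp_jumpAt_mul_jumpOutOf hA z,
          hend, ← mul_add, ← mul_add, ← mul_add]
        refine mul_le_mul_of_nonneg_left ?_ (by positivity)
        have hbefore := mul_le_mul_of_nonneg_left (greenEscape_mono hA (by omega : i ≤ n) z) hρ
        have hafter := mul_le_mul_of_nonneg_left
          (greenEscape_mono hA (by omega : n - (i + 1) ≤ n) z) hρ
        linarith

lemma statExp_one_add_numJumps_mul_hits_le (hA : IsSymmStochastic A) (z : S) (n : ℕ) :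
    statExp A n (fun ω => (1 + numJumps n ω) * hits z n ω)
      ≤ (Fintype.card S : ℝ)⁻¹ * ((1 + n * escape A z) * (1 + 2 * greenEscape A n z)) := by
  have e : (fun ω : ℕ → S => (1 + numJumps n ω) * hits z n ω)
      = fun ω => hits z n ω + ∑ i ∈ Finset.range n, jumpAt i ω * hits z n ω := by
    funext ω
    rw [numJumps, add_mul, one_mul, Finset.sum_mul]
  rw [e, statExp_add, statExp_sum]
  have h1 := statExp_hits_le hA z n
  have h2 := Finset.sum_le_sum fun i (hi : i ∈ Finset.range n) =>
    statExp_jumpAt_mul_hits_le hA z (Finset.mem_range.1 hi)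
  rw [← Finset.mul_sum, Finset.sum_add_distrib, Finset.sum_add_distrib, Finset.sum_add_distrib,
    Finset.sum_range_reflect (fun k => ((A ^ k).mulVec (escape A)) z)] at h2
  simp only [Finset.sum_const, Finset.card_range, nsmul_eq_mul] at h2
  rw [← greenEscape] at h2
  refine (add_le_add h1 h2).trans (le_of_eq ?_)
  ring

lemma one_add_two_mul_greenEscape_eq_sum (hA : IsSymmStochastic A) {n : ℕ} (hn : n ≠ 0) (z : S) :
    1 + 2 * greenEscape A n z
      = ∑ k ∈ Finset.range n, (n : ℝ)⁻¹ * ((A ^ k).mulVec fun y => 1 + 2 * n * escape A y) z := by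
  have haffine : ∀ k, ((A ^ k).mulVec fun y => 1 + 2 * n * escape A y) z
      = 1 + 2 * n * ((A ^ k).mulVec (escape A)) z := by
    intro k
    simp only [Matrix.mulVec, dotProduct, mul_add, Finset.sum_add_distrib, mul_one,
      (hA.pow k).row_sum z, Finset.mul_sum]
    congr 1
    exact Finset.sum_congr rfl fun y _ => mul_left_comm _ _ _
  simp only [haffine, greenEscape, mul_add, Finset.sum_add_distrib, ← Finset.mul_sum,
    Finset.sum_const, Finset.card_range, nsmul_eq_mul]
  field_simp

lemma one_add_two_mul_greenEscape_pow_le (hA : IsSymmStochastic A) {n : ℕ} (hn : n ≠ 0) (p : ℕ)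
    (z : S) : (1 + 2 * greenEscape A n z) ^ p ≤ ∑ k ∈ Finset.range n, (n : ℝ)⁻¹ *
      ((A ^ k).mulVec fun y => (1 + 2 * n * escape A y) ^ p) z := by
  have hf : ∀ y, 0 ≤ 1 + 2 * n * escape A y := fun y => by
    have := escape_nonneg hA y; positivity
  rw [one_add_two_mul_greenEscape_eq_sum hA hn]
  refine (Real.pow_arith_mean_le_arith_mean_pow _ _ _ (fun _ _ => by positivity) ?_
    (fun k _ => (hA.pow k).mulVec_nonneg hf z) p).trans ?_
  · simp [hn]
  · exact Finset.sum_le_sum fun k _ => mul_le_mul_of_nonneg_left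
      ((hA.pow k).mulVec_pow_le hf p z) (by positivity)

lemma sum_one_add_greenEscape_pow_le (hA : IsSymmStochastic A) (n p : ℕ) :
    ∑ z, (1 + 2 * greenEscape A n z) ^ p ≤ ∑ z, (1 + 2 * n * escape A z) ^ p := by
  rcases eq_or_ne n 0 with rfl | hn
  · simp [greenEscape]
  refine (Finset.sum_le_sum fun z _ => one_add_two_mul_greenEscape_pow_le hA hn p z).trans
    (le_of_eq ?_)
  rw [Finset.sum_comm]
  simp only [← Finset.mul_sum, (hA.pow _).sum_mulVec]
  simp [hn]

lemma sum_statExp_mul_hits_pow_le (hA : IsSymmStochastic A) (n p : ℕ) :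
    ∑ z, ((Fintype.card S : ℝ) * statExp A n (fun ω => (1 + numJumps n ω) * hits z n ω)) ^ p
      ≤ ∑ z, (1 + 2 * n * escape A z) ^ (2 * p) := by
  have hcard : ∀ _z : S, (Fintype.card S : ℝ) ≠ 0 := fun z =>
    have : Nonempty S := ⟨z⟩
    Nat.cast_ne_zero.2 Fintype.card_ne_zero
  calc _ ≤ ∑ z, ((1 + n * escape A z) * (1 + 2 * greenEscape A n z)) ^ p := by
        refine Finset.sum_le_sum fun z _ => pow_le_pow_left₀ ?_ ?_ p
        · exact mul_nonneg (by positivity) (statExp_nonneg hA n fun ω =>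
            mul_nonneg (by linarith [numJumps_nonneg n ω]) (hits_nonneg z n ω))
        · refine (mul_le_mul_of_nonneg_left (statExp_one_add_numJumps_mul_hits_le hA z n)
            (by positivity)).trans (le_of_eq ?_)
          rw [← mul_assoc, mul_inv_cancel₀ (hcard z), one_mul]
    _ ≤ ∑ z, ((1 + 2 * n * escape A z) ^ (2 * p) + (1 + 2 * greenEscape A n z) ^ (2 * p)) / 2 := by
        refine Finset.sum_le_sum fun z _ => ?_
        have h0 := escape_nonneg hA z
        have h1 : (1 + n * escape A z) ^ p ≤ (1 + 2 * n * escape A z) ^ p :=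
          pow_le_pow_left₀ (by positivity)
            (by have : 0 ≤ n * escape A z := by positivity
                linarith) p
        have h2 : 0 ≤ (1 + 2 * greenEscape A n z) ^ p := by
          have := greenEscape_nonneg hA n z
          positivity
        rw [mul_pow, pow_mul', pow_mul']
        nlinarith [sq_nonneg ((1 + 2 * n * escape A z) ^ p - (1 + 2 * greenEscape A n z) ^ p),
          mul_le_mul_of_nonneg_right h1 h2]
    _ ≤ _ := by
        rw [← Finset.sum_div, Finset.sum_add_distrib]
        have := sum_one_add_greenEscape_pow_le hA n (2 * p)
        linarith

end Stationary

/-! ### The Efron–Stein inequality -/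

section EfronStein

variable {Ω : Type*} {n : ℕ}

lemma dependsOn_fin_cons {β : Type*} {g : (Fin (n + 1) → Ω) → β} {i : Fin n}
    (hg : DependsOn g {i.succ}ᶜ) (x : Ω) : DependsOn (fun y => g (Fin.cons x y)) {i}ᶜ :=
  fun y y' h => hg fun j hj => by
    induction j using Fin.cases with
    | zero => rfl
    | succ j => exact h j fun hji => hj (congrArg Fin.succ hji)

lemma fin_cons_eq_of_dependsOn {β : Type*} {g : (Fin (n + 1) → Ω) → β} (hg : DependsOn g {0}ᶜ)
    (x x' : Ω) (y : Fin n → Ω) : g (Fin.cons x y) = g (Fin.cons x' y) :=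
  hg fun j hj => by
    induction j using Fin.cases with
    | zero => exact absurd rfl hj
    | succ j => rfl

variable [MeasurableSpace Ω]

lemma integrable_of_bounded {μ : Measure Ω} [IsFiniteMeasure μ] {f : Ω → ℝ}
    (hf : Measurable f) {C : ℝ} (hC : ∀ x, |f x| ≤ C) : Integrable f μ :=
  Integrable.of_bound hf.aestronglyMeasurable C (Eventually.of_forall hC)

lemma memLp_of_abs_le {μ : Measure Ω} [IsFiniteMeasure μ] {p : ℝ≥0∞} {f : Ω → ℝ}
    (hf : Measurable f) {C : ℝ} (hC : ∀ x, |f x| ≤ C) : MemLp f p μ :=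
  MemLp.of_bound hf.aestronglyMeasurable C (Eventually.of_forall hC)

lemma abs_integral_le_of_abs_le {μ : Measure Ω} [IsProbabilityMeasure μ] {f : Ω → ℝ} {C : ℝ}
    (hC : ∀ x, |f x| ≤ C) : |∫ x, f x ∂μ| ≤ C := by
  simpa using norm_integral_le_of_norm_le_const (μ := μ) (f := f) (Eventually.of_forall hC)

lemma variance_le_integral_sub_sq {μ : Measure Ω} [IsProbabilityMeasure μ] {f : Ω → ℝ}
    (hf : AEStronglyMeasurable f μ) (c : ℝ) : Var[f; μ] ≤ ∫ x, (f x - c) ^ 2 ∂μ := by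
  rw [← variance_sub_const hf c]
  exact variance_le_expectation_sq (hf.sub aestronglyMeasurable_const)

lemma sq_integral_le {μ : Measure Ω} [IsProbabilityMeasure μ] {f : Ω → ℝ} (hf : MemLp f 2 μ) :
    (∫ x, f x ∂μ) ^ 2 ≤ ∫ x, f x ^ 2 ∂μ := by
  have h := variance_nonneg f μ
  rw [variance_eq_sub hf] at h
  exact sub_nonneg.1 h

section FinCons

variable {f : (Fin (n + 1) → Ω) → ℝ}

lemma measurable_fin_cons :
    Measurable fun p : Ω × (Fin n → Ω) => (Fin.cons p.1 p.2 : Fin (n + 1) → Ω) :=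
  measurable_pi_lambda _ fun i => Fin.cases (by simpa using measurable_fst)
    (fun i => by simpa using measurable_snd.eval) i

lemma measurable_comp_fin_cons (hf : Measurable f) (y : Fin n → Ω) :
    Measurable fun x => f (Fin.cons x y) :=
  hf.comp (measurable_fin_cons.comp measurable_prodMk_right)

lemma measurable_integral_fin_cons (μ : Measure Ω) [SFinite μ] (hf : Measurable f) :
    Measurable fun y : Fin n → Ω => ∫ x, f (Fin.cons x y) ∂μ :=
  ((hf.comp measurable_fin_cons).stronglyMeasurable.integral_prod_left').measurable

variable {C : ℝ} {μ : Fin (n + 1) → Measure Ω} [∀ i, IsProbabilityMeasure (μ i)]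

lemma integral_pi_fin_succ (hf : Measurable f) (hC : ∀ x, |f x| ≤ C) :
    ∫ x, f x ∂(Measure.pi μ)
      = ∫ y, ∫ x, f (Fin.cons x y) ∂(μ 0) ∂(Measure.pi fun i : Fin n => μ i.succ) := by
  have hcons : ∀ p : Ω × (Fin n → Ω),
      (MeasurableEquiv.piFinSuccAbove (fun _ => Ω) 0).symm p = Fin.cons p.1 p.2 := fun p => by
    simp [MeasurableEquiv.piFinSuccAbove, Fin.insertNthEquiv]
  rw [← ((measurePreserving_piFinSuccAbove μ 0).symm _).integral_comp
    (MeasurableEquiv.measurableEmbedding _) f]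
  simp only [hcons, Fin.succAbove_zero]
  exact integral_prod_symm _ (integrable_of_bounded (hf.comp measurable_fin_cons) fun p => hC _)

lemma variance_pi_fin_succ (hf : Measurable f) (hC : ∀ x, |f x| ≤ C) :
    Var[f; Measure.pi μ]
      = ∫ y, Var[fun x => f (Fin.cons x y); μ 0] ∂(Measure.pi fun i : Fin n => μ i.succ)
        + Var[fun y => ∫ x, f (Fin.cons x y) ∂(μ 0); Measure.pi fun i : Fin n => μ i.succ] := by
  have hC2 : ∀ x, |f x ^ 2| ≤ C ^ 2 := fun x => by
    rw [abs_pow]; exact pow_le_pow_left₀ (abs_nonneg _) (hC x) 2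
  have hmean := memLp_of_abs_le (μ := Measure.pi fun i : Fin n => μ i.succ) (p := 2)
    (measurable_integral_fin_cons (μ 0) hf) fun y => abs_integral_le_of_abs_le fun x => hC _
  have hslice : ∀ y, Var[fun x => f (Fin.cons x y); μ 0]
      = ∫ x, f (Fin.cons x y) ^ 2 ∂(μ 0) - (∫ x, f (Fin.cons x y) ∂(μ 0)) ^ 2 := fun y =>
    variance_eq_sub (memLp_of_abs_le (measurable_comp_fin_cons hf y) fun x => hC _)
  have hsq : Integrable (fun y => ∫ x, f (Fin.cons x y) ^ 2 ∂(μ 0))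
      (Measure.pi fun i : Fin n => μ i.succ) :=
    integrable_of_bounded (measurable_integral_fin_cons (μ 0) (hf.pow_const 2))
      fun y => abs_integral_le_of_abs_le fun x => hC2 _
  simp only [hslice]
  rw [variance_eq_sub (memLp_of_abs_le hf hC), variance_eq_sub hmean,
    integral_sub hsq hmean.integrable_sq, ← integral_pi_fin_succ hf hC]
  simp only [Pi.pow_apply]
  rw [integral_pi_fin_succ (hf.pow_const 2) hC2]
  ring

end FinCons

lemma sq_abs_sub_le {C u v : ℝ} (hu : |u| ≤ C) (hv : |v| ≤ C) : |(u - v) ^ 2| ≤ (2 * C) ^ 2 := by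
  rw [abs_pow]
  exact pow_le_pow_left₀ (abs_nonneg _) ((abs_sub _ _).trans (by linarith)) 2

lemma variance_le_sum_integral_sub_sq_fin {C : ℝ} : ∀ {n : ℕ} {μ : Fin n → Measure Ω}
    [∀ i, IsProbabilityMeasure (μ i)] {f : (Fin n → Ω) → ℝ} {g : Fin n → (Fin n → Ω) → ℝ},
    Measurable f → (∀ i, Measurable (g i)) → (∀ x, |f x| ≤ C) → (∀ i x, |g i x| ≤ C) →
    (∀ i, DependsOn (g i) {i}ᶜ) →
    Var[f; Measure.pi μ] ≤ ∑ i, ∫ x, (f x - g i x) ^ 2 ∂(Measure.pi μ)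
  | 0, μ, _, f, _, hf, _, _, _, _ => by
      refine (variance_le_integral_sub_sq hf.aestronglyMeasurable (f default)).trans_eq ?_
      simp [fun x => congrArg f (Subsingleton.elim x default)]
  | n + 1, μ, _, f, g, hf, hg, hfC, hgC, hd => by
      have hsub : ∀ i, Measurable fun x => (f x - g i x) ^ 2 := fun i =>
        (hf.sub (hg i)).pow_const 2
      have hsubC : ∀ i x, |(f x - g i x) ^ 2| ≤ (2 * C) ^ 2 := fun i x =>
        sq_abs_sub_le (hfC x) (hgC i x)
      have hint : ∀ i, Integrable (fun y => ∫ x, (f (Fin.cons x y) - g i (Fin.cons x y)) ^ 2 ∂(μ 0))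
          (Measure.pi fun i : Fin n => μ i.succ) := fun i =>
        integrable_of_bounded (measurable_integral_fin_cons (μ 0) (hsub i))
          fun y => abs_integral_le_of_abs_le fun x => hsubC i _
      have ih := variance_le_sum_integral_sub_sq_fin (μ := fun i => μ i.succ)
        (f := fun y => ∫ x, f (Fin.cons x y) ∂(μ 0))
        (g := fun i y => ∫ x, g i.succ (Fin.cons x y) ∂(μ 0))
        (measurable_integral_fin_cons _ hf) (fun i => measurable_integral_fin_cons _ (hg _))
        (fun y => abs_integral_le_of_abs_le fun x => hfC _)
        (fun i y => abs_integral_le_of_abs_le fun x => hgC _ _)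
        (fun i y y' h => integral_congr_ae (Eventually.of_forall fun x =>
          dependsOn_fin_cons (hd i.succ) x h))
      rw [variance_pi_fin_succ hf hfC, Fin.sum_univ_succ, integral_pi_fin_succ (hsub 0) (hsubC 0)]
      refine add_le_add (integral_mono_of_nonneg (Eventually.of_forall fun y => variance_nonneg _ _)
        (hint 0) (Eventually.of_forall fun y => ?_)) (ih.trans (Finset.sum_le_sum fun i _ => ?_))
      · obtain ⟨x₀⟩ := nonempty_of_isProbabilityMeasure (μ 0)
        simp only [fin_cons_eq_of_dependsOn (hd 0) _ x₀ y]
        exact variance_le_integral_sub_sq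
          (measurable_comp_fin_cons hf y).aestronglyMeasurable _
      · rw [integral_pi_fin_succ (hsub i.succ) (hsubC i.succ)]
        refine integral_mono_of_nonneg (Eventually.of_forall fun y => sq_nonneg _) (hint i.succ)
          (Eventually.of_forall fun y => ?_)
        have hfy := measurable_comp_fin_cons hf y
        have hgy := measurable_comp_fin_cons (hg i.succ) y
        simp only
        rw [← integral_sub (integrable_of_bounded hfy fun x => hfC _)
          (integrable_of_bounded hgy fun x => hgC _ _)]
        exact sq_integral_le (memLp_of_abs_le (hfy.sub hgy) (C := 2 * C) fun x =>
          (abs_sub _ _).trans (by linarith [hfC (Fin.cons x y), hgC i.succ (Fin.cons x y)]))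

lemma variance_le_sum_integral_sub_sq {ι : Type*} [Fintype ι] {μ : ι → Measure Ω}
    [∀ i, IsProbabilityMeasure (μ i)] {C : ℝ} {f : (ι → Ω) → ℝ} {g : ι → (ι → Ω) → ℝ}
    (hf : Measurable f) (hg : ∀ i, Measurable (g i)) (hfC : ∀ x, |f x| ≤ C)
    (hgC : ∀ i x, |g i x| ≤ C) (hd : ∀ i, DependsOn (g i) {i}ᶜ) :
    Var[f; Measure.pi μ] ≤ ∑ i, ∫ x, (f x - g i x) ^ 2 ∂(Measure.pi μ) := by
  let e : Fin (Fintype.card ι) ≃ ι := (Fintype.equivFin ι).symm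
  let T := MeasurableEquiv.piCongrLeft (fun _ : ι => Ω) e
  have hT : MeasurePreserving T (Measure.pi fun i => μ (e i)) (Measure.pi μ) :=
    measurePreserving_piCongrLeft μ e
  have hTe : ∀ x i, T x (e i) = x i := fun x i =>
    MeasurableEquiv.piCongrLeft_apply_apply (e := e) (β := fun _ => Ω) x i
  have hfin := variance_le_sum_integral_sub_sq_fin (μ := fun i => μ (e i)) (C := C)
    (f := fun x => f (T x)) (g := fun i x => g (e i) (T x))
    (hf.comp T.measurable) (fun i => (hg _).comp T.measurable) (fun x => hfC _)
    (fun i x => hgC _ _) (fun i x x' h => hd (e i) fun j hj => by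
      obtain ⟨k, rfl⟩ := e.surjective j
      rw [hTe, hTe]
      exact h k fun hk => hj (congrArg e hk))
  rw [hT.variance_fun_comp hf.aemeasurable] at hfin
  simp only [fun i => hT.integral_comp T.measurableEmbedding fun x => (f x - g i x) ^ 2] at hfin
  exact hfin.trans_eq (Equiv.sum_comp e fun i => ∫ x, (f x - g i x) ^ 2 ∂(Measure.pi μ))

end EfronStein

/-! ### The Poincaré inequality on the hypercube -/

section Poincare

variable {N : ℕ}

/-- The neighbour of `x` that differs from it in the coordinate `i`. -/
def flip (i : Fin N) (x : V N) : V N := Function.update x i (!x i)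

lemma flip_flip (i : Fin N) (x : V N) : flip i (flip i x) = x := by
  simp [flip]

lemma eq_or_eq_flip {i : Fin N} {x x' : V N} (h : ∀ j ∈ ({i}ᶜ : Set (Fin N)), x j = x' j) :
    x' = x ∨ x' = flip i x := by
  by_cases hi : x' i = x i
  · left
    funext j
    by_cases hj : j = i
    · rw [hj, hi]
    · exact (h j hj).symm
  · right
    funext j
    by_cases hj : j = i
    · subst hj
      simpa only [flip, Function.update_self] using Bool.eq_not.2 hi
    · simp only [flip, Function.update_of_ne hj]
      exact (h j hj).symm

lemma card_V (N : ℕ) : (Fintype.card (V N) : ℝ) = 2 ^ N := by simp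

lemma integral_pi_uniformOfFintype_bool (f : V N → ℝ) :
    ∫ x, f x ∂(Measure.pi fun _ : Fin N => (PMF.uniformOfFintype Bool).toMeasure)
      = ((2 : ℝ) ^ N)⁻¹ * ∑ x, f x := by
  rw [integral_fintype Integrable.of_finite, Finset.mul_sum]
  refine Finset.sum_congr rfl fun x _ => ?_
  rw [Measure.real, Measure.pi_singleton]
  simp

-- Efron–Stein for uniform bits, comparing `f` with its average over the `i`-th bit.
lemma four_mul_sum_sq_le (f : V N → ℝ) (hf : ∑ x, f x = 0) :
    4 * ∑ x, f x ^ 2 ≤ ∑ x, ∑ i, (f x - f (flip i x)) ^ 2 := by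
  have hb : ∀ x, |f x| ≤ ∑ x, |f x| := fun x =>
    Finset.single_le_sum (f := fun x => |f x|) (fun _ _ => abs_nonneg _) (Finset.mem_univ x)
  have h := variance_le_sum_integral_sub_sq
    (μ := fun _ : Fin N => (PMF.uniformOfFintype Bool).toMeasure)
    (g := fun i x => (f x + f (flip i x)) / 2) (measurable_of_finite f)
    (fun i => measurable_of_finite _) hb
    (fun i x => by
      rw [abs_div, abs_two]
      linarith [abs_add_le (f x) (f (flip i x)), hb x, hb (flip i x)])
    (fun i x x' hxx => by
      rcases eq_or_eq_flip hxx with h | h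
      · rw [h]
      · simp only [h, flip_flip, add_comm])
  have hmid : ∀ x i, (f x - (f x + f (flip i x)) / 2) ^ 2 = (f x - f (flip i x)) ^ 2 / 4 :=
    fun x i => by ring
  rw [variance_of_integral_eq_zero (measurable_of_finite f).aemeasurable
    (by rw [integral_pi_uniformOfFintype_bool, hf, mul_zero])] at h
  simp only [integral_pi_uniformOfFintype_bool, ← Finset.mul_sum] at h
  have hsum := le_of_mul_le_mul_left h (by positivity)
  rw [Finset.sum_comm] at hsum
  simp only [hmid, ← Finset.sum_div] at hsum
  linarith

end Poincare

/-! ### The discretized walk on the hypercube -/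

section Kernel

variable {N : ℕ}

lemma hammingDist_flip (i : Fin N) (x : V N) : hammingDist x (flip i x) = 1 := by
  rw [hammingDist, Finset.card_eq_one]
  refine ⟨i, Finset.ext fun j => ?_⟩
  have key : x j ≠ flip i x j ↔ j = i := by
    by_cases h : j = i
    · subst h; simp [flip]
    · simp [flip, h]
  simpa using key

lemma exists_flip {x y : V N} (h : hammingDist x y = 1) : ∃ i, y = flip i x := by
  rw [hammingDist, Finset.card_eq_one] at h
  obtain ⟨i, hi⟩ := h
  have key : ∀ j, x j ≠ y j ↔ j = i := fun j => by
    simpa using Finset.ext_iff.1 hi j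
  refine ⟨i, ?_⟩
  rcases eq_or_eq_flip (i := i) (x := x) (x' := y) (fun j hj => by
    by_contra hne; exact hj ((key j).1 hne)) with h | h
  · exact absurd (congrFun h i).symm ((key i).2 rfl)
  · exact h

lemma flip_injective (x : V N) : Function.Injective fun i => flip i x := by
  intro i j h
  by_contra hij
  have := congrFun h i
  simp [flip, Function.update_of_ne hij] at this

lemma sum_neighbours (x : V N) (f : V N → ℝ) :
    ∑ y, (if hammingDist x y = 1 then f y else 0) = ∑ i, f (flip i x) := by
  have himage : Finset.univ.filter (fun y => hammingDist x y = 1)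
      = Finset.univ.image fun i => flip i x := by
    ext y
    simp only [Finset.mem_filter, Finset.mem_univ, true_and, Finset.mem_image]
    exact ⟨fun h => (exists_flip h).imp fun i hi => hi.symm,
      fun ⟨i, hi⟩ => hi ▸ hammingDist_flip i x⟩
  rw [← Finset.sum_filter, himage, Finset.sum_image fun i _ j _ h => flip_injective x h]

/-- Total jump rate out of `x`. -/
def exitRate (a : ℝ) (e : V N → ℝ) (x : V N) : ℝ := ∑ z, rate a e x z

/-- Jump probability from `x` to `y` of the walk with time step `1 / q`. The cap `1 / (2 * N)`
makes the walk lazy in every environment and is not reached once `q` is large. -/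
def stepRate (a : ℝ) (e : V N → ℝ) (q : ℕ) (x y : V N) : ℝ :=
  min (rate a e x y / q) (1 / (2 * N))

/-- Transition matrix of the walk with time step `1 / q`. -/
def stepKernel (a : ℝ) (e : V N → ℝ) (q : ℕ) : Matrix (V N) (V N) ℝ :=
  Matrix.of fun x y => if x = y then 1 - ∑ z, stepRate a e q x z else stepRate a e q x y

lemma rate_nonneg (a : ℝ) (e : V N → ℝ) (x y : V N) : 0 ≤ rate a e x y := by
  unfold rate; split_ifs <;> positivity

lemma rate_symm (a : ℝ) (e : V N → ℝ) (x y : V N) : rate a e x y = rate a e y x := by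
  simp only [rate, hammingDist_comm x y, add_comm (e x)]

lemma rate_self (a : ℝ) (e : V N → ℝ) (x : V N) : rate a e x x = 0 := by
  simp [rate]

lemma stepRate_nonneg (a : ℝ) (e : V N → ℝ) (q : ℕ) (x y : V N) : 0 ≤ stepRate a e q x y :=
  le_min (div_nonneg (rate_nonneg a e x y) (by positivity)) (by positivity)

lemma stepRate_symm (a : ℝ) (e : V N → ℝ) (q : ℕ) (x y : V N) :
    stepRate a e q x y = stepRate a e q y x := by
  simp only [stepRate, rate_symm a e x y]

lemma stepRate_eq_zero (a : ℝ) (e : V N → ℝ) (q : ℕ) {x y : V N} (h : hammingDist x y ≠ 1) :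
    stepRate a e q x y = 0 := by
  simp only [stepRate, rate, h, if_false, zero_div]
  exact min_eq_left (by positivity)

lemma sum_stepRate_le (a : ℝ) (e : V N → ℝ) (q : ℕ) (x : V N) :
    ∑ z, stepRate a e q x z ≤ 1 / 2 := by
  calc ∑ z, stepRate a e q x z
      ≤ ∑ z, (if hammingDist x z = 1 then (1 / (2 * N) : ℝ) else 0) := by
        refine Finset.sum_le_sum fun z _ => ?_
        split_ifs with h
        · exact min_le_right _ _
        · exact (stepRate_eq_zero a e q h).le
    _ = N * (1 / (2 * N)) := by rw [sum_neighbours]; simp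
    _ ≤ 1 / 2 := by
        rcases Nat.eq_zero_or_pos N with rfl | h
        · norm_num
        · have : (0 : ℝ) < N := by exact_mod_cast h
          exact le_of_eq (by field_simp)

lemma stepKernel_self (a : ℝ) (e : V N → ℝ) (q : ℕ) (x : V N) :
    stepKernel a e q x x = 1 - ∑ z, stepRate a e q x z := by simp [stepKernel]

lemma stepKernel_of_ne (a : ℝ) (e : V N → ℝ) (q : ℕ) {x y : V N} (h : x ≠ y) :
    stepKernel a e q x y = stepRate a e q x y := by simp [stepKernel, h]

lemma stepRate_self (a : ℝ) (e : V N → ℝ) (q : ℕ) (x : V N) : stepRate a e q x x = 0 :=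
  stepRate_eq_zero a e q (by simp)

lemma half_le_stepKernel_self (a : ℝ) (e : V N → ℝ) (q : ℕ) (x : V N) :
    1 / 2 ≤ stepKernel a e q x x := by
  rw [stepKernel_self]
  linarith [sum_stepRate_le a e q x]

lemma escape_stepKernel (a : ℝ) (e : V N → ℝ) (q : ℕ) (x : V N) :
    escape (stepKernel a e q) x = ∑ z, stepRate a e q x z := by
  refine Finset.sum_congr rfl fun z _ => ?_
  split_ifs with h
  · rw [← h, stepRate_self]
  · exact stepKernel_of_ne a e q h

lemma isSymmStochastic_stepKernel (a : ℝ) (e : V N → ℝ) (q : ℕ) :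
    IsSymmStochastic (stepKernel a e q) where
  nonneg x y := by
    by_cases h : x = y
    · subst h
      linarith [half_le_stepKernel_self a e q x]
    · rw [stepKernel_of_ne a e q h]
      exact stepRate_nonneg a e q x y
  row_sum x := by
    have h : ∀ y, stepKernel a e q x y
        = stepRate a e q x y + if x = y then 1 - ∑ z, stepRate a e q x z else 0 := by
      intro y
      by_cases h : x = y
      · subst h; simp [stepKernel_self, stepRate_self]
      · simp [stepKernel_of_ne a e q h, h]
    simp [h, Finset.sum_add_distrib]
  symm x y := by
    by_cases h : x = y
    · rw [h]
    · rw [stepKernel_of_ne a e q h, stepKernel_of_ne a e q (Ne.symm h), stepRate_symm]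

lemma escape_stepKernel_le (a : ℝ) (e : V N → ℝ) (q : ℕ) (x : V N) :
    escape (stepKernel a e q) x ≤ exitRate a e x / q := by
  rw [escape_stepKernel, exitRate, Finset.sum_div]
  exact Finset.sum_le_sum fun z _ => min_le_left _ _

lemma measurable_rate (a : ℝ) (x y : V N) : Measurable fun e : V N → ℝ => rate a e x y := by
  unfold rate
  split_ifs
  · fun_prop
  · exact measurable_const

lemma measurable_stepKernel (a : ℝ) (q : ℕ) (x y : V N) :
    Measurable fun e : V N → ℝ => stepKernel a e q x y := by
  have h : ∀ x y, Measurable fun e : V N → ℝ => stepRate a e q x y := fun x y =>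
    ((measurable_rate a x y).div_const _).min measurable_const
  by_cases hxy : x = y
  · subst hxy
    simp only [stepKernel_self]
    exact measurable_const.sub (Finset.measurable_sum _ fun z _ => h x z)
  · simp only [stepKernel_of_ne a _ q hxy]
    exact h x y

lemma stepKernel_eq_of_far (a : ℝ) {e e' : V N → ℝ} (q : ℕ) {y : V N}
    (he : ∀ z, z ≠ y → e z = e' z) {x : V N} (hx : ¬ hammingDist x y ≤ 1) (z : V N) :
    stepKernel a e q x z = stepKernel a e' q x z := by
  have hxy : x ≠ y := fun h => hx (by simp [h])
  have hr : ∀ z, stepRate a e q x z = stepRate a e' q x z := by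
    intro z
    by_cases h : hammingDist x z = 1
    · have hzy : z ≠ y := fun h' => hx (by rw [← h', h])
      simp only [stepRate, rate, he x hxy, he z hzy]
    · rw [stepRate_eq_zero a e q h, stepRate_eq_zero a e' q h]
  simp only [stepKernel, hr, Matrix.of_apply]

end Kernel

/-! ### Mixing -/

section SpectralGap

variable {S : Type*} [Fintype S] {A : Matrix S S ℝ}

-- `2 A - 1` is stochastic, hence a contraction.
lemma sum_mulVec_sq_le_of_lazy (hA : IsSymmStochastic A) (hlazy : ∀ x, 1 / 2 ≤ A x x)
    (f : S → ℝ) : ∑ x, (A.mulVec f x) ^ 2 ≤ ∑ x, f x * A.mulVec f x := by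
  classical
  let B : Matrix S S ℝ := fun x y => 2 * A x y - if x = y then 1 else 0
  have hB : IsSymmStochastic B := by
    refine ⟨fun x y => ?_, fun x => ?_, fun x y => ?_⟩
    · simp only [B]
      split_ifs with h
      · subst h; linarith [hlazy x]
      · linarith [hA.nonneg x y]
    · simp only [B, Finset.sum_sub_distrib, ← Finset.mul_sum, hA.row_sum]
      simp; norm_num
    · simp only [B, hA.symm x y, eq_comm]
  have e : ∀ x, B.mulVec f x = 2 * A.mulVec f x - f x := by
    intro x
    simp only [B, Matrix.mulVec, dotProduct, sub_mul, Finset.sum_sub_distrib, Finset.mul_sum]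
    simp [mul_assoc]
  have h1 : ∑ x, (B.mulVec f x) ^ 2 ≤ ∑ x, f x ^ 2 := by
    rw [← hB.sum_mulVec fun x => f x ^ 2]
    exact Finset.sum_le_sum fun x _ => Real.pow_arith_mean_le_arith_mean_pow_of_even _ _ _
      (fun y _ => hB.nonneg x y) (hB.row_sum x) even_two
  have h2 : ∑ x, (B.mulVec f x) ^ 2
      = 4 * ∑ x, (A.mulVec f x) ^ 2 - 4 * ∑ x, f x * A.mulVec f x + ∑ x, f x ^ 2 := by
    simp only [e, Finset.mul_sum]
    rw [← Finset.sum_sub_distrib, ← Finset.sum_add_distrib]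
    exact Finset.sum_congr rfl fun x _ => by ring
  linarith

lemma sum_sum_mul_sub_sq (hA : IsSymmStochastic A) (f : S → ℝ) :
    ∑ x, ∑ y, A x y * (f x - f y) ^ 2 = 2 * (∑ x, f x ^ 2 - ∑ x, f x * A.mulVec f x) := by
  have e : ∀ x, ∑ y, A x y * (f x - f y) ^ 2
      = f x ^ 2 - 2 * (f x * A.mulVec f x) + A.mulVec (fun y => f y ^ 2) x := by
    intro x
    have h1 : f x ^ 2 = ∑ y, A x y * f x ^ 2 := by rw [← Finset.sum_mul, hA.row_sum, one_mul]
    rw [h1]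
    simp only [Matrix.mulVec, dotProduct, Finset.mul_sum]
    rw [← Finset.sum_sub_distrib, ← Finset.sum_add_distrib]
    exact Finset.sum_congr rfl fun y _ => by ring
  simp only [e, Finset.sum_add_distrib, Finset.sum_sub_distrib, hA.sum_mulVec, ← Finset.mul_sum]
  ring

variable [DecidableEq S] {r : ℝ}

lemma sum_pow_mulVec_sq_le (hA : IsSymmStochastic A) (hr : 0 ≤ r)
    (hgap : ∀ f : S → ℝ, ∑ x, f x = 0 → ∑ x, (A.mulVec f x) ^ 2 ≤ r * ∑ x, f x ^ 2)
    {f : S → ℝ} (hf : ∑ x, f x = 0) (m : ℕ) :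
    ∑ x, ((A ^ m).mulVec f x) ^ 2 ≤ r ^ m * ∑ x, f x ^ 2 := by
  induction m with
  | zero => simp
  | succ m ih =>
    simp only [pow_succ' A, ← Matrix.mulVec_mulVec]
    refine (hgap _ (by rw [(hA.pow m).sum_mulVec, hf])).trans ?_
    refine (mul_le_mul_of_nonneg_left ih hr).trans (le_of_eq ?_)
    ring

lemma sq_pow_apply_sub_inv_card_le (hA : IsSymmStochastic A) (hr : 0 ≤ r)
    (hgap : ∀ f : S → ℝ, ∑ x, f x = 0 → ∑ x, (A.mulVec f x) ^ 2 ≤ r * ∑ x, f x ^ 2)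
    (m : ℕ) (x y : S) : ((A ^ m) x y - (Fintype.card S : ℝ)⁻¹) ^ 2 ≤ r ^ m := by
  have : Nonempty S := ⟨x⟩
  have hcard : (Fintype.card S : ℝ) ≠ 0 := Nat.cast_ne_zero.2 Fintype.card_ne_zero
  let c : ℝ := (Fintype.card S : ℝ)⁻¹
  let f : S → ℝ := fun z => (if z = y then 1 else 0) - c
  have hf : ∑ z, f z = 0 := by simp [f, c, hcard]
  have hf2 : ∑ z, f z ^ 2 ≤ 1 := by
    have hexpand : ∀ z, f z ^ 2 = (if z = y then 1 - c else 0) - c * f z := fun z => by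
      simp only [f]; split_ifs <;> ring
    simp only [hexpand, Finset.sum_sub_distrib, ← Finset.mul_sum, hf]
    simp [c]
  have happly : (A ^ m).mulVec f x = (A ^ m) x y - c := by
    simp only [Matrix.mulVec, dotProduct, f, mul_sub, Finset.sum_sub_distrib, ← Finset.sum_mul,
      (hA.pow m).row_sum, one_mul]
    simp
  calc ((A ^ m) x y - c) ^ 2 = ((A ^ m).mulVec f x) ^ 2 := by rw [happly]
    _ ≤ ∑ z, ((A ^ m).mulVec f z) ^ 2 := Finset.single_le_sum
        (f := fun z => ((A ^ m).mulVec f z) ^ 2) (fun z _ => sq_nonneg _) (Finset.mem_univ x)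
    _ ≤ r ^ m * ∑ z, f z ^ 2 := sum_pow_mulVec_sq_le hA hr hgap hf m
    _ ≤ r ^ m := mul_le_of_le_one_right (pow_nonneg hr m) hf2

end SpectralGap

section Mixing

variable {N : ℕ}

lemma inv_le_stepKernel_flip {a : ℝ} {e : V N → ℝ} (hN : 1 ≤ N) {q : ℕ} (hq : 2 * N ≤ q)
    (hrate : ∀ x y, hammingDist x y = 1 → 1 ≤ rate a e x y) {x y : V N}
    (h : hammingDist x y = 1) : (q : ℝ)⁻¹ ≤ stepKernel a e q x y := by
  have : (0 : ℝ) < N := by exact_mod_cast hN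
  have hq' : (2 * N : ℝ) ≤ q := by exact_mod_cast hq
  rw [stepKernel_of_ne a e q (by rintro rfl; simp at h), ← one_div]
  exact le_min (div_le_div_of_nonneg_right (hrate x y h) (by positivity))
    (one_div_le_one_div_of_le (by positivity) hq')

lemma sum_stepKernel_mulVec_sq_le {a : ℝ} {e : V N → ℝ} (hN : 1 ≤ N) {q : ℕ} (hq : 2 * N ≤ q)
    (hrate : ∀ x y, hammingDist x y = 1 → 1 ≤ rate a e x y) (f : V N → ℝ) (hf : ∑ x, f x = 0) :
    ∑ x, ((stepKernel a e q).mulVec f x) ^ 2 ≤ (1 - 2 / q) * ∑ x, f x ^ 2 := by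
  have hA := isSymmStochastic_stepKernel a e q
  have hdirichlet : (q : ℝ)⁻¹ * ∑ x, ∑ i, (f x - f (flip i x)) ^ 2
      ≤ ∑ x, ∑ y, stepKernel a e q x y * (f x - f y) ^ 2 := by
    simp only [Finset.mul_sum]
    refine Finset.sum_le_sum fun x _ => ?_
    rw [← sum_neighbours x fun y => (q : ℝ)⁻¹ * (f x - f y) ^ 2]
    refine Finset.sum_le_sum fun y _ => ?_
    split_ifs with h
    · exact mul_le_mul_of_nonneg_right (inv_le_stepKernel_flip hN hq hrate h) (sq_nonneg _)
    · exact mul_nonneg (hA.nonneg x y) (sq_nonneg _)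
  have hpoincare := mul_le_mul_of_nonneg_left (four_mul_sum_sq_le f hf)
    (inv_nonneg.2 (Nat.cast_nonneg (α := ℝ) q))
  calc ∑ x, ((stepKernel a e q).mulVec f x) ^ 2
      ≤ ∑ x, f x * (stepKernel a e q).mulVec f x :=
        sum_mulVec_sq_le_of_lazy hA (half_le_stepKernel_self a e q) f
    _ ≤ ∑ x, f x ^ 2 - 2 * ((q : ℝ)⁻¹ * ∑ x, f x ^ 2) := by
        linarith [sum_sum_mul_sub_sq hA f]
    _ = (1 - 2 / q) * ∑ x, f x ^ 2 := by ring

lemma one_sub_two_div_pow_le {q m : ℕ} (hq : 2 ≤ q) (hm : 2 * N * q ≤ m) :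
    (1 - 2 / q : ℝ) ^ m ≤ (((2 : ℝ) ^ N)⁻¹ * ((2 : ℝ) ^ N)⁻¹) ^ 2 := by
  have hq' : (2 : ℝ) ≤ q := by exact_mod_cast hq
  have hm' : (2 * N * q : ℝ) ≤ m := by exact_mod_cast hm
  calc (1 - 2 / q : ℝ) ^ m ≤ (Real.exp (-(2 / q))) ^ m :=
        pow_le_pow_left₀ (by rw [sub_nonneg, div_le_one (by linarith)]; exact hq')
          (Real.one_sub_le_exp_neg _) m
    _ = Real.exp (-(2 * m / q)) := by rw [← Real.exp_nat_mul]; congr 1; ring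
    _ ≤ Real.exp (-(4 * N)) := by
        refine Real.exp_le_exp.2 (neg_le_neg ?_)
        rw [le_div_iff₀ (by linarith)]
        linarith
    _ = (Real.exp (-1) ^ N) ^ 4 := by rw [← Real.exp_nat_mul, ← Real.exp_nat_mul]; ring_nf
    _ ≤ ((2⁻¹ : ℝ) ^ N) ^ 4 := by
        gcongr
        rw [Real.exp_neg]
        exact inv_anti₀ two_pos (by linarith [Real.add_one_le_exp (1 : ℝ)])
    _ = _ := by rw [inv_pow]; ring

lemma stepKernel_pow_le {a : ℝ} {e : V N → ℝ} (hN : 1 ≤ N) {q : ℕ} (hq : 2 * N ≤ q)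
    (hrate : ∀ x y, hammingDist x y = 1 → 1 ≤ rate a e x y) {m : ℕ} (hm : 2 * N * q ≤ m)
    (x y : V N) : (stepKernel a e q ^ m) x y
      ≤ (Fintype.card (V N) : ℝ)⁻¹ * (1 + ((2 : ℝ) ^ N)⁻¹) := by
  have hq2 : (2 : ℝ) ≤ q := by exact_mod_cast (by omega : 2 ≤ q)
  have hr : (0 : ℝ) ≤ 1 - 2 / q := by
    rw [sub_nonneg, div_le_one (by linarith)]
    exact hq2
  have h := sq_pow_apply_sub_inv_card_le (isSymmStochastic_stepKernel a e q) hr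
    (sum_stepKernel_mulVec_sq_le hN hq hrate) m x y
  have habs := abs_le_of_sq_le_sq (h.trans (one_sub_two_div_pow_le (by omega) hm)) (by positivity)
  rw [card_V] at habs ⊢
  linarith [(abs_le.1 habs).2]

end Mixing

/-! ### The number of discovered sites along a discrete path -/

section Discovery

variable {N : ℕ}

/-- The sites at distance at most `1` from `y`. -/
def ball (y : V N) : Finset (V N) := Finset.univ.filter fun z => hammingDist z y ≤ 1

open Classical in
/-- Indicator of the discovery of `x` in the first `n` steps. -/
def seen (x : V N) (n : ℕ) (ω : ℕ → V N) : ℝ := if ∃ i ≤ n, hammingDist (ω i) x ≤ 1 then 1 else 0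

/-- The number of sites discovered in the first `n` steps. -/
def discCount (n : ℕ) (ω : ℕ → V N) : ℝ := ∑ x, seen x n ω

lemma mem_ball {y z : V N} : z ∈ ball y ↔ hammingDist z y ≤ 1 := by simp [ball]

lemma mem_ball_comm {y z : V N} : z ∈ ball y ↔ y ∈ ball z := by
  rw [mem_ball, mem_ball, hammingDist_comm]

lemma card_ball (y : V N) : ((ball y).card : ℝ) = N + 1 := by
  have h : ((ball y).card : ℝ)
      = ∑ z, ((if hammingDist y z = 1 then (1 : ℝ) else 0) + if z = y then 1 else 0) := by
    rw [Finset.card_eq_sum_ones, ball, Finset.sum_filter]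
    push_cast
    refine Finset.sum_congr rfl fun z _ => ?_
    rw [hammingDist_comm z y]
    by_cases hz : z = y
    · subst hz; simp
    · have : hammingDist y z ≠ 0 := by rw [hammingDist_ne_zero]; exact Ne.symm hz
      have e : hammingDist y z ≤ 1 ↔ hammingDist y z = 1 := by omega
      simp [hz, e]
  rw [h, Finset.sum_add_distrib, sum_neighbours]
  simp

lemma sum_sum_ball (f : V N → ℝ) : ∑ y, ∑ z ∈ ball y, f z = (N + 1) * ∑ z, f z := by
  have : ∀ y, ∑ z ∈ ball y, f z = ∑ z, if y ∈ ball z then f z else 0 := fun y => by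
    rw [← Finset.sum_filter]
    refine Finset.sum_congr (Finset.ext fun z => ?_) fun _ _ => rfl
    rw [mem_ball_comm]; simp
  simp only [this]
  rw [Finset.sum_comm, Finset.mul_sum]
  refine Finset.sum_congr rfl fun z _ => ?_
  rw [← Finset.sum_filter, Finset.filter_mem_eq_inter, Finset.univ_inter, Finset.sum_const,
    nsmul_eq_mul, card_ball]

lemma sum_sq_sum_ball_le (f : V N → ℝ) :
    ∑ y, (∑ z ∈ ball y, f z) ^ 2 ≤ (N + 1) ^ 2 * ∑ z, f z ^ 2 := by
  calc ∑ y, (∑ z ∈ ball y, f z) ^ 2 ≤ ∑ y, (N + 1) * ∑ z ∈ ball y, f z ^ 2 :=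
        Finset.sum_le_sum fun y _ => by
          rw [← card_ball y]; exact sq_sum_le_card_mul_sum_sq
    _ = _ := by rw [← Finset.mul_sum, sum_sum_ball]; ring

lemma seen_nonneg (x : V N) (n : ℕ) (ω : ℕ → V N) : 0 ≤ seen x n ω := by
  unfold seen; split_ifs <;> norm_num

lemma seen_le_one (x : V N) (n : ℕ) (ω : ℕ → V N) : seen x n ω ≤ 1 := by
  unfold seen; split_ifs <;> norm_num

lemma seen_eq_zero_or_one (x : V N) (n : ℕ) (ω : ℕ → V N) : seen x n ω = 0 ∨ seen x n ω = 1 := by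
  unfold seen; split_ifs <;> simp

lemma seen_of_mem {x : V N} {n i : ℕ} {ω : ℕ → V N} (hi : i ≤ n) (h : hammingDist (ω i) x ≤ 1) :
    seen x n ω = 1 := if_pos ⟨i, hi, h⟩

lemma dependsOn_seen (x : V N) (n : ℕ) : DependsOn (seen x n) (Set.Iic n) := by
  intro ω ω' h
  have : (∃ i ≤ n, hammingDist (ω i) x ≤ 1) ↔ ∃ i ≤ n, hammingDist (ω' i) x ≤ 1 :=
    exists_congr fun i => and_congr_right fun hi => by rw [h i hi]
  simp only [seen, this]

lemma dependsOn_discCount (n : ℕ) : DependsOn (discCount (N := N) n) (Set.Iic n) :=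
  fun _ _ h => Finset.sum_congr rfl fun x _ => dependsOn_seen x n h

lemma discCount_nonneg (n : ℕ) (ω : ℕ → V N) : 0 ≤ discCount n ω :=
  Finset.sum_nonneg fun x _ => seen_nonneg x n ω

lemma discCount_le (n : ℕ) (ω : ℕ → V N) : discCount n ω ≤ 2 ^ N := by
  rw [← card_V]
  refine (Finset.sum_le_sum fun x _ => seen_le_one x n ω).trans ?_
  simp

lemma seen_le_sum_hits (x : V N) (n : ℕ) (ω : ℕ → V N) :
    seen x n ω ≤ ∑ z ∈ ball x, hits z n ω := by
  have h0 : ∀ z ∈ ball x, 0 ≤ hits z n ω := fun z _ => hits_nonneg z n ω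
  unfold seen
  split_ifs with h
  · obtain ⟨i, hi, h⟩ := h
    refine le_trans ?_ (Finset.single_le_sum h0 (mem_ball.2 h))
    unfold hits
    rw [if_pos ⟨i, hi, rfl⟩]
  · exact Finset.sum_nonneg h0

lemma sum_ite_mem_ball (y : V N) : ∑ x, (if x ∈ ball y then (1 : ℝ) else 0) = N + 1 := by
  rw [← card_ball y, Finset.sum_ite_mem, Finset.univ_inter, Finset.sum_const, nsmul_eq_mul, mul_one]

lemma seen_zero_le (x : V N) (ω : ℕ → V N) :
    seen x 0 ω ≤ if x ∈ ball (ω 0) then 1 else 0 := by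
  simp only [seen, Nat.le_zero, exists_eq_left, mem_ball, hammingDist_comm x]
  exact le_rfl

lemma seen_succ_le (x : V N) (n : ℕ) (ω : ℕ → V N) :
    seen x (n + 1) ω
      ≤ seen x n ω + jumpAt n ω * if x ∈ ball (ω (n + 1)) then 1 else 0 := by
  have hjump : 0 ≤ jumpAt n ω * if x ∈ ball (ω (n + 1)) then (1 : ℝ) else 0 :=
    mul_nonneg (jumpAt_nonneg n ω) (by split_ifs <;> norm_num)
  by_cases hold : ∃ i ≤ n, hammingDist (ω i) x ≤ 1
  · have : seen x n ω = 1 := if_pos hold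
    linarith [seen_le_one x (n + 1) ω]
  by_cases hnew : hammingDist (ω (n + 1)) x ≤ 1
  · have hne : ω n ≠ ω (n + 1) := fun h => hold ⟨n, le_rfl, by rw [h]; exact hnew⟩
    rw [jumpAt, if_neg hne, if_pos (mem_ball_comm.1 (mem_ball.2 hnew))]
    linarith [seen_le_one x (n + 1) ω, seen_nonneg x n ω]
  · have : seen x (n + 1) ω = 0 := if_neg fun ⟨i, hi, h⟩ => by
      rcases Nat.le_succ_iff.1 hi with hi | rfl
      · exact hold ⟨i, hi, h⟩
      · exact hnew h
    linarith [seen_nonneg x n ω]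

lemma discCount_le_numJumps (n : ℕ) (ω : ℕ → V N) :
    discCount n ω ≤ (N + 1) * (1 + numJumps n ω) := by
  induction n with
  | zero =>
    simp only [numJumps, Finset.range_zero, Finset.sum_empty, add_zero, mul_one]
    rw [← sum_ite_mem_ball (ω 0)]
    exact Finset.sum_le_sum fun x _ => seen_zero_le x ω
  | succ n ih =>
    have hstep : discCount (n + 1) ω ≤ discCount n ω + jumpAt n ω * (N + 1) := by
      rw [← sum_ite_mem_ball (ω (n + 1)), discCount, discCount, Finset.mul_sum,
        ← Finset.sum_add_distrib]
      exact Finset.sum_le_sum fun x _ => seen_succ_le x n ω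
    rw [show numJumps (n + 1) ω = numJumps n ω + jumpAt n ω from Finset.sum_range_succ _ _]
    linarith

/-- The mean over the starting point of `(1 + 2 n ρ)^4`, for `ρ` the escape probability. -/
def escapeMoment (A : Matrix (V N) (V N) ℝ) (n : ℕ) : ℝ :=
  ((2 : ℝ) ^ N)⁻¹ * ∑ z, (1 + 2 * n * escape A z) ^ 4

/-- The mean of `1 + numJumps` on the event that `z` is visited. -/
def jumpsAndHits (A : Matrix (V N) (V N) ℝ) (n : ℕ) (z : V N) : ℝ :=
  statExp A n fun ω => (1 + numJumps n ω) * hits z n ω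

variable {A : Matrix (V N) (V N) ℝ}

lemma sum_jumpsAndHits_le (hA : IsSymmStochastic A) (n : ℕ) :
    ∑ z, jumpsAndHits A n z ≤ escapeMoment A n := by
  have h := sum_statExp_mul_hits_pow_le hA n 1
  simp only [pow_one, mul_one, ← Finset.mul_sum, card_V] at h
  have h2 : ∑ z, (1 + 2 * n * escape A z) ^ 2 ≤ ∑ z, (1 + 2 * n * escape A z) ^ 4 :=
    Finset.sum_le_sum fun z _ => pow_le_pow_right₀
      (by have := escape_nonneg hA z
          have : 0 ≤ 2 * n * escape A z := by positivity
          linarith) (by norm_num)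
  rw [escapeMoment, ← div_eq_inv_mul, le_div_iff₀ (by positivity), mul_comm]
  exact h.trans h2

lemma sum_jumpsAndHits_sq_le (hA : IsSymmStochastic A) (n : ℕ) :
    ∑ z, jumpsAndHits A n z ^ 2 ≤ ((2 : ℝ) ^ N)⁻¹ * escapeMoment A n := by
  have h := sum_statExp_mul_hits_pow_le hA n 2
  simp only [mul_pow, ← Finset.mul_sum, card_V] at h
  rw [escapeMoment, ← mul_assoc, ← mul_inv, ← pow_two, ← div_eq_inv_mul,
    le_div_iff₀ (by positivity), mul_comm]
  exact h

lemma statExp_seen_le (hA : IsSymmStochastic A) (n : ℕ) (x : V N) :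
    statExp A n (seen x n) ≤ ∑ z ∈ ball x, jumpsAndHits A n z := by
  simp only [jumpsAndHits]
  rw [← statExp_sum]
  refine statExp_mono hA n fun ω => (seen_le_sum_hits x n ω).trans
    (Finset.sum_le_sum fun z _ => ?_)
  nlinarith [numJumps_nonneg n ω, hits_nonneg z n ω]

lemma statExp_discCount_mul_seen_le (hA : IsSymmStochastic A) (n : ℕ) (x : V N) :
    statExp A n (fun ω => discCount n ω * seen x n ω)
      ≤ (N + 1) * ∑ z ∈ ball x, jumpsAndHits A n z := by
  simp only [jumpsAndHits]
  rw [← statExp_sum, ← statExp_const_mul]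
  refine statExp_mono hA n fun ω => ?_
  calc discCount n ω * seen x n ω
      ≤ ((N + 1) * (1 + numJumps n ω)) * ∑ z ∈ ball x, hits z n ω :=
        mul_le_mul (discCount_le_numJumps n ω) (seen_le_sum_hits x n ω) (seen_nonneg x n ω)
          (mul_nonneg (by positivity) (by linarith [numJumps_nonneg n ω]))
    _ = _ := by rw [mul_assoc, ← Finset.mul_sum]

lemma statExp_discCount_le (hA : IsSymmStochastic A) (n : ℕ) :
    statExp A n (discCount n) ≤ (N + 1) * escapeMoment A n := by
  unfold discCount
  rw [statExp_sum]
  refine (Finset.sum_le_sum fun x _ => statExp_seen_le hA n x).trans ?_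
  rw [sum_sum_ball]
  exact mul_le_mul_of_nonneg_left (sum_jumpsAndHits_le hA n) (by positivity)

lemma statExp_discCount_sq_le (hA : IsSymmStochastic A) (n : ℕ) :
    statExp A n (fun ω => discCount n ω ^ 2) ≤ (N + 1) ^ 2 * escapeMoment A n := by
  have e : (fun ω : ℕ → V N => discCount n ω ^ 2)
      = fun ω => ∑ x, discCount n ω * seen x n ω := by
    funext ω
    rw [← Finset.mul_sum, pow_two]
    rfl
  rw [e, statExp_sum]
  refine (Finset.sum_le_sum fun x _ => statExp_discCount_mul_seen_le hA n x).trans ?_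
  rw [← Finset.mul_sum, sum_sum_ball, pow_two, mul_assoc]
  gcongr
  exact sum_jumpsAndHits_le hA n

lemma sum_statExp_seen_sq_le (hA : IsSymmStochastic A) (n : ℕ) :
    ∑ x, statExp A n (seen x n) ^ 2 ≤ (N + 1) ^ 2 * (((2 : ℝ) ^ N)⁻¹ * escapeMoment A n) := by
  calc ∑ x, statExp A n (seen x n) ^ 2
      ≤ ∑ x, (∑ z ∈ ball x, jumpsAndHits A n z) ^ 2 :=
        Finset.sum_le_sum fun x _ => pow_le_pow_left₀
          (statExp_nonneg hA n (seen_nonneg x n)) (statExp_seen_le hA n x) 2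
    _ ≤ (N + 1) ^ 2 * ∑ z, jumpsAndHits A n z ^ 2 := sum_sq_sum_ball_le _
    _ ≤ _ := mul_le_mul_of_nonneg_left (sum_jumpsAndHits_sq_le hA n) (by positivity)

lemma sum_statExp_discCount_mul_seen_sq_le (hA : IsSymmStochastic A) (n : ℕ) :
    ∑ x, statExp A n (fun ω => discCount n ω * seen x n ω) ^ 2
      ≤ (N + 1) ^ 4 * (((2 : ℝ) ^ N)⁻¹ * escapeMoment A n) := by
  calc ∑ x, statExp A n (fun ω => discCount n ω * seen x n ω) ^ 2
      ≤ ∑ x, ((N + 1) * ∑ z ∈ ball x, jumpsAndHits A n z) ^ 2 :=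
        Finset.sum_le_sum fun x _ => pow_le_pow_left₀
          (statExp_nonneg hA n fun ω => mul_nonneg (discCount_nonneg n ω) (seen_nonneg x n ω))
          (statExp_discCount_mul_seen_le hA n x) 2
    _ = (N + 1) ^ 2 * ∑ x, (∑ z ∈ ball x, jumpsAndHits A n z) ^ 2 := by
        rw [Finset.mul_sum]; exact Finset.sum_congr rfl fun x _ => by ring
    _ ≤ (N + 1) ^ 2 * ((N + 1) ^ 2 * (((2 : ℝ) ^ N)⁻¹ * escapeMoment A n)) := by
        gcongr
        exact (sum_sq_sum_ball_le _).trans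
          (mul_le_mul_of_nonneg_left (sum_jumpsAndHits_sq_le hA n) (by positivity))
    _ = _ := by ring

/-! ### Decomposition into blocks -/

/-- Bonferroni's lower bound for the indicator `U` of a union of events with indicators `s k`. -/
lemma sum_sub_sum_pairs_le {s : ℕ → ℝ} (hs : ∀ k, s k = 0 ∨ s k = 1) {U : ℝ} (hU : 0 ≤ U) :
    ∀ K : ℕ, (∀ k < K, s k ≤ U) →
      ∑ k ∈ Finset.range K, (s k - ∑ l ∈ Finset.range k, s l * s k) ≤ U
  | 0, _ => by simpa using hU
  | K + 1, h => by
      have ih := sum_sub_sum_pairs_le hs hU K fun k hk => h k (by omega)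
      have hs0 : ∀ k, 0 ≤ s k := fun k => by rcases hs k with h | h <;> simp [h]
      rw [Finset.sum_range_succ, ← Finset.sum_mul]
      by_cases h1 : ∃ l < K, s l = 1
      · obtain ⟨l, hl, hl1⟩ := h1
        have := Finset.single_le_sum (f := s) (fun k _ => hs0 k) (Finset.mem_range.2 hl)
        nlinarith [hs0 K]
      · have h0 : ∀ l ∈ Finset.range K, s l = 0 := fun l hl =>
          (hs l).resolve_right fun h' => h1 ⟨l, Finset.mem_range.1 hl, h'⟩
        have hprev : ∑ k ∈ Finset.range K, (s k - ∑ l ∈ Finset.range k, s l * s k) = 0 :=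
          Finset.sum_eq_zero fun k hk => by
            rw [h0 k hk]; simp
        rw [Finset.sum_eq_zero h0, hprev]
        simpa using h K (by omega)

lemma sum_range_sum_range_le {f : ℕ → ℕ → ℝ} {c : ℝ} (hc : 0 ≤ c) {K : ℕ}
    (hf : ∀ k < K, ∀ l < k, f k l ≤ c) :
    ∑ k ∈ Finset.range K, ∑ l ∈ Finset.range k, f k l ≤ K ^ 2 * c := by
  calc ∑ k ∈ Finset.range K, ∑ l ∈ Finset.range k, f k l
      ≤ ∑ _k ∈ Finset.range K, K * c := Finset.sum_le_sum fun k hk => by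
        have hk := Finset.mem_range.1 hk
        calc ∑ l ∈ Finset.range k, f k l ≤ ∑ _l ∈ Finset.range k, c :=
              Finset.sum_le_sum fun l hl => hf k hk l (Finset.mem_range.1 hl)
          _ = k * c := by simp
          _ ≤ K * c := by gcongr
    _ = K ^ 2 * c := by simp; ring

lemma mul_add_self_le_mul {k K : ℕ} (h : k < K) (L : ℕ) : k * L + L ≤ K * L := by
  rw [← Nat.succ_mul]; exact Nat.mul_le_mul_right L h

section Blocks

variable {S : Type*} [Fintype S] {A : Matrix S S ℝ} {W G : ℕ}

lemma sq_statExp_le [Nonempty S] (hA : IsSymmStochastic A) (n : ℕ) (F : (ℕ → S) → ℝ) :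
    statExp A n F ^ 2 ≤ statExp A n (fun ω => F ω ^ 2) := by
  have h := statExp_nonneg hA n
    (G := fun ω => (F ω ^ 2 + -2 * statExp A n F * F ω) + statExp A n F ^ 2)
    fun ω => by nlinarith [sq_nonneg (F ω - statExp A n F)]
  rw [statExp_add, statExp_add, statExp_const_mul, statExp_const hA] at h
  linarith

lemma statExp_sum_blocks (hA : IsSymmStochastic A) {F : (ℕ → S) → ℝ}
    (hF : DependsOn F (Set.Iic W)) (K : ℕ) :
    statExp A (K * (W + G)) (fun ω => ∑ k ∈ Finset.range K, F (shiftPath (k * (W + G)) ω))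
      = K * statExp A W F := by
  rw [statExp_sum, Finset.sum_congr rfl fun k hk => statExp_shiftPath hA hF
    (by have := mul_add_self_le_mul (Finset.mem_range.1 hk) (W + G); omega)]
  simp

variable [DecidableEq S] {η : ℝ}

/-- After `G` steps the chain with transition matrix `A` is close to the uniform distribution, in
the one-sided sense that every transition probability is at most `1 + η` times the uniform one. -/
def IsMixedAfter (A : Matrix S S ℝ) (G : ℕ) (η : ℝ) : Prop :=
  ∀ m, G ≤ m → ∀ x y, (A ^ m) x y ≤ (Fintype.card S : ℝ)⁻¹ * (1 + η)

lemma statExp_mul_blocks_le (hA : IsSymmStochastic A) (hη : IsMixedAfter A G η)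
    {F H : (ℕ → S) → ℝ} (hF : DependsOn F (Set.Iic W)) (hH : DependsOn H (Set.Iic W))
    (hF0 : ∀ ω, 0 ≤ F ω) (hH0 : ∀ ω, 0 ≤ H ω) {l k K : ℕ} (hlk : l < k) (hk : k < K) :
    statExp A (K * (W + G))
      (fun ω => F (shiftPath (l * (W + G)) ω) * H (shiftPath (k * (W + G)) ω))
      ≤ (1 + η) * (statExp A W F * statExp A W H) := by
  have h1 := mul_add_self_le_mul hlk (W + G)
  have h2 := mul_add_self_le_mul hk (W + G)
  have := statExp_mul_shiftPath_le hA (i := l * (W + G)) (m := W)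
    (j := k * (W + G) - l * (W + G) - W) (k := W) (n := K * (W + G)) hF hH hF0 hH0
    (hη _ (by omega)) (by omega)
  rwa [show l * (W + G) + W + (k * (W + G) - l * (W + G) - W) = k * (W + G) by omega] at this

lemma statExp_sum_blocks_sq_le [Nonempty S] (hA : IsSymmStochastic A) (hη : IsMixedAfter A G η)
    (hη0 : 0 ≤ η) {F : (ℕ → S) → ℝ} (hF : DependsOn F (Set.Iic W)) (hF0 : ∀ ω, 0 ≤ F ω) (K : ℕ) :
    statExp A (K * (W + G))
      (fun ω => (∑ k ∈ Finset.range K, F (shiftPath (k * (W + G)) ω)) ^ 2)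
      ≤ K * statExp A W (fun ω => F ω ^ 2) + K ^ 2 * ((1 + η) * statExp A W F ^ 2) := by
  have hdiag : ∀ k < K, statExp A (K * (W + G))
      (fun ω => F (shiftPath (k * (W + G)) ω) * F (shiftPath (k * (W + G)) ω))
      = statExp A W (fun ω => F ω ^ 2) := fun k hk => by
    simp only [pow_two]
    exact statExp_shiftPath hA (dependsOn_mul hF hF)
      (by have := mul_add_self_le_mul hk (W + G); omega)
  have hoff : ∀ k < K, ∀ l < K, l ≠ k → statExp A (K * (W + G))
      (fun ω => F (shiftPath (l * (W + G)) ω) * F (shiftPath (k * (W + G)) ω))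
      ≤ (1 + η) * statExp A W F ^ 2 := fun k hk l hl hlk => by
    rw [pow_two]
    rcases Nat.lt_or_gt_of_ne hlk with h | h
    · exact statExp_mul_blocks_le hA hη hF hF hF0 hF0 h hk
    · simp only [mul_comm (F (shiftPath (l * (W + G)) _))]
      exact statExp_mul_blocks_le hA hη hF hF hF0 hF0 h hl
  have hterm : ∀ k ∈ Finset.range K, ∀ l ∈ Finset.range K, statExp A (K * (W + G))
      (fun ω => F (shiftPath (l * (W + G)) ω) * F (shiftPath (k * (W + G)) ω))
      ≤ (if l = k then statExp A W (fun ω => F ω ^ 2) else 0) + (1 + η) * statExp A W F ^ 2 := by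
    intro k hk l hl
    split_ifs with h
    · subst h
      rw [hdiag l (Finset.mem_range.1 hk)]
      exact le_add_of_nonneg_right (by positivity)
    · rw [zero_add]
      exact hoff k (Finset.mem_range.1 hk) l (Finset.mem_range.1 hl) h
  simp only [pow_two (Finset.sum _ _), Finset.sum_mul_sum, statExp_sum]
  rw [Finset.sum_comm]
  refine (Finset.sum_le_sum fun k hk => Finset.sum_le_sum (hterm k hk)).trans_eq ?_
  simp only [Finset.sum_add_distrib, Finset.sum_ite_eq', Finset.sum_const, Finset.card_range,
    nsmul_eq_mul, Finset.sum_ite_mem, Finset.inter_self]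
  ring

lemma statExp_sq_sum_blocks_sub_le [Nonempty S] (hA : IsSymmStochastic A)
    (hη : IsMixedAfter A G η) (hη0 : 0 ≤ η) {F : (ℕ → S) → ℝ} (hF : DependsOn F (Set.Iic W))
    (hF0 : ∀ ω, 0 ≤ F ω) (K : ℕ) :
    statExp A (K * (W + G)) (fun ω =>
      (∑ k ∈ Finset.range K, F (shiftPath (k * (W + G)) ω) - K * statExp A W F) ^ 2)
      ≤ (K + K ^ 2 * η) * statExp A W (fun ω => F ω ^ 2) := by
  have hexpand : ∀ u : ℝ, (u - K * statExp A W F) ^ 2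
      = (u ^ 2 + (-2 * (K * statExp A W F)) * u) + (K * statExp A W F) ^ 2 := fun u => by ring
  simp only [hexpand]
  rw [statExp_add, statExp_add, statExp_const_mul, statExp_const hA, statExp_sum_blocks hA hF]
  have hsq := statExp_sum_blocks_sq_le hA hη hη0 hF hF0 K
  have hvar : K ^ 2 * (η * statExp A W F ^ 2)
      ≤ K ^ 2 * (η * statExp A W (fun ω => F ω ^ 2)) := by
    gcongr
    exact sq_statExp_le hA W F
  linarith

lemma statExp_abs_sum_blocks_sub_le [Nonempty S] (hA : IsSymmStochastic A)
    (hη : IsMixedAfter A G η) (hη0 : 0 ≤ η) {F : (ℕ → S) → ℝ} (hF : DependsOn F (Set.Iic W))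
    (hF0 : ∀ ω, 0 ≤ F ω) {K : ℕ} (hK : 1 ≤ K) :
    statExp A (K * (W + G)) (fun ω =>
      |∑ k ∈ Finset.range K, F (shiftPath (k * (W + G)) ω) - K * statExp A W F|)
      ≤ K + (1 + K * η) * statExp A W (fun ω => F ω ^ 2) := by
  have hK' : (0 : ℝ) < K := by exact_mod_cast hK
  have hAMGM : ∀ u : ℝ, |u| ≤ K + (K : ℝ)⁻¹ * u ^ 2 := fun u => by
    rw [← div_eq_inv_mul, ← sub_le_iff_le_add', le_div_iff₀ hK', ← sq_abs u]
    nlinarith [sq_nonneg (|u| - K), abs_nonneg u]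
  refine (statExp_mono hA _ fun ω => hAMGM _).trans ?_
  rw [statExp_add, statExp_const hA, statExp_const_mul]
  refine add_le_add le_rfl ((mul_le_mul_of_nonneg_left
    (statExp_sq_sum_blocks_sub_le hA hη hη0 hF hF0 K) (by positivity)).trans_eq ?_)
  field_simp

lemma statExp_atSite_mul_atSite_le (hA : IsSymmStochastic A) (hη : IsMixedAfter A G η) (x : S)
    {i k n : ℕ} (hik : i + G ≤ k) (hk : k ≤ n) :
    statExp A n (fun ω => atSite x i ω * atSite x k ω)
      ≤ (1 + η) * (Fintype.card S : ℝ)⁻¹ ^ 2 := by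
  have := statExp_mul_shiftPath_le hA (i := i) (m := 0) (j := k - i) (k := 0)
    (n := n) (dependsOn_atSite_zero x) (dependsOn_atSite_zero x) (atSite_nonneg x 0)
    (atSite_nonneg x 0) (hη _ (by omega)) (by omega)
  simp only [atSite_shiftPath, add_zero] at this
  rwa [show i + (k - i) = k by omega, statExp_atSite hA x le_rfl, ← pow_two] at this

end Blocks

/-- The number of sites discovered both by `ω` and by `ω'` in the first `n` steps. -/
def commonCount (n : ℕ) (ω ω' : ℕ → V N) : ℝ := ∑ x, seen x n ω * seen x n ω'

lemma commonCount_nonneg (n : ℕ) (ω ω' : ℕ → V N) : 0 ≤ commonCount n ω ω' :=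
  Finset.sum_nonneg fun _ _ => mul_nonneg (seen_nonneg _ _ _) (seen_nonneg _ _ _)

lemma seen_shiftPath_le (x : V N) {i m n : ℕ} (h : i + m ≤ n) (ω : ℕ → V N) :
    seen x m (shiftPath i ω) ≤ seen x n ω := by
  by_cases hx : ∃ j ≤ m, hammingDist (shiftPath i ω j) x ≤ 1
  · obtain ⟨j, hj, hx⟩ := hx
    rw [seen_of_mem (i := i + j) (ω := ω) (by omega) hx]
    exact seen_le_one _ _ _
  · rw [seen, if_neg hx]
    exact seen_nonneg _ _ _

variable {W G K : ℕ} {η : ℝ}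

lemma exists_lt_eq_mul_add {L i : ℕ} (hK : 1 ≤ K) (hL : 1 ≤ L) (hi : i ≤ K * L) :
    ∃ k < K, ∃ r ≤ L, i = k * L + r := by
  rcases hi.lt_or_eq with hlt | rfl
  · exact ⟨i / L, (Nat.div_lt_iff_lt_mul hL).2 hlt, i % L, (Nat.mod_lt _ hL).le,
      (Nat.div_add_mod' i L).symm⟩
  · exact ⟨K - 1, by omega, L, le_rfl, by rw [← Nat.succ_mul, Nat.succ_eq_add_one,
      Nat.sub_add_cancel hK]⟩

lemma seen_le_blocks (x : V N) (hK : 1 ≤ K) (hL : 1 ≤ W + G) (ω : ℕ → V N) :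
    seen x (K * (W + G)) ω
      ≤ ∑ k ∈ Finset.range K, seen x W (shiftPath (k * (W + G)) ω)
        + ∑ k ∈ Finset.range K, seen x G (shiftPath (k * (W + G) + W) ω) := by
  have hactive : ∀ k ∈ Finset.range K, 0 ≤ seen x W (shiftPath (k * (W + G)) ω) :=
    fun k _ => seen_nonneg _ _ _
  have hgap : ∀ k ∈ Finset.range K, 0 ≤ seen x G (shiftPath (k * (W + G) + W) ω) :=
    fun k _ => seen_nonneg _ _ _
  by_cases h : ∃ i ≤ K * (W + G), hammingDist (ω i) x ≤ 1
  · refine (seen_le_one _ _ _).trans ?_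
    obtain ⟨i, hi, h⟩ := h
    obtain ⟨k, hk, r, hr, rfl⟩ := exists_lt_eq_mul_add hK hL hi
    rcases Nat.le_total r W with hrW | hrW
    · have := Finset.single_le_sum hactive (Finset.mem_range.2 hk)
      rw [seen_of_mem hrW h] at this
      linarith [Finset.sum_nonneg hgap]
    · have := Finset.single_le_sum hgap (Finset.mem_range.2 hk)
      rw [seen_of_mem (i := r - W) (by omega) (by
        rwa [shiftPath_apply, show k * (W + G) + W + (r - W) = k * (W + G) + r by omega])] at this
      linarith [Finset.sum_nonneg hactive]
  · rw [seen, if_neg h]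
    exact add_nonneg (Finset.sum_nonneg hactive) (Finset.sum_nonneg hgap)

lemma discCount_le_blocks (hK : 1 ≤ K) (hL : 1 ≤ W + G) (ω : ℕ → V N) :
    discCount (K * (W + G)) ω
      ≤ ∑ k ∈ Finset.range K, discCount W (shiftPath (k * (W + G)) ω)
        + ∑ k ∈ Finset.range K, discCount G (shiftPath (k * (W + G) + W) ω) := by
  simp only [discCount]
  rw [Finset.sum_comm, Finset.sum_comm (s := Finset.range K) (t := Finset.univ),
    ← Finset.sum_add_distrib]
  exact Finset.sum_le_sum fun x _ => seen_le_blocks x hK hL ω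

lemma blocks_le_discCount (W G K : ℕ) (ω : ℕ → V N) :
    ∑ k ∈ Finset.range K, discCount W (shiftPath (k * (W + G)) ω)
      ≤ discCount (K * (W + G)) ω + ∑ k ∈ Finset.range K, ∑ l ∈ Finset.range k,
        commonCount W (shiftPath (l * (W + G)) ω) (shiftPath (k * (W + G)) ω) := by
  have key : ∑ x, ∑ k ∈ Finset.range K, (seen x W (shiftPath (k * (W + G)) ω)
      - ∑ l ∈ Finset.range k, seen x W (shiftPath (l * (W + G)) ω)
          * seen x W (shiftPath (k * (W + G)) ω)) ≤ discCount (K * (W + G)) ω :=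
    Finset.sum_le_sum fun x _ => sum_sub_sum_pairs_le (fun k => seen_eq_zero_or_one _ _ _)
      (seen_nonneg _ _ _) K fun k hk => seen_shiftPath_le x
        (by have := mul_add_self_le_mul hk (W + G); omega) ω
  rw [Finset.sum_comm] at key
  simp only [Finset.sum_sub_distrib, Finset.sum_comm (s := Finset.univ)] at key
  simpa only [discCount, commonCount, sub_le_iff_le_add] using key

lemma abs_discCount_sub_blocks_le (hK : 1 ≤ K) (hL : 1 ≤ W + G) (ω : ℕ → V N) :
    |discCount (K * (W + G)) ω
        - ∑ k ∈ Finset.range K, discCount W (shiftPath (k * (W + G)) ω)|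
      ≤ ∑ k ∈ Finset.range K, discCount G (shiftPath (k * (W + G) + W) ω)
        + ∑ k ∈ Finset.range K, ∑ l ∈ Finset.range k,
          commonCount W (shiftPath (l * (W + G)) ω) (shiftPath (k * (W + G)) ω) := by
  have hupper := discCount_le_blocks hK hL ω
  have hlower := blocks_le_discCount W G K ω
  have hgap : 0 ≤ ∑ k ∈ Finset.range K, discCount G (shiftPath (k * (W + G) + W) ω) :=
    Finset.sum_nonneg fun k _ => discCount_nonneg _ _
  have hcommon : 0 ≤ ∑ k ∈ Finset.range K, ∑ l ∈ Finset.range k,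
      commonCount W (shiftPath (l * (W + G)) ω) (shiftPath (k * (W + G)) ω) :=
    Finset.sum_nonneg fun k _ => Finset.sum_nonneg fun l _ => commonCount_nonneg _ _ _
  rw [abs_le]
  constructor <;> linarith

lemma statExp_sum_gaps_le (hA : IsSymmStochastic A) (W G K : ℕ) :
    statExp A (K * (W + G))
      (fun ω => ∑ k ∈ Finset.range K, discCount G (shiftPath (k * (W + G) + W) ω))
      ≤ K * ((N + 1) * escapeMoment A G) := by
  rw [statExp_sum, Finset.sum_congr rfl fun k hk => statExp_shiftPath hA (dependsOn_discCount G)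
    (by have := mul_add_self_le_mul (Finset.mem_range.1 hk) (W + G); omega)]
  rw [Finset.sum_const, Finset.card_range, nsmul_eq_mul]
  exact mul_le_mul_of_nonneg_left (statExp_discCount_le hA G) (Nat.cast_nonneg K)

lemma escapeMoment_nonneg (A : Matrix (V N) (V N) ℝ) (n : ℕ) : 0 ≤ escapeMoment A n :=
  mul_nonneg (by positivity) (Finset.sum_nonneg fun _ _ => by positivity)

lemma statExp_commonCount_blocks_le (hA : IsSymmStochastic A) (hη : IsMixedAfter A G η)
    (hη1 : η ≤ 1) {l k : ℕ} (hlk : l < k) (hk : k < K) :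
    statExp A (K * (W + G)) (fun ω =>
      commonCount W (shiftPath (l * (W + G)) ω) (shiftPath (k * (W + G)) ω))
      ≤ 2 * ((N + 1) ^ 2 * (((2 : ℝ) ^ N)⁻¹ * escapeMoment A W)) := by
  simp only [commonCount, statExp_sum]
  calc ∑ x, statExp A (K * (W + G)) (fun ω =>
          seen x W (shiftPath (l * (W + G)) ω) * seen x W (shiftPath (k * (W + G)) ω))
      ≤ ∑ x, 2 * statExp A W (seen x W) ^ 2 := Finset.sum_le_sum fun x _ => by
        refine (statExp_mul_blocks_le hA hη (dependsOn_seen x W) (dependsOn_seen x W)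
          (seen_nonneg x W) (seen_nonneg x W) hlk hk).trans ?_
        rw [← pow_two]
        exact mul_le_mul_of_nonneg_right (by linarith) (sq_nonneg _)
    _ ≤ 2 * ((N + 1) ^ 2 * (((2 : ℝ) ^ N)⁻¹ * escapeMoment A W)) := by
        rw [← Finset.mul_sum]
        exact mul_le_mul_of_nonneg_left (sum_statExp_seen_sq_le hA W) (by norm_num)

lemma statExp_abs_discCount_sub_blocks_le (hA : IsSymmStochastic A) (hη : IsMixedAfter A G η)
    (hη1 : η ≤ 1) (hK : 1 ≤ K) (hL : 1 ≤ W + G) :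
    statExp A (K * (W + G)) (fun ω => |discCount (K * (W + G)) ω
      - ∑ k ∈ Finset.range K, discCount W (shiftPath (k * (W + G)) ω)|)
      ≤ K * ((N + 1) * escapeMoment A G)
        + K ^ 2 * (2 * ((N + 1) ^ 2 * (((2 : ℝ) ^ N)⁻¹ * escapeMoment A W))) := by
  refine (statExp_mono hA _ (abs_discCount_sub_blocks_le hK hL)).trans ?_
  rw [statExp_add]
  refine add_le_add (statExp_sum_gaps_le hA W G K) ?_
  simp only [statExp_sum]
  have := escapeMoment_nonneg A W
  exact sum_range_sum_range_le (by positivity) fun k hk l hl =>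
    statExp_commonCount_blocks_le hA hη hη1 hl hk

/-- The error in the law of large numbers for the number of sites discovered in `K` blocks, each
made of an active part and a gap whose escape moments are at most `μW` and `μG`, when the chain is
mixed up to the relative excess `η` during a gap. The terms stand for the discoveries made in the
gaps, the sites discovered in two blocks, and the fluctuations of the sum over the blocks. The
number `K` is real so that the error can be evaluated at a quotient of times. -/
def blockError (N : ℕ) (η μG μW K : ℝ) : ℝ :=
  K * ((N + 1) * μG) + K ^ 2 * (2 * ((N + 1) ^ 2 * (((2 : ℝ) ^ N)⁻¹ * μW)))
    + (K + (1 + K * η) * ((N + 1) ^ 2 * μW))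

lemma statExp_abs_discCount_sub_le (hA : IsSymmStochastic A) (hη : IsMixedAfter A G η)
    (hη0 : 0 ≤ η) (hη1 : η ≤ 1) (hK : 1 ≤ K) (hL : 1 ≤ W + G) :
    statExp A (K * (W + G)) (fun ω => |discCount (K * (W + G)) ω
      - K * statExp A W (discCount W)|)
      ≤ blockError N η (escapeMoment A G) (escapeMoment A W) K := by
  refine (statExp_mono hA _ fun ω => abs_sub_le _
    (∑ k ∈ Finset.range K, discCount W (shiftPath (k * (W + G)) ω)) _).trans ?_
  rw [statExp_add]
  refine add_le_add (statExp_abs_discCount_sub_blocks_le hA hη hη1 hK hL)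
    ((statExp_abs_sum_blocks_sub_le hA hη hη0 (dependsOn_discCount W) (discCount_nonneg W)
      hK).trans ?_)
  gcongr
  exact statExp_discCount_sq_le hA W

lemma sum_atSite_sub_le_discCount {v : ℕ} (hW : v * G ≤ W) (ω : ℕ → V N) :
    ∑ x, ∑ k ∈ Finset.range (v + 1), (atSite x (k * G) ω
      - ∑ l ∈ Finset.range k, atSite x (l * G) ω * atSite x (k * G) ω) ≤ discCount W ω := by
  refine Finset.sum_le_sum fun x _ => sum_sub_sum_pairs_le (s := fun k => atSite x (k * G) ω)
    (fun k => by simp only [atSite]; split_ifs <;> simp) (seen_nonneg _ _ _) _ fun k hk => ?_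
  simp only [atSite]
  split_ifs with h
  · rw [seen_of_mem ((Nat.mul_le_mul_right G (Nat.lt_succ_iff.1 hk)).trans hW) (by rw [h]; simp)]
  · exact seen_nonneg _ _ _

-- The positions at the multiples of the mixing time `G` are almost independent and uniform, so
-- that they are mostly distinct.
lemma le_statExp_discCount (hA : IsSymmStochastic A) (hη : IsMixedAfter A G η) (hη1 : η ≤ 1)
    {v : ℕ} (hW : v * G ≤ W) :
    (v + 1 : ℝ) - 2 * (v + 1) ^ 2 * ((2 : ℝ) ^ N)⁻¹ ≤ statExp A W (discCount W) := by
  have hle : ∀ k < v + 1, k * G ≤ W := fun k hk =>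
    (Nat.mul_le_mul_right G (Nat.lt_succ_iff.1 hk)).trans hW
  have hpair : ∀ (x : V N), ∀ k < v + 1, ∀ l < k,
      statExp A W (fun ω => atSite x (l * G) ω * atSite x (k * G) ω) ≤ 2 * ((2 : ℝ) ^ N)⁻¹ ^ 2 :=
    fun x k hk l hl => by
      refine (statExp_atSite_mul_atSite_le hA hη x (mul_add_self_le_mul hl G) (hle k hk)).trans ?_
      rw [card_V]
      exact mul_le_mul_of_nonneg_right (by linarith) (by positivity)
  have hsite : ∀ x : V N, (v + 1 : ℝ) * ((2 : ℝ) ^ N)⁻¹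
      - (v + 1) ^ 2 * (2 * ((2 : ℝ) ^ N)⁻¹ ^ 2) ≤ ∑ k ∈ Finset.range (v + 1),
        (statExp A W (atSite x (k * G)) - ∑ l ∈ Finset.range k,
          statExp A W (fun ω => atSite x (l * G) ω * atSite x (k * G) ω)) := fun x => by
    rw [Finset.sum_sub_distrib, Finset.sum_congr rfl fun k hk => by
      rw [statExp_atSite hA x (hle k (Finset.mem_range.1 hk)), card_V]]
    have := sum_range_sum_range_le (by positivity) (hpair x)
    push_cast at this
    simp only [Finset.sum_const, Finset.card_range, nsmul_eq_mul, Nat.cast_add, Nat.cast_one]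
    linarith
  refine le_trans ?_ (statExp_mono hA W (sum_atSite_sub_le_discCount hW))
  simp only [statExp_sum, statExp_sub]
  refine le_trans (le_of_eq ?_) (Finset.sum_le_sum fun x _ => hsite x)
  rw [Finset.sum_const, Finset.card_univ, nsmul_eq_mul, card_V]
  field_simp

end Discovery

/-! ### Averaging over the environment -/

section Annealed

lemma integral_abs_sub_integral_le {Ω : Type*} [MeasurableSpace Ω] {μ : Measure Ω}
    [IsProbabilityMeasure μ] {f : Ω → ℝ} (hf : MemLp f 2 μ) :
    ∫ x, |f x - ∫ y, f y ∂μ| ∂μ ≤ 1 + Var[f; μ] := by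
  have hsub : MemLp (fun x => f x - ∫ y, f y ∂μ) 2 μ := hf.sub (memLp_const _)
  have hAMGM : ∀ u : ℝ, |u| ≤ 1 + u ^ 2 := fun u => by
    nlinarith [sq_abs u, sq_nonneg (|u| - 1), abs_nonneg u]
  rw [variance_eq_integral hf.aestronglyMeasurable.aemeasurable]
  refine (integral_mono (hsub.integrable one_le_two).abs
    ((integrable_const 1).add hsub.integrable_sq) fun x => hAMGM _).trans_eq ?_
  simp only [Pi.add_apply]
  rw [integral_add (integrable_const 1) hsub.integrable_sq]
  simp

instance isProbabilityMeasure_posGaussian : IsProbabilityMeasure posGaussian :=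
  Measure.isProbabilityMeasure_map (by fun_prop)

instance isProbabilityMeasure_envLaw (N : ℕ) : IsProbabilityMeasure (envLaw N) := by
  unfold envLaw; infer_instance

lemma exp_mul_max_zero_le (b u : ℝ) : Real.exp (b * max u 0) ≤ 1 + Real.exp (b * u) := by
  rcases le_total u 0 with h | h
  · rw [max_eq_right h, mul_zero, Real.exp_zero]
    linarith [Real.exp_pos (b * u)]
  · rw [max_eq_left h]
    linarith

lemma integrable_one_add_exp_gaussianReal (b : ℝ) :
    Integrable (fun u : ℝ => 1 + Real.exp (b * u)) (gaussianReal 0 1) :=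
  (integrable_const _).add (integrable_exp_mul_gaussianReal b)

lemma integrable_exp_mul_max_zero_gaussianReal (b : ℝ) :
    Integrable (fun u : ℝ => Real.exp (b * max u 0)) (gaussianReal 0 1) :=
  (integrable_one_add_exp_gaussianReal b).mono' (by fun_prop) (Eventually.of_forall fun u => by
    rw [Real.norm_eq_abs, abs_of_pos (Real.exp_pos _)]
    exact exp_mul_max_zero_le b u)

lemma integrable_exp_mul_posGaussian (b : ℝ) :
    Integrable (fun u => Real.exp (b * u)) posGaussian := by
  rw [posGaussian, integrable_map_measure (by fun_prop) (by fun_prop)]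
  exact integrable_exp_mul_max_zero_gaussianReal b

lemma integral_exp_mul_posGaussian_le (b : ℝ) :
    ∫ u, Real.exp (b * u) ∂posGaussian ≤ 1 + Real.exp (b ^ 2 / 2) := by
  have hmgf : ∫ u, Real.exp (b * u) ∂(gaussianReal 0 1) = Real.exp (b ^ 2 / 2) := by
    simpa [mgf] using congrFun (mgf_id_gaussianReal (μ := 0) (v := 1)) b
  rw [posGaussian, integral_map (by fun_prop) (by fun_prop)]
  refine (integral_mono (integrable_exp_mul_max_zero_gaussianReal b)
    (integrable_one_add_exp_gaussianReal b) (exp_mul_max_zero_le b)).trans_eq ?_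
  rw [integral_add (integrable_const _) (integrable_exp_mul_gaussianReal b), hmgf]
  simp

variable {N : ℕ}

lemma measurePreserving_eval_envLaw (x : V N) :
    MeasurePreserving (fun e : V N → ℝ => e x) (envLaw N) posGaussian :=
  measurePreserving_eval (fun _ : V N => posGaussian) x

lemma ae_nonneg_envLaw (N : ℕ) : ∀ᵐ e ∂(envLaw N), ∀ x, 0 ≤ e x := by
  rw [ae_all_iff]
  intro x
  have h : ∀ᵐ u ∂posGaussian, 0 ≤ u := by
    rw [posGaussian, ae_map_iff (by fun_prop) measurableSet_Ici]
    exact Eventually.of_forall fun u => le_max_right _ _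
  exact (measurePreserving_eval_envLaw x).quasiMeasurePreserving.ae h

lemma integrable_exp_mul_envLaw (b : ℝ) (x : V N) :
    Integrable (fun e : V N → ℝ => Real.exp (b * e x)) (envLaw N) :=
  (measurePreserving_eval_envLaw x).integrable_comp_of_integrable (integrable_exp_mul_posGaussian b)

lemma integral_exp_mul_envLaw_le (b : ℝ) (x : V N) :
    ∫ e, Real.exp (b * e x) ∂(envLaw N) ≤ 1 + Real.exp (b ^ 2 / 2) := by
  refine le_of_eq_of_le ?_ (integral_exp_mul_posGaussian_le b)
  rw [← (measurePreserving_eval_envLaw x).map_eq,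
    integral_map (measurable_pi_apply x).aemeasurable (by fun_prop)]

/-- The mean over the sites of the exponential `exp (b e)` of the energy. -/
def expMean (b : ℝ) (e : V N → ℝ) : ℝ := ((2 : ℝ) ^ N)⁻¹ * ∑ x, Real.exp (b * e x)

lemma integrable_expMean (b : ℝ) : Integrable (expMean (N := N) b) (envLaw N) :=
  (integrable_finsetSum _ fun x _ => integrable_exp_mul_envLaw b x).const_mul _

lemma integral_expMean_le (b : ℝ) :
    ∫ e, expMean (N := N) b e ∂(envLaw N) ≤ 1 + Real.exp (b ^ 2 / 2) := by
  simp only [expMean]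
  rw [integral_const_mul, integral_finsetSum _ fun x _ => integrable_exp_mul_envLaw b x,
    inv_mul_le_iff₀ (by positivity)]
  refine (Finset.sum_le_sum fun x _ => integral_exp_mul_envLaw_le b x).trans_eq ?_
  rw [Finset.sum_const, nsmul_eq_mul, Finset.card_univ, card_V]

lemma exitRate_nonneg (a : ℝ) (e : V N → ℝ) (x : V N) : 0 ≤ exitRate a e x :=
  Finset.sum_nonneg fun z _ => rate_nonneg a e x z

lemma exitRate_eq_sum_flip (a : ℝ) (e : V N → ℝ) (x : V N) :
    exitRate a e x = ∑ i, Real.exp (a * (e x + e (flip i x))) :=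
  sum_neighbours x fun z => Real.exp (a * (e x + e z))

lemma sum_flip (f : V N → ℝ) (i : Fin N) : ∑ x, f (flip i x) = ∑ x, f x :=
  Equiv.sum_comp (Function.Involutive.toPerm (flip i) (flip_flip i)) f

lemma exp_mul_add_pow_four_le (a u v : ℝ) :
    Real.exp (a * (u + v)) ^ 4 ≤ (Real.exp (8 * a * u) + Real.exp (8 * a * v)) / 2 := by
  have hsplit : Real.exp (a * (u + v)) ^ 4 = Real.exp (4 * a * u) * Real.exp (4 * a * v) := by
    rw [← Real.exp_nat_mul, ← Real.exp_add]; congr 1; push_cast; ring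
  have hsq : ∀ t : ℝ, Real.exp (8 * a * t) = Real.exp (4 * a * t) ^ 2 := fun t => by
    rw [← Real.exp_nat_mul]; congr 1; push_cast; ring
  rw [hsplit, hsq, hsq]
  linarith [two_mul_le_add_sq (Real.exp (4 * a * u)) (Real.exp (4 * a * v))]

lemma exitRate_pow_four_le (a : ℝ) (e : V N → ℝ) (x : V N) :
    exitRate a e x ^ 4
      ≤ N ^ 3 * ∑ i, (Real.exp (8 * a * e x) + Real.exp (8 * a * e (flip i x))) / 2 := by
  rw [exitRate_eq_sum_flip]
  refine (pow_sum_le_card_mul_sum_pow (fun i _ => (Real.exp_pos _).le) 3).trans ?_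
  rw [Finset.card_univ, Fintype.card_fin]
  gcongr with i
  exact exp_mul_add_pow_four_le a _ _

lemma sum_exitRate_pow_four_le (a : ℝ) (e : V N → ℝ) :
    ∑ x, exitRate a e x ^ 4 ≤ N ^ 4 * ∑ x, Real.exp (8 * a * e x) := by
  have hflip : ∀ i : Fin N,
      ∑ x, (Real.exp (8 * a * e x) + Real.exp (8 * a * e (flip i x))) / 2
        = ∑ x, Real.exp (8 * a * e x) := fun i => by
    rw [← Finset.sum_div, Finset.sum_add_distrib, sum_flip (fun x => Real.exp (8 * a * e x)) i]
    ring
  refine (Finset.sum_le_sum fun x _ => exitRate_pow_four_le a e x).trans_eq ?_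
  rw [← Finset.mul_sum, Finset.sum_comm]
  simp only [hflip, Finset.sum_const, Finset.card_univ, Fintype.card_fin, nsmul_eq_mul]
  ring

lemma one_add_escape_stepKernel_pow_four_le (a : ℝ) (e : V N → ℝ) {q : ℕ} (hq : 1 ≤ q) (τ : ℕ)
    (x : V N) : (1 + 2 * ((τ * q : ℕ) : ℝ) * escape (stepKernel a e q) x) ^ 4
      ≤ 8 + 128 * τ ^ 4 * exitRate a e x ^ 4 := by
  have : (0 : ℝ) < q := by exact_mod_cast hq
  have hescape : 2 * ((τ * q : ℕ) : ℝ) * escape (stepKernel a e q) x ≤ 2 * τ * exitRate a e x := by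
    push_cast
    calc 2 * (τ * q : ℝ) * escape (stepKernel a e q) x
        ≤ 2 * (τ * q : ℝ) * (exitRate a e x / q) := by
          gcongr; exact escape_stepKernel_le a e q x
      _ = 2 * τ * exitRate a e x := by field_simp
  have h0 := escape_nonneg (isSymmStochastic_stepKernel a e q) x
  have hr0 := exitRate_nonneg a e x
  calc (1 + 2 * ((τ * q : ℕ) : ℝ) * escape (stepKernel a e q) x) ^ 4
      ≤ (1 + 2 * τ * exitRate a e x) ^ 4 := by gcongr
    _ ≤ 2 ^ 3 * (1 ^ 4 + (2 * τ * exitRate a e x) ^ 4) := add_pow_le (by norm_num) (by positivity) 4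
    _ = 8 + 128 * τ ^ 4 * exitRate a e x ^ 4 := by ring

lemma escapeMoment_stepKernel_le (a : ℝ) (e : V N → ℝ) {q : ℕ} (hq : 1 ≤ q) (τ : ℕ) :
    escapeMoment (stepKernel a e q) (τ * q) ≤ 8 + 128 * τ ^ 4 * N ^ 4 * expMean (8 * a) e := by
  calc escapeMoment (stepKernel a e q) (τ * q)
      ≤ ((2 : ℝ) ^ N)⁻¹ * ∑ x, (8 + 128 * τ ^ 4 * exitRate a e x ^ 4) := by
        unfold escapeMoment
        gcongr with x
        exact one_add_escape_stepKernel_pow_four_le a e hq τ x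
    _ = 8 + 128 * τ ^ 4 * (((2 : ℝ) ^ N)⁻¹ * ∑ x, exitRate a e x ^ 4) := by
        rw [Finset.sum_add_distrib, ← Finset.mul_sum, Finset.sum_const, nsmul_eq_mul,
          Finset.card_univ, card_V]
        field_simp
    _ ≤ 8 + 128 * τ ^ 4 * (((2 : ℝ) ^ N)⁻¹ * (N ^ 4 * ∑ x, Real.exp (8 * a * e x))) := by
        gcongr
        exact sum_exitRate_pow_four_le a e
    _ = 8 + 128 * τ ^ 4 * N ^ 4 * expMean (8 * a) e := by unfold expMean; ring

/-- A bound for the environment average of `escapeMoment` over a time `τ`. -/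
def momentBound (N : ℕ) (a : ℝ) (τ : ℕ) : ℝ :=
  8 + 128 * τ ^ 4 * N ^ 4 * (1 + Real.exp (32 * a ^ 2))

lemma momentBound_nonneg (N : ℕ) (a : ℝ) (τ : ℕ) : 0 ≤ momentBound N a τ := by
  unfold momentBound; positivity

lemma measurable_escapeMoment (a : ℝ) (q n : ℕ) :
    Measurable fun e : V N → ℝ => escapeMoment (stepKernel a e q) n := by
  unfold escapeMoment
  simp only [escape]
  refine (Finset.measurable_sum _ fun z _ => ?_).const_mul _
  refine ((Measurable.const_mul (Finset.measurable_sum _ fun y _ => ?_) _).const_add _).pow_const _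
  split_ifs
  · exact measurable_const
  · exact measurable_stepKernel a q z y

lemma integrable_escapeMoment_bound (a : ℝ) (τ : ℕ) :
    Integrable (fun e : V N → ℝ => 8 + 128 * τ ^ 4 * N ^ 4 * expMean (8 * a) e) (envLaw N) :=
  (integrable_const _).add ((integrable_expMean _).const_mul _)

lemma integrable_escapeMoment (a : ℝ) {q : ℕ} (hq : 1 ≤ q) (τ : ℕ) :
    Integrable (fun e : V N → ℝ => escapeMoment (stepKernel a e q) (τ * q)) (envLaw N) :=
  (integrable_escapeMoment_bound a τ).mono' (measurable_escapeMoment a q _).aestronglyMeasurable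
    (Eventually.of_forall fun e => by
      rw [Real.norm_eq_abs, abs_of_nonneg (escapeMoment_nonneg _ _)]
      exact escapeMoment_stepKernel_le a e hq τ)

lemma integral_escapeMoment_le (a : ℝ) {q : ℕ} (hq : 1 ≤ q) (τ : ℕ) :
    ∫ e : V N → ℝ, escapeMoment (stepKernel a e q) (τ * q) ∂(envLaw N) ≤ momentBound N a τ := by
  refine (integral_mono (integrable_escapeMoment a hq τ) (integrable_escapeMoment_bound a τ)
    fun e => escapeMoment_stepKernel_le a e hq τ).trans ?_
  rw [integral_add (integrable_const _) ((integrable_expMean _).const_mul _), integral_const_mul]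
  simp only [integral_const, probReal_univ, smul_eq_mul, one_mul]
  unfold momentBound
  gcongr
  refine (integral_expMean_le (8 * a)).trans_eq ?_
  ring_nf

/-- The mean of a path functional for the discretized walk, averaged over the environment. -/
def annealedExp (N : ℕ) (a : ℝ) (q n : ℕ) (G : (ℕ → V N) → ℝ) : ℝ :=
  ∫ e, statExp (stepKernel a e q) n G ∂(envLaw N)

lemma measurable_statExp_stepKernel (a : ℝ) (q n : ℕ) (G : (ℕ → V N) → ℝ) :
    Measurable fun e : V N → ℝ => statExp (stepKernel a e q) n G :=
  measurable_statExp (measurable_stepKernel a q) n G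

lemma abs_statExp_stepKernel_le (a : ℝ) (e : V N → ℝ) (q n : ℕ) {G : (ℕ → V N) → ℝ} {C : ℝ}
    (hG : ∀ ω, |G ω| ≤ C) : |statExp (stepKernel a e q) n G| ≤ C :=
  abs_statExp_le (isSymmStochastic_stepKernel a e q).nonneg
    (isSymmStochastic_stepKernel a e q).row_sum n hG

lemma integrable_statExp_stepKernel (a : ℝ) (q n : ℕ) {G : (ℕ → V N) → ℝ} {C : ℝ}
    (hG : ∀ ω, |G ω| ≤ C) :
    Integrable (fun e : V N → ℝ => statExp (stepKernel a e q) n G) (envLaw N) :=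
  integrable_of_bounded (measurable_statExp_stepKernel a q n G)
    fun e => abs_statExp_stepKernel_le a e q n hG

lemma abs_discCount_le (n : ℕ) (ω : ℕ → V N) : |discCount n ω| ≤ 2 ^ N := by
  rw [abs_of_nonneg (discCount_nonneg n ω)]
  exact discCount_le n ω

lemma annealedExp_discCount_le (a : ℝ) {q : ℕ} (hq : 1 ≤ q) (τ : ℕ) :
    annealedExp N a q (τ * q) (discCount (τ * q)) ≤ (N + 1) * momentBound N a τ := by
  refine (integral_mono (integrable_statExp_stepKernel a q _ (abs_discCount_le _))
    ((integrable_escapeMoment a hq τ).const_mul ((N : ℝ) + 1))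
    fun e => statExp_discCount_le (isSymmStochastic_stepKernel a e q) _).trans ?_
  rw [integral_const_mul]
  gcongr
  exact integral_escapeMoment_le a hq τ

/-! ### Fluctuations of the quenched mean -/

-- Paths that avoid the ball around `y` do not feel the energy of `y`.
lemma dependsOn_statExp_stepKernel (a : ℝ) (q n : ℕ) {y : V N} {F : (ℕ → V N) → ℝ}
    (hF : ∀ ω, seen y n ω = 1 → F ω = 0) :
    DependsOn (fun e : V N → ℝ => statExp (stepKernel a e q) n F) {y}ᶜ := fun e e' h => by
  simp only [statExp]
  congr 1
  refine Finset.sum_congr rfl fun z _ => pathExp_eq_of_avoid (B := {x | hammingDist x y ≤ 1})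
    (fun x hx z => stepKernel_eq_of_far a q (fun z hz => h z hz) hx z) n ?_ z
  rintro ω ⟨i, hi, hB⟩
  exact hF ω (seen_of_mem hi.le hB)

lemma abs_discCount_mul_seen_le (n : ℕ) (y : V N) (ω : ℕ → V N) :
    |discCount n ω * seen y n ω| ≤ 2 ^ N := by
  rw [abs_mul, abs_of_nonneg (seen_nonneg y n ω)]
  exact (mul_le_of_le_one_right (abs_nonneg _) (seen_le_one y n ω)).trans (abs_discCount_le n ω)

lemma abs_discCount_sub_mul_seen_le (n : ℕ) (y : V N) (ω : ℕ → V N) :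
    |discCount n ω - discCount n ω * seen y n ω| ≤ 2 ^ N := by
  rcases seen_eq_zero_or_one y n ω with h | h <;> rw [h]
  · simpa using abs_discCount_le n ω
  · simp

lemma variance_statExp_discCount_le (a : ℝ) {q : ℕ} (hq : 1 ≤ q) (τ : ℕ) :
    Var[fun e : V N → ℝ => statExp (stepKernel a e q) (τ * q) (discCount (τ * q)); envLaw N]
      ≤ (N + 1) ^ 4 * (((2 : ℝ) ^ N)⁻¹ * momentBound N a τ) := by
  have hES := variance_le_sum_integral_sub_sq (μ := fun _ : V N => posGaussian)
    (measurable_statExp_stepKernel a q (τ * q) (discCount (τ * q)))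
    (fun y => measurable_statExp_stepKernel a q (τ * q) _)
    (fun e => abs_statExp_stepKernel_le a e q (τ * q) (abs_discCount_le _))
    (fun y e => abs_statExp_stepKernel_le a e q (τ * q) (abs_discCount_sub_mul_seen_le _ y))
    (fun y => dependsOn_statExp_stepKernel a q (τ * q) fun ω hω => by rw [hω, mul_one, sub_self])
  simp only [statExp_sub, sub_sub_cancel] at hES
  rw [← envLaw] at hES
  have hint : ∀ y ∈ (Finset.univ : Finset (V N)), Integrable (fun e : V N → ℝ =>
      statExp (stepKernel a e q) (τ * q) (fun ω => discCount (τ * q) ω * seen y (τ * q) ω) ^ 2)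
      (envLaw N) := fun y _ =>
    (memLp_of_abs_le (measurable_statExp_stepKernel a q (τ * q) _) fun e =>
      abs_statExp_stepKernel_le a e q _ (abs_discCount_mul_seen_le _ y)).integrable_sq
  refine hES.trans ?_
  rw [← integral_finsetSum _ hint]
  refine (integral_mono (integrable_finsetSum _ hint)
    (((integrable_escapeMoment a hq τ).const_mul _).const_mul _) fun e =>
      sum_statExp_discCount_mul_seen_sq_le (isSymmStochastic_stepKernel a e q) _).trans ?_
  rw [integral_const_mul, integral_const_mul]
  gcongr
  exact integral_escapeMoment_le a hq τ

lemma integral_abs_statExp_sub_annealedExp_le (a : ℝ) {q : ℕ} (hq : 1 ≤ q) (τ : ℕ) :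
    ∫ e : V N → ℝ, |statExp (stepKernel a e q) (τ * q) (discCount (τ * q))
        - annealedExp N a q (τ * q) (discCount (τ * q))| ∂(envLaw N)
      ≤ 1 + (N + 1) ^ 4 * (((2 : ℝ) ^ N)⁻¹ * momentBound N a τ) :=
  (integral_abs_sub_integral_le (memLp_of_abs_le (measurable_statExp_stepKernel a q _ _) fun e =>
    abs_statExp_stepKernel_le a e q _ (abs_discCount_le _))).trans
    (add_le_add le_rfl (variance_statExp_discCount_le a hq τ))

/-! ### The annealed law of large numbers -/

lemma one_le_rate {a : ℝ} (ha : 0 ≤ a) {e : V N → ℝ} (he : ∀ x, 0 ≤ e x) (x y : V N)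
    (h : hammingDist x y = 1) : 1 ≤ rate a e x y := by
  rw [rate, if_pos h]
  exact Real.one_le_exp (mul_nonneg ha (add_nonneg (he x) (he y)))

lemma isMixedAfter_stepKernel {a : ℝ} (ha : 0 ≤ a) (hN : 1 ≤ N) {q : ℕ} (hq : 2 * N ≤ q)
    {e : V N → ℝ} (he : ∀ x, 0 ≤ e x) {g : ℕ} (hg : 2 * N ≤ g) :
    IsMixedAfter (stepKernel a e q) (g * q) ((2 : ℝ) ^ N)⁻¹ := fun _ hm =>
  stepKernel_pow_le hN hq (one_le_rate ha he) ((Nat.mul_le_mul_right q hg).trans hm)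

lemma inv_two_pow_le_one (N : ℕ) : ((2 : ℝ) ^ N)⁻¹ ≤ 1 :=
  inv_le_one_of_one_le₀ (one_le_pow₀ (by norm_num))

lemma blockError_eq_affine (η μG μW K : ℝ) :
    blockError N η μG μW K = K + (K * (N + 1) * μG
      + (2 * K ^ 2 * ((2 : ℝ) ^ N)⁻¹ + (1 + K * η)) * (N + 1) ^ 2 * μW) := by
  unfold blockError; ring

section BlockErrorIntegral

variable {Ω : Type*} [MeasurableSpace Ω] {μ : Measure Ω} [IsProbabilityMeasure μ] {G W : Ω → ℝ}

lemma integrable_blockError (hG : Integrable G μ) (hW : Integrable W μ) (η K : ℝ) :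
    Integrable (fun x => blockError N η (G x) (W x) K) μ := by
  simp only [blockError_eq_affine]
  exact (integrable_const _).add ((hG.const_mul _).add (hW.const_mul _))

lemma integral_blockError (hG : Integrable G μ) (hW : Integrable W μ) (η K : ℝ) :
    ∫ x, blockError N η (G x) (W x) K ∂μ
      = blockError N η (∫ x, G x ∂μ) (∫ x, W x ∂μ) K := by
  simp only [blockError_eq_affine]
  rw [integral_add (integrable_const _) (by fun_prop),
    integral_add (hG.const_mul _) (hW.const_mul _), integral_const_mul, integral_const_mul]
  simp

end BlockErrorIntegral

lemma blockError_le_blockError {η μG μG' μW μW' K K' : ℝ} (hη : 0 ≤ η) (hG : 0 ≤ μG)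
    (hW : 0 ≤ μW) (hK : 0 ≤ K) (hGG : μG ≤ μG') (hWW : μW ≤ μW') (hKK : K ≤ K') :
    blockError N η μG μW K ≤ blockError N η μG' μW' K' := by
  have := hG.trans hGG
  have := hW.trans hWW
  have := hK.trans hKK
  unfold blockError
  gcongr

/-- The error in the law of large numbers for `K` blocks, each made of an active time `w` and of
a gap `g`, after averaging over the environment: besides the quenched error it accounts for the
fluctuations of the quenched mean. -/
def annealedBlockError (N : ℕ) (a : ℝ) (w g : ℕ) (K : ℝ) : ℝ :=
  blockError N ((2 : ℝ) ^ N)⁻¹ (momentBound N a g) (momentBound N a w) K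
    + K * (1 + (N + 1) ^ 4 * (((2 : ℝ) ^ N)⁻¹ * momentBound N a w))

lemma statExp_abs_discCount_sub_const_le {a : ℝ} (ha : 0 ≤ a) (hN : 1 ≤ N) {q : ℕ}
    (hq : 2 * N ≤ q) {e : V N → ℝ} (he : ∀ x, 0 ≤ e x) (w : ℕ) {g : ℕ} (hg : 2 * N ≤ g) {K : ℕ}
    (hK : 1 ≤ K) (m : ℝ) :
    statExp (stepKernel a e q) (K * (w * q + g * q))
        (fun ω => |discCount (K * (w * q + g * q)) ω - K * m|)
      ≤ blockError N ((2 : ℝ) ^ N)⁻¹ (escapeMoment (stepKernel a e q) (g * q))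
          (escapeMoment (stepKernel a e q) (w * q)) K
        + K * |statExp (stepKernel a e q) (w * q) (discCount (w * q)) - m| := by
  have hA := isSymmStochastic_stepKernel a e q
  have hL : 1 ≤ w * q + g * q := le_add_left (Nat.mul_pos (by omega) (by omega))
  refine (statExp_mono hA _ fun ω => abs_sub_le _
    (K * statExp (stepKernel a e q) (w * q) (discCount (w * q))) _).trans ?_
  rw [statExp_add, statExp_const hA, ← mul_sub, abs_mul, Nat.abs_cast]
  exact add_le_add (statExp_abs_discCount_sub_le hA (isMixedAfter_stepKernel ha hN hq he hg)
    (by positivity) (inv_two_pow_le_one N) hK hL) le_rfl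

lemma annealedExp_abs_discCount_sub_le {a : ℝ} (ha : 0 ≤ a) (hN : 1 ≤ N) {q : ℕ}
    (hq : 2 * N ≤ q) (w : ℕ) {g : ℕ} (hg : 2 * N ≤ g) {K : ℕ} (hK : 1 ≤ K) :
    annealedExp N a q (K * (w + g) * q) (fun ω => |discCount (K * (w + g) * q) ω
      - K * annealedExp N a q (w * q) (discCount (w * q))|) ≤ annealedBlockError N a w g K := by
  have hq1 : 1 ≤ q := by omega
  rw [show K * (w + g) * q = K * (w * q + g * q) by ring]
  have hgi := integrable_escapeMoment (N := N) a hq1 g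
  have hwi := integrable_escapeMoment (N := N) a hq1 w
  set m := annealedExp N a q (w * q) (discCount (w * q))
  have herr := integrable_blockError (N := N) hgi hwi ((2 : ℝ) ^ N)⁻¹ K
  have hfluct := (((integrable_statExp_stepKernel (N := N) a q (w * q)
    (abs_discCount_le (w * q))).sub (integrable_const m)).abs).const_mul (K : ℝ)
  have hbound : ∀ ω, |(|discCount (N := N) (K * (w * q + g * q)) ω - K * m|)|
      ≤ 2 ^ N + |K * m| := fun ω => by
    rw [abs_abs]
    exact (abs_sub _ _).trans (add_le_add (abs_discCount_le _ ω) le_rfl)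
  have hquenched : ∀ᵐ e ∂(envLaw N), _ := (ae_nonneg_envLaw N).mono fun e he =>
    statExp_abs_discCount_sub_const_le ha hN hq he w hg hK m
  refine (integral_mono_ae (integrable_statExp_stepKernel a q _ hbound) (herr.add hfluct)
    hquenched).trans ?_
  rw [integral_add' herr hfluct, integral_blockError hgi hwi, integral_const_mul]
  exact add_le_add (blockError_le_blockError (by positivity)
    (integral_nonneg fun e => escapeMoment_nonneg _ _)
    (integral_nonneg fun e => escapeMoment_nonneg _ _) (Nat.cast_nonneg K)
    (integral_escapeMoment_le a hq1 g) (integral_escapeMoment_le a hq1 w) le_rfl)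
    (mul_le_mul_of_nonneg_left (integral_abs_statExp_sub_annealedExp_le a hq1 w)
      (Nat.cast_nonneg K))

lemma le_annealedExp_discCount {a : ℝ} (ha : 0 ≤ a) (hN : 1 ≤ N) {q : ℕ}
    (hq : 2 * N ≤ q) {g : ℕ} (hg : 2 * N ≤ g) (v : ℕ) :
    (v + 1 : ℝ) - 2 * (v + 1) ^ 2 * ((2 : ℝ) ^ N)⁻¹
      ≤ annealedExp N a q (v * g * q) (discCount (v * g * q)) := by
  have h : ∀ᵐ e ∂(envLaw N), (v + 1 : ℝ) - 2 * (v + 1) ^ 2 * ((2 : ℝ) ^ N)⁻¹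
      ≤ statExp (stepKernel a e q) (v * g * q) (discCount (v * g * q)) := by
    filter_upwards [ae_nonneg_envLaw N] with e he
    exact le_statExp_discCount (isSymmStochastic_stepKernel a e q)
      (isMixedAfter_stepKernel ha hN hq he hg) (inv_two_pow_le_one N) (mul_assoc v g q).ge
  have := integral_mono_ae (integrable_const _)
    (integrable_statExp_stepKernel a q _ (abs_discCount_le _)) h
  rwa [integral_const, probReal_univ, one_smul] at this

end Annealed

/-! ### The transition matrices -/

section Transition

variable {N : ℕ}

lemma generator_eq_rate_add (a : ℝ) (e : V N → ℝ) (x y : V N) :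
    generator a e x y = rate a e x y + if x = y then -exitRate a e x else 0 := by
  by_cases h : x = y
  · subst h; simp [generator, rate_self, exitRate]
  · simp [generator, h]

lemma sum_generator (a : ℝ) (e : V N → ℝ) (x : V N) : ∑ y, generator a e x y = 0 := by
  simp [generator_eq_rate_add, Finset.sum_add_distrib, exitRate]

attribute [local instance] Matrix.linftyOpNormedRing Matrix.linftyOpNormedAlgebra

section MatrixExp

variable {S : Type*} [Fintype S] [DecidableEq S]

lemma hasSum_matrix_exp (M : Matrix S S ℝ) (x y : S) :
    HasSum (fun n : ℕ => ((n.factorial : ℝ)⁻¹) * (M ^ n) x y) (NormedSpace.exp M x y) :=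
  Pi.hasSum.1 (Pi.hasSum.1 (NormedSpace.exp_series_hasSum_exp' (𝕂 := ℝ) M) x) y

-- A multiple of the identity commutes with `M`, so the diagonal may be assumed nonnegative.
lemma matrix_exp_nonneg {M : Matrix S S ℝ} (hM : ∀ x y, x ≠ y → 0 ≤ M x y) (x y : S) :
    0 ≤ NormedSpace.exp M x y := by
  obtain ⟨c, hc⟩ : ∃ c : ℝ, ∀ x, 0 ≤ M x x + c := by
    refine ⟨∑ x, |M x x|, fun x => ?_⟩
    have := Finset.single_le_sum (f := fun x => |M x x|) (fun _ _ => abs_nonneg _)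
      (Finset.mem_univ x)
    linarith [neg_abs_le (M x x)]
  have hcomm : Commute (M + c • (1 : Matrix S S ℝ)) (Matrix.diagonal fun _ => -c) := by
    rw [← Matrix.smul_one_eq_diagonal]
    exact (Commute.one_right _).smul_right _
  have hsplit : M = (M + c • (1 : Matrix S S ℝ)) + Matrix.diagonal fun _ => -c := by
    rw [← Matrix.smul_one_eq_diagonal, neg_smul]; abel
  have hshift : ∀ x y, 0 ≤ (M + c • (1 : Matrix S S ℝ)) x y := fun x y => by
    by_cases h : x = y
    · subst h; simpa using hc x
    · simpa [h] using hM x y h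
  rw [hsplit, Matrix.exp_add_of_commute _ _ hcomm, Matrix.exp_diagonal, Matrix.mul_diagonal,
    Pi.coe_exp, ← Real.exp_eq_exp_ℝ]
  exact mul_nonneg ((hasSum_matrix_exp _ x y).nonneg fun n =>
    mul_nonneg (by positivity) (Matrix.pow_apply_nonneg hshift n x y)) (Real.exp_pos _).le

end MatrixExp

lemma transition_nonneg (a : ℝ) (e : V N → ℝ) {t : ℝ} (ht : 0 ≤ t) (x y : V N) :
    0 ≤ transition a e t x y := by
  refine matrix_exp_nonneg (fun x y h => ?_) x y
  simp only [Matrix.smul_apply, smul_eq_mul, generator, Matrix.of_apply, if_neg h]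
  exact mul_nonneg ht (rate_nonneg a e x y)

lemma sum_generator_pow (a : ℝ) (e : V N → ℝ) (t : ℝ) (x : V N) {n : ℕ} (hn : n ≠ 0) :
    ∑ y, ((t • generator a e) ^ n) x y = 0 := by
  obtain ⟨n, rfl⟩ := Nat.exists_eq_succ_of_ne_zero hn
  simp only [Nat.succ_eq_add_one, pow_succ, Matrix.mul_apply]
  rw [Finset.sum_comm]
  refine Finset.sum_eq_zero fun z _ => ?_
  simp only [← Finset.mul_sum, Matrix.smul_apply, smul_eq_mul, sum_generator, mul_zero]

lemma transition_sum (a : ℝ) (e : V N → ℝ) (t : ℝ) (x : V N) :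
    ∑ y, transition a e t x y = 1 := by
  have hseries := hasSum_sum fun y (_ : y ∈ Finset.univ) =>
    hasSum_matrix_exp (t • generator a e) x y
  simp only [← Finset.mul_sum] at hseries
  have hsingle := hasSum_single (f := fun n : ℕ =>
    ((n.factorial : ℝ)⁻¹) * ∑ y, ((t • generator a e) ^ n) x y) 0
    fun n hn => by rw [sum_generator_pow a e t x hn, mul_zero]
  exact hseries.unique (by simpa [Matrix.one_apply] using hsingle)

lemma transition_le_one (a : ℝ) (e : V N → ℝ) {t : ℝ} (ht : 0 ≤ t) (x y : V N) :
    transition a e t x y ≤ 1 :=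
  (Finset.single_le_sum (f := fun y => transition a e t x y)
    (fun y _ => transition_nonneg a e ht x y) (Finset.mem_univ y)).trans_eq (transition_sum a e t x)

lemma continuous_rate (a : ℝ) (x y : V N) : Continuous fun e : V N → ℝ => rate a e x y := by
  unfold rate; split_ifs <;> fun_prop

lemma continuous_generator (a : ℝ) : Continuous fun e : V N → ℝ => generator a e := by
  refine continuous_matrix fun x y => ?_
  simp only [generator, Matrix.of_apply]
  split_ifs
  · exact (continuous_finsetSum _ fun z _ => continuous_rate a x z).neg
  · exact continuous_rate a x y

lemma continuous_transition (a t : ℝ) (x y : V N) :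
    Continuous fun e : V N → ℝ => transition a e t x y :=
  ((NormedSpace.exp_continuous (𝔸 := Matrix (V N) (V N) ℝ)).comp
    ((continuous_generator a).const_smul t)).matrix_elem x y

lemma tendsto_mul_transition_sub_one (a : ℝ) (e : V N → ℝ) (x y : V N) :
    Tendsto (fun q : ℕ => (q : ℝ) * (transition a e (1 / q) x y - (1 : Matrix (V N) (V N) ℝ) x y))
      atTop (𝓝 (generator a e x y)) := by
  have hslope := hasDerivAt_exp_smul_const (𝕂 := ℝ) (generator a e) (0 : ℝ)
  rw [hasDerivAt_iff_tendsto_slope_zero] at hslope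
  simp only [zero_smul, NormedSpace.exp_zero, one_mul, zero_add] at hslope
  have hq : Tendsto (fun q : ℕ => (1 / q : ℝ)) atTop (𝓝[≠] 0) := by
    refine tendsto_nhdsWithin_iff.2 ⟨tendsto_one_div_atTop_nhds_zero_nat, ?_⟩
    filter_upwards [eventually_gt_atTop 0] with q hq
    have : (q : ℝ) ≠ 0 := by positivity
    simpa using this
  refine (((continuous_id.matrix_elem x y).tendsto (generator a e)).comp
    (hslope.comp hq)).congr fun q => ?_
  simp only [Function.comp_apply, id, one_div, inv_inv]
  rfl

lemma eventually_mul_stepRate_eq (a : ℝ) (e : V N → ℝ) (hN : 1 ≤ N) (x z : V N) :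
    ∀ᶠ q : ℕ in atTop, (q : ℝ) * stepRate a e q x z = rate a e x z := by
  obtain ⟨n, hn⟩ := exists_nat_ge (2 * N * rate a e x z)
  filter_upwards [eventually_ge_atTop n, eventually_gt_atTop 0] with q hq hq0
  have hq0' : (0 : ℝ) < q := by exact_mod_cast hq0
  have hq' : (n : ℝ) ≤ q := by exact_mod_cast hq
  rw [stepRate, min_eq_left]
  · field_simp
  · rw [div_le_div_iff₀ hq0' (by positivity)]
    linarith

lemma eventually_mul_stepKernel_sub_one_eq (a : ℝ) (e : V N → ℝ) (hN : 1 ≤ N) (x y : V N) :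
    ∀ᶠ q : ℕ in atTop, (q : ℝ) * (stepKernel a e q x y - (1 : Matrix (V N) (V N) ℝ) x y)
      = generator a e x y := by
  filter_upwards [eventually_all.2 (eventually_mul_stepRate_eq a e hN x)] with q hq
  by_cases h : x = y
  · subst h
    simp only [stepKernel_self, Matrix.one_apply_eq, generator, Matrix.of_apply, if_true]
    rw [← Finset.sum_congr rfl fun z _ => hq z, ← Finset.mul_sum]
    ring
  · simp only [stepKernel_of_ne a e q h, Matrix.one_apply_ne h, generator, Matrix.of_apply,
      if_neg h, sub_zero, hq]

lemma tendsto_mul_abs_transition_sub_stepKernel (a : ℝ) (e : V N → ℝ) (hN : 1 ≤ N) (x y : V N) :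
    Tendsto (fun q : ℕ => (q : ℝ) * |transition a e (1 / q) x y - stepKernel a e q x y|) atTop
      (𝓝 0) := by
  have h := ((tendsto_mul_transition_sub_one a e x y).sub_const (generator a e x y)).abs
  rw [sub_self, abs_zero] at h
  refine h.congr' ?_
  filter_upwards [eventually_mul_stepKernel_sub_one_eq a e hN x y] with q hq
  rw [← hq, ← mul_sub, abs_mul, Nat.abs_cast, sub_sub_sub_cancel_right]

/-- The sum of the absolute values of the differences of the entries of two matrices. -/
def entryDist {S : Type*} [Fintype S] (A B : Matrix S S ℝ) : ℝ := ∑ x, ∑ y, |A x y - B x y|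

lemma tendsto_mul_entryDist_transition_stepKernel (a : ℝ) (e : V N → ℝ) (hN : 1 ≤ N) :
    Tendsto (fun q : ℕ => q * entryDist (transition a e (1 / q)) (stepKernel a e q)) atTop
      (𝓝 0) := by
  have h := tendsto_finsetSum Finset.univ fun x _ => tendsto_finsetSum Finset.univ
    fun y _ => tendsto_mul_abs_transition_sub_stepKernel a e hN x y
  simp only [Finset.sum_const_zero] at h
  refine h.congr fun q => ?_
  simp only [entryDist, Finset.mul_sum]

lemma abs_statExp_sub_le {S : Type*} [Fintype S] [Nonempty S] {A B : Matrix S S ℝ}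
    (hA : ∀ x y, 0 ≤ A x y) (hA1 : ∀ x, ∑ y, A x y = 1) (hB : ∀ x y, 0 ≤ B x y)
    (hB1 : ∀ x, ∑ y, B x y = 1) {C : ℝ} (hC : 0 ≤ C) (n : ℕ) {G : (ℕ → S) → ℝ}
    (hG : ∀ ω, |G ω| ≤ C) :
    |statExp A n G - statExp B n G| ≤ n * entryDist A B * C := by
  have hrow : ∀ x, ∑ y, |A x y - B x y| ≤ entryDist A B := fun x =>
    Finset.single_le_sum (f := fun x => ∑ y, |A x y - B x y|)
      (fun _ _ => Finset.sum_nonneg fun _ _ => abs_nonneg _) (Finset.mem_univ x)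
  have hcard : (0 : ℝ) < Fintype.card S := by exact_mod_cast Fintype.card_pos
  rw [statExp, statExp, ← mul_sub, ← Finset.sum_sub_distrib, abs_mul,
    abs_of_pos (inv_pos.2 hcard), inv_mul_le_iff₀ hcard]
  refine (Finset.abs_sum_le_sum_abs _ _).trans ((Finset.sum_le_sum fun y _ =>
    abs_pathExp_sub_le hA hA1 hB hB1 hrow hC n hG y).trans_eq ?_)
  rw [Finset.sum_const, nsmul_eq_mul, Finset.card_univ]

lemma tendsto_statExp_transition_sub (a : ℝ) (e : V N → ℝ) (hN : 1 ≤ N) (τ : ℕ)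
    {G : ℕ → (ℕ → V N) → ℝ} {C : ℝ} (hC : 0 ≤ C) (hG : ∀ q ω, |G q ω| ≤ C) :
    Tendsto (fun q : ℕ => statExp (transition a e (1 / q)) (τ * q) (G q)
      - statExp (stepKernel a e q) (τ * q) (G q)) atTop (𝓝 0) := by
  have hbound := (tendsto_mul_entryDist_transition_stepKernel a e hN).const_mul (τ * C)
  rw [mul_zero] at hbound
  refine squeeze_zero_norm (fun q => ?_) hbound
  have hS := isSymmStochastic_stepKernel a e q
  refine (abs_statExp_sub_le (transition_nonneg a e (by positivity)) (transition_sum a e (1 / q))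
    hS.nonneg hS.row_sum hC (τ * q) (hG q)).trans_eq ?_
  push_cast
  ring

end Transition

/-! ### Discrete skeletons of the walk -/

section Skeleton

/-- A finite path, extended by its last position. -/
def extendPath {S : Type*} {n : ℕ} (x : Fin (n + 1) → S) : ℕ → S :=
  fun i => x ⟨min i n, by omega⟩

lemma extendPath_zero {S : Type*} {n : ℕ} (x : Fin (n + 1) → S) : extendPath x 0 = x 0 := by
  simp [extendPath]

lemma extendPath_cons {S : Type*} {n : ℕ} (y : S) (x : Fin (n + 1) → S) :
    extendPath (Fin.cons y x : Fin (n + 2) → S) = consPath y (extendPath x) := by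
  funext i
  cases i with
  | zero => rfl
  | succ i =>
    have hidx : (⟨min (i + 1) (n + 1), by omega⟩ : Fin (n + 2)) = Fin.succ ⟨min i n, by omega⟩ := by
      ext; simp
    simp only [extendPath, consPath_succ]
    rw [hidx, Fin.cons_succ]

/-- The weight of a finite path: the product of its transition probabilities. -/
def pathWeight {S : Type*} (A : Matrix S S ℝ) {n : ℕ} (x : Fin (n + 1) → S) : ℝ :=
  ∏ i : Fin n, A (x i.castSucc) (x i.succ)

lemma pathWeight_cons {S : Type*} (A : Matrix S S ℝ) {n : ℕ} (y : S) (x : Fin (n + 1) → S) :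
    pathWeight A (Fin.cons y x : Fin (n + 2) → S) = A y (x 0) * pathWeight A x :=
  Fin.prod_univ_succ _

lemma sum_pathExp_eq_sum_pathWeight {S : Type*} [Fintype S] (A : Matrix S S ℝ) :
    ∀ (n : ℕ) (G : (ℕ → S) → ℝ), ∑ y, pathExp A n G y
      = ∑ x : Fin (n + 1) → S, pathWeight A x * G (extendPath x)
  | 0, G => by
      rw [← Equiv.sum_comp (Equiv.funUnique (Fin 1) S).symm]
      refine Finset.sum_congr rfl fun y _ => ?_
      simp only [pathExp, pathWeight, Finset.univ_eq_empty, Finset.prod_empty, one_mul]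
      rfl
  | n + 1, G => by
      rw [← Equiv.sum_comp (Fin.consEquiv fun _ : Fin (n + 2) => S), Fintype.sum_prod_type]
      refine Finset.sum_congr rfl fun y _ => ?_
      have hfirst : ∀ z, A y z * pathExp A n (fun ω => G (consPath y ω)) z
          = pathExp A n (fun ω => A y (ω 0) * G (consPath y ω)) z := fun z =>
        (pathExp_mul_of_dependsOn_zero A (F := fun ω => A y (ω 0))
          (fun ω ω' h => congrArg (A y) (h 0 (Set.mem_Iic.2 le_rfl))) n _ z).symm
      simp only [pathExp, hfirst]
      rw [sum_pathExp_eq_sum_pathWeight A n]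
      refine Finset.sum_congr rfl fun x _ => ?_
      simp only [Fin.consEquiv, Equiv.coe_fn_mk]
      rw [extendPath_cons, extendPath_zero, pathWeight_cons, mul_left_comm, mul_assoc]

variable {N : ℕ} {Ω : Type*} {X : ℝ≥0 → Ω → V N}

/-- The positions of the walk at the multiples of `1 / q`. -/
def skeleton (X : ℝ≥0 → Ω → V N) (q : ℕ) (ω : Ω) : ℕ → V N := fun i => X (i / q) ω

lemma ncard_eq_sum {S : Type*} [Fintype S] (s : Set S) [DecidablePred (· ∈ s)] :
    (s.ncard : ℝ) = ∑ x, if x ∈ s then (1 : ℝ) else 0 := by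
  rw [Set.ncard_eq_toFinset_card', ← Finset.sum_filter, Finset.sum_const, nsmul_eq_mul, mul_one]
  congr 2
  ext x
  simp

lemma eventually_exists_skeleton_eq {ω : Ω} {s : ℝ≥0} (hω : ∀ᶠ r in 𝓝[≥] s, X r ω = X s ω)
    {τ : ℕ} (hs : (s : ℝ) ≤ τ) :
    ∀ᶠ q : ℕ in atTop, ∃ i ≤ τ * q, skeleton X q ω i = X s ω := by
  have hlim : Tendsto (fun q : ℕ => (⌈(s : ℝ) * q⌉₊ : ℝ≥0) / q) atTop (𝓝 s) := by
    rw [← NNReal.tendsto_coe]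
    exact ((tendsto_nat_ceil_mul_div_atTop s.coe_nonneg).comp tendsto_natCast_atTop_atTop)
  have hge : ∀ᶠ q : ℕ in atTop, s ≤ (⌈(s : ℝ) * q⌉₊ : ℝ≥0) / q := by
    filter_upwards [eventually_gt_atTop 0] with q hq
    rw [← NNReal.coe_le_coe]
    push_cast
    rw [le_div_iff₀ (by exact_mod_cast hq)]
    exact Nat.le_ceil _
  filter_upwards [(tendsto_nhdsWithin_iff.2 ⟨hlim, hge⟩).eventually hω] with q hq
  refine ⟨⌈(s : ℝ) * q⌉₊, Nat.ceil_le.2 ?_, hq⟩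
  push_cast
  gcongr

lemma skeleton_mem_discovered {q τ i : ℕ} (hq : 0 < q) (hi : i ≤ τ * q) {ω : Ω} {x : V N}
    (h : hammingDist (skeleton X q ω i) x ≤ 1) : x ∈ discovered (fun s => X s ω) τ := by
  refine ⟨i / q, ?_, h⟩
  push_cast
  rw [div_le_iff₀ (by exact_mod_cast hq)]
  exact_mod_cast hi

lemma eventually_discCount_skeleton {ω : Ω} (hω : ∀ s, ∀ᶠ r in 𝓝[≥] s, X r ω = X s ω) (τ : ℕ) :
    ∀ᶠ q : ℕ in atTop, discCount (τ * q) (skeleton X q ω) = numDiscovered X τ ω := by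
  classical
  have hiff : ∀ x : V N, ∀ᶠ q : ℕ in atTop,
      ((∃ i ≤ τ * q, hammingDist (skeleton X q ω i) x ≤ 1) ↔
        x ∈ discovered (fun s => X s ω) τ) := fun x => by
    by_cases hx : x ∈ discovered (fun s => X s ω) τ
    · have ⟨s, hs, hd⟩ := hx
      filter_upwards [eventually_exists_skeleton_eq (hω s) hs] with q ⟨i, hi, hXi⟩
      exact iff_of_true ⟨i, hi, hXi ▸ hd⟩ hx
    · filter_upwards [eventually_gt_atTop 0] with q hq
      exact iff_of_false (fun ⟨i, hi, hd⟩ => hx (skeleton_mem_discovered hq hi hd)) hx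
  filter_upwards [eventually_all.2 hiff] with q hq
  rw [numDiscovered, ncard_eq_sum, discCount]
  refine Finset.sum_congr rfl fun x _ => ?_
  simp only [seen, hq x]

lemma numDiscovered_le (T : ℝ) (ω : Ω) : (numDiscovered X T ω : ℝ) ≤ 2 ^ N := by
  have h := Set.ncard_le_card (discovered (fun s => X s ω) T)
  rw [Nat.card_eq_fintype_card] at h
  rw [← card_V N]
  exact_mod_cast h

lemma numDiscovered_mul_time (T : ℝ≥0) (hT : T ≠ 0) (ω : Ω) :
    numDiscovered (fun s => X (T * s)) 1 ω = numDiscovered X T ω := by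
  refine congrArg Set.ncard (Set.ext fun x => ⟨?_, ?_⟩)
  · rintro ⟨s, hs, hd⟩
    exact ⟨T * s, mod_cast mul_le_of_le_one_right T.coe_nonneg hs, hd⟩
  · rintro ⟨s, hs, hd⟩
    refine ⟨s / T, ?_, by simpa only [mul_div_cancel₀ _ hT] using hd⟩
    push_cast
    exact div_le_one_of_le₀ hs T.coe_nonneg

/-- The first `n + 1` positions of the skeleton. -/
def skeletonPositions (X : ℝ≥0 → Ω → V N) (q n : ℕ) (ω : Ω) : Fin (n + 1) → V N :=
  fun i => X ((i : ℕ) / q) ω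

lemma apply_skeleton_of_dependsOn {q n : ℕ} {G : (ℕ → V N) → ℝ} (hG : DependsOn G (Set.Iic n))
    (ω : Ω) : G (skeleton X q ω) = G (extendPath (skeletonPositions X q n ω)) :=
  hG fun i hi => by
    have : min i n = i := min_eq_left hi
    simp only [skeleton, extendPath, skeletonPositions, this]

lemma dependsOn_comp_discCount (φ : ℝ → ℝ) (n : ℕ) :
    DependsOn (fun ω : ℕ → V N => φ (discCount n ω)) (Set.Iic n) :=
  fun _ _ h => congrArg φ (dependsOn_discCount n h)

variable [MeasurableSpace Ω] {P : Measure Ω} {a : ℝ} {E : Ω → V N → ℝ}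

lemma measurable_skeletonPositions (hX : ∀ s, Measurable (X s)) (q n : ℕ) :
    Measurable (skeletonPositions X q n) :=
  measurable_pi_lambda _ fun _ => hX _

lemma measurable_apply_skeleton (hX : ∀ s, Measurable (X s)) (q : ℕ) {n : ℕ}
    {G : (ℕ → V N) → ℝ} (hG : DependsOn G (Set.Iic n)) :
    Measurable fun ω => G (skeleton X q ω) := by
  simp only [apply_skeleton_of_dependsOn hG]
  exact (measurable_of_finite fun x => G (extendPath x)).comp (measurable_skeletonPositions hX q n)

lemma aemeasurable_numDiscovered_natCast (hm : ∀ s, Measurable (X s))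
    (hr : ∀ᵐ ω ∂P, ∀ s, ∀ᶠ r in 𝓝[≥] s, X r ω = X s ω) (τ : ℕ) :
    AEMeasurable (fun ω => (numDiscovered X τ ω : ℝ)) P := by
  refine aemeasurable_of_tendsto_metrizable_ae atTop (fun q : ℕ =>
    (measurable_apply_skeleton hm q (dependsOn_discCount (τ * q))).aemeasurable) ?_
  filter_upwards [hr] with ω hω
  exact tendsto_const_nhds.congr' ((eventually_discCount_skeleton hω τ).mono fun q hq => hq.symm)

lemma tendsto_mul_nhdsGE (T s : ℝ≥0) : Tendsto (fun r => T * r) (𝓝[≥] s) (𝓝[≥] (T * s)) :=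
  tendsto_nhdsWithin_iff.2
    ⟨((continuous_const_mul T).tendsto s).mono_left nhdsWithin_le_nhds,
      eventually_mem_nhdsWithin.mono fun _ hr => mul_le_mul_right hr T⟩

lemma aemeasurable_numDiscovered (hX : IsAnnealedWalk a P E X) {T : ℝ} (hT : 0 < T) :
    AEMeasurable (fun ω => (numDiscovered X T ω : ℝ)) P := by
  lift T to ℝ≥0 using hT.le
  have h := aemeasurable_numDiscovered_natCast (X := fun s => X (T * s)) (P := P)
    (fun s => hX.measurable_walk _) (by
      filter_upwards [hX.right_continuous] with ω hω s
      exact (tendsto_mul_nhdsGE T s).eventually (hω (T * s))) 1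
  refine h.congr (Eventually.of_forall fun ω => ?_)
  have hcount := numDiscovered_mul_time (X := X) T (by exact_mod_cast hT.ne') ω
  simp only [Nat.cast_one, hcount]

lemma quenchedProb_skeleton (a : ℝ) (e : V N → ℝ) (q n : ℕ) (x : Fin (n + 1) → V N) :
    quenchedProb a e n (fun i => (i : ℕ) / q) x
      = ((2 : ℝ) ^ N)⁻¹ * pathWeight (transition a e (1 / q)) x := by
  have hstep : ∀ i : Fin n, (((i.succ : ℕ) / q : ℝ≥0) : ℝ) - (((i.castSucc : ℕ) / q : ℝ≥0) : ℝ)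
      = 1 / q := fun i => by
    simp only [Fin.val_succ, Fin.val_castSucc]
    push_cast
    ring
  simp only [quenchedProb, pathWeight, hstep]

lemma pathWeight_transition_nonneg (a : ℝ) (e : V N → ℝ) {t : ℝ} (ht : 0 ≤ t) {n : ℕ}
    (x : Fin (n + 1) → V N) : 0 ≤ pathWeight (transition a e t) x :=
  Finset.prod_nonneg fun _ _ => transition_nonneg a e ht _ _

lemma integrable_pathWeight_transition (a : ℝ) {t : ℝ} (ht : 0 ≤ t) {n : ℕ}
    (x : Fin (n + 1) → V N) :
    Integrable (fun e => pathWeight (transition a e t) x) (envLaw N) := by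
  refine integrable_of_bounded (C := 1) (Finset.measurable_prod _ fun i _ =>
    (continuous_transition a t _ _).measurable) fun e => ?_
  rw [abs_of_nonneg (pathWeight_transition_nonneg a e ht x)]
  exact Finset.prod_le_one (fun i _ => transition_nonneg a e ht _ _)
    fun i _ => transition_le_one a e ht _ _

lemma measureReal_map_skeletonPositions (hX : IsAnnealedWalk a P E X) (q n : ℕ)
    (x : Fin (n + 1) → V N) :
    (P.map (skeletonPositions X q n)).real {x}
      = ∫ e, ((2 : ℝ) ^ N)⁻¹ * pathWeight (transition a e (1 / q)) x ∂(envLaw N) := by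
  have hmono : Monotone fun i : Fin (n + 1) => ((i : ℕ) / q : ℝ≥0) := fun i j h => by
    change (((i : ℕ) : ℝ≥0) / q) ≤ ((j : ℕ) : ℝ≥0) / q
    gcongr
    exact h
  have hevent : skeletonPositions X q n ⁻¹' {x}
      = {ω | E ω ∈ Set.univ ∧ ∀ i : Fin (n + 1), X ((i : ℕ) / q) ω = x i} := by
    ext ω; simp [skeletonPositions, funext_iff]
  have hnonneg : ∀ e, 0 ≤ ((2 : ℝ) ^ N)⁻¹ * pathWeight (transition a e (1 / q)) x := fun e =>
    mul_nonneg (by positivity) (pathWeight_transition_nonneg a e (by positivity) x)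
  rw [measureReal_def, Measure.map_apply (measurable_skeletonPositions hX.measurable_walk q n)
    (measurableSet_singleton x), hevent,
    hX.finite_dim Set.univ MeasurableSet.univ n _ (by simp) hmono x, Measure.restrict_univ]
  simp only [quenchedProb_skeleton]
  rw [← ofReal_integral_eq_lintegral_ofReal
    ((integrable_pathWeight_transition a (by positivity) x).const_mul _)
    (Eventually.of_forall hnonneg), ENNReal.toReal_ofReal (integral_nonneg hnonneg)]

variable [IsProbabilityMeasure P]

lemma integral_skeleton (hX : IsAnnealedWalk a P E X) (q : ℕ) {n : ℕ} {G : (ℕ → V N) → ℝ}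
    (hG : DependsOn G (Set.Iic n)) :
    ∫ ω, G (skeleton X q ω) ∂P = ∫ e, statExp (transition a e (1 / q)) n G ∂(envLaw N) := by
  have hint : ∀ x : Fin (n + 1) → V N, Integrable (fun e =>
      ((2 : ℝ) ^ N)⁻¹ * pathWeight (transition a e (1 / q)) x * G (extendPath x)) (envLaw N) :=
    fun x => ((integrable_pathWeight_transition a (by positivity) x).const_mul _).mul_const _
  have := Measure.isProbabilityMeasure_map (μ := P)
    (measurable_skeletonPositions hX.measurable_walk q n).aemeasurable
  simp only [apply_skeleton_of_dependsOn hG]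
  rw [← integral_map (f := fun x => G (extendPath x))
    (measurable_skeletonPositions hX.measurable_walk q n).aemeasurable
    (measurable_of_finite _).aestronglyMeasurable, integral_fintype Integrable.of_finite]
  simp only [measureReal_map_skeletonPositions hX, smul_eq_mul, ← integral_mul_const]
  rw [← integral_finsetSum _ fun x _ => hint x]
  simp only [statExp, sum_pathExp_eq_sum_pathWeight, card_V, Finset.mul_sum, mul_assoc]

lemma tendsto_integral_comp_discCount_skeleton (hX : IsAnnealedWalk a P E X) (τ : ℕ)
    {φ : ℝ → ℝ} {C : ℝ} (hφ : ∀ u, 0 ≤ u → u ≤ 2 ^ N → |φ u| ≤ C) :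
    Tendsto (fun q : ℕ => ∫ ω, φ (discCount (τ * q) (skeleton X q ω)) ∂P) atTop
      (𝓝 (∫ ω, φ (numDiscovered X τ ω) ∂P)) := by
  refine tendsto_integral_of_dominated_convergence (fun _ => C)
    (fun q => (measurable_apply_skeleton hX.measurable_walk q
      (dependsOn_comp_discCount φ (τ * q))).aestronglyMeasurable)
    (integrable_const _) (fun q => Eventually.of_forall fun ω =>
      hφ _ (discCount_nonneg _ _) (discCount_le _ _)) ?_
  filter_upwards [hX.right_continuous] with ω hω
  exact tendsto_const_nhds.congr'
    ((eventually_discCount_skeleton hω τ).mono fun q hq => by simp only [hq])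

lemma abs_statExp_transition_le (a : ℝ) (e : V N → ℝ) {t : ℝ} (ht : 0 ≤ t) (n : ℕ)
    {G : (ℕ → V N) → ℝ} {C : ℝ} (hG : ∀ ω, |G ω| ≤ C) :
    |statExp (transition a e t) n G| ≤ C :=
  abs_statExp_le (transition_nonneg a e ht) (transition_sum a e t) n hG

lemma integrable_statExp_transition (a : ℝ) {t : ℝ} (ht : 0 ≤ t) (n : ℕ) {G : (ℕ → V N) → ℝ}
    {C : ℝ} (hG : ∀ ω, |G ω| ≤ C) :
    Integrable (fun e => statExp (transition a e t) n G) (envLaw N) :=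
  integrable_of_bounded (measurable_statExp (fun x y => (continuous_transition a t x y).measurable)
    n G) fun e => abs_statExp_transition_le a e ht n hG

lemma tendsto_integral_statExp_transition_sub_annealedExp (a : ℝ) (hN : 1 ≤ N) (τ : ℕ)
    {G : ℕ → (ℕ → V N) → ℝ} {C : ℝ} (hC : 0 ≤ C) (hG : ∀ q ω, |G q ω| ≤ C) :
    Tendsto (fun q : ℕ => (∫ e, statExp (transition a e (1 / q)) (τ * q) (G q) ∂(envLaw N))
      - annealedExp N a q (τ * q) (G q)) atTop (𝓝 0) := by
  have hti := fun q : ℕ => integrable_statExp_transition (N := N) a (t := 1 / q) (by positivity)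
    (τ * q) (hG q)
  have hsi := fun q : ℕ => integrable_statExp_stepKernel a q (τ * q) (hG q)
  simp only [annealedExp, ← integral_sub (hti _) (hsi _)]
  rw [← integral_zero (V N → ℝ) ℝ (μ := envLaw N)]
  refine tendsto_integral_of_dominated_convergence (fun _ => C + C)
    (fun q => ((hti q).sub (hsi q)).aestronglyMeasurable) (integrable_const _)
    (fun q => Eventually.of_forall fun e => ?_)
    (Eventually.of_forall fun e => tendsto_statExp_transition_sub a e hN τ hC hG)
  exact (abs_sub _ _).trans (add_le_add (abs_statExp_transition_le a e (by positivity) _ (hG q))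
    (abs_statExp_stepKernel_le a e q _ (hG q)))

lemma tendsto_annealedExp_discCount (hX : IsAnnealedWalk a P E X) (hN : 1 ≤ N) (τ : ℕ)
    {φ : ℝ → ℝ} {C : ℝ} (hφ : ∀ u, 0 ≤ u → u ≤ 2 ^ N → |φ u| ≤ C) :
    Tendsto (fun q : ℕ => annealedExp N a q (τ * q) fun ω => φ (discCount (τ * q) ω)) atTop
      (𝓝 (∫ ω, φ (numDiscovered X τ ω) ∂P)) := by
  have hC : 0 ≤ C := (abs_nonneg _).trans (hφ 0 le_rfl (by positivity))
  have h := (tendsto_integral_comp_discCount_skeleton hX τ hφ).sub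
    (tendsto_integral_statExp_transition_sub_annealedExp a hN τ hC
      (G := fun q ω => φ (discCount (τ * q) ω))
      fun q ω => hφ _ (discCount_nonneg _ _) (discCount_le _ _))
  rw [sub_zero] at h
  refine h.congr fun q => ?_
  rw [integral_skeleton hX q (dependsOn_comp_discCount φ (τ * q)), sub_sub_cancel]

end Skeleton

/-! ### The law of large numbers for a fixed dimension -/

section FixedDimension

variable {N : ℕ} {a : ℝ} {Ω : Type*} {X : ℝ≥0 → Ω → V N}

lemma annealedBlockError_mono (w g : ℕ) {K K' : ℝ} (hK : 0 ≤ K) (hKK : K ≤ K') :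
    annealedBlockError N a w g K ≤ annealedBlockError N a w g K' := by
  have hw := momentBound_nonneg N a w
  unfold annealedBlockError
  have := blockError_le_blockError (N := N) (η := ((2 : ℝ) ^ N)⁻¹) (by positivity)
    (momentBound_nonneg N a g) hw hK le_rfl le_rfl hKK
  gcongr

lemma numDiscovered_mono {S T : ℝ} (h : S ≤ T) (ω : Ω) :
    (numDiscovered X S ω : ℝ) ≤ numDiscovered X T ω := by
  have : discovered (fun s => X s ω) S ⊆ discovered (fun s => X s ω) T :=
    fun x ⟨s, hs, hd⟩ => ⟨s, hs.trans h, hd⟩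
  exact_mod_cast Set.ncard_le_ncard this (Set.toFinite _)

lemma abs_sub_le_of_mem_Icc {d d₁ d₂ y y₁ y₂ : ℝ} (hd : d ∈ Set.Icc d₁ d₂)
    (hy : y ∈ Set.Icc y₁ y₂) : |d - y| ≤ |d₁ - y₁| + |d₂ - y₂| + (y₂ - y₁) := by
  obtain ⟨hd₁, hd₂⟩ := hd
  obtain ⟨hy₁, hy₂⟩ := hy
  rw [abs_le]
  constructor <;> linarith [neg_abs_le (d₁ - y₁), le_abs_self (d₂ - y₂), abs_nonneg (d₁ - y₁),
    abs_nonneg (d₂ - y₂)]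

variable [MeasurableSpace Ω] {P : Measure Ω}

lemma meanDiscovered_nonneg (P : Measure Ω) (X : ℝ≥0 → Ω → V N) (T : ℝ) :
    0 ≤ meanDiscovered P X T :=
  integral_nonneg fun _ => Nat.cast_nonneg _

variable [IsProbabilityMeasure P] {E : Ω → V N → ℝ}

lemma integrable_numDiscovered (hX : IsAnnealedWalk a P E X) {T : ℝ} (hT : 0 < T) :
    Integrable (fun ω => (numDiscovered X T ω : ℝ)) P :=
  Integrable.of_bound (aemeasurable_numDiscovered hX hT).aestronglyMeasurable (2 ^ N)
    (Eventually.of_forall fun ω => by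
      rw [Real.norm_eq_abs, Nat.abs_cast]; exact numDiscovered_le T ω)

lemma integrable_abs_numDiscovered_sub (hX : IsAnnealedWalk a P E X) {T : ℝ} (hT : 0 < T)
    (c : ℝ) : Integrable (fun ω => |(numDiscovered X T ω : ℝ) - c|) P :=
  ((integrable_numDiscovered hX hT).sub (integrable_const c)).abs

lemma tendsto_annealedExp_meanDiscovered (hX : IsAnnealedWalk a P E X) (hN : 1 ≤ N) (τ : ℕ) :
    Tendsto (fun q : ℕ => annealedExp N a q (τ * q) (discCount (τ * q))) atTop
      (𝓝 (meanDiscovered P X τ)) :=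
  tendsto_annealedExp_discCount hX hN τ (φ := fun u => u) (C := 2 ^ N)
    fun u h0 h1 => by rwa [abs_of_nonneg h0]

lemma meanDiscovered_le (hX : IsAnnealedWalk a P E X) (hN : 1 ≤ N) (τ : ℕ) :
    meanDiscovered P X τ ≤ (N + 1) * momentBound N a τ := by
  refine le_of_tendsto (tendsto_annealedExp_meanDiscovered hX hN τ) ?_
  filter_upwards [eventually_ge_atTop 1] with q hq
  exact annealedExp_discCount_le a hq τ

lemma le_meanDiscovered (hX : IsAnnealedWalk a P E X) (ha : 0 ≤ a) (hN : 1 ≤ N) {g : ℕ}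
    (hg : 2 * N ≤ g) (v : ℕ) :
    (v + 1 : ℝ) - 2 * (v + 1) ^ 2 * ((2 : ℝ) ^ N)⁻¹ ≤ meanDiscovered P X ((v * g : ℕ) : ℝ) := by
  refine ge_of_tendsto (tendsto_annealedExp_meanDiscovered hX hN (v * g)) ?_
  filter_upwards [eventually_ge_atTop (2 * N)] with q hq
  exact le_annealedExp_discCount ha hN hq hg v

lemma annealedExp_abs_discCount_sub_le_add (a : ℝ) (q n : ℕ) (c c' : ℝ) :
    annealedExp N a q n (fun ω => |discCount n ω - c|)
      ≤ annealedExp N a q n (fun ω => |discCount n ω - c'|) + |c' - c| := by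
  have hbound : ∀ (b : ℝ) (ω : ℕ → V N), |(|discCount n ω - b|)| ≤ 2 ^ N + |b| := fun b ω => by
    rw [abs_abs]
    exact (abs_sub _ _).trans (add_le_add (abs_discCount_le n ω) le_rfl)
  have hint := integrable_statExp_stepKernel (N := N) a q n (hbound c')
  refine (integral_mono (integrable_statExp_stepKernel a q n (hbound c))
    (hint.add (integrable_const |c' - c|)) fun e => ?_).trans_eq ?_
  · have hA := isSymmStochastic_stepKernel a e q
    refine (statExp_mono hA n fun ω => abs_sub_le _ c' _).trans_eq ?_
    rw [statExp_add, statExp_const hA, Pi.add_apply]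
  · rw [integral_add' hint (integrable_const _), integral_const, probReal_univ, one_smul,
      annealedExp]

lemma integral_abs_numDiscovered_sub_le (hX : IsAnnealedWalk a P E X) (ha : 0 ≤ a) (hN : 1 ≤ N)
    (w : ℕ) {g : ℕ} (hg : 2 * N ≤ g) {K : ℕ} (hK : 1 ≤ K) :
    ∫ ω, |(numDiscovered X ((K * (w + g) : ℕ) : ℝ) ω : ℝ) - K * meanDiscovered P X w| ∂P
      ≤ annealedBlockError N a w g K := by
  set m := meanDiscovered P X w
  have hdev := tendsto_annealedExp_discCount hX hN (K * (w + g)) (φ := fun u => |u - K * m|)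
    (C := 2 ^ N + |K * m|) fun u h0 h1 => by
      rw [abs_abs]
      exact (abs_sub _ _).trans (by rw [abs_of_nonneg h0]; linarith)
  have hbound := ((((tendsto_annealedExp_meanDiscovered hX hN w).const_mul (K : ℝ)).sub_const
    (K * m)).abs).const_add (annealedBlockError N a w g K)
  rw [sub_self, abs_zero, add_zero] at hbound
  refine le_of_tendsto_of_tendsto hdev hbound ?_
  filter_upwards [eventually_ge_atTop (2 * N)] with q hq
  exact (annealedExp_abs_discCount_sub_le_add a q _ _ _).trans
    (add_le_add (annealedExp_abs_discCount_sub_le ha hN hq w hg hK) le_rfl)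

lemma integral_abs_numDiscovered_sub_le_of_mem_Icc (hX : IsAnnealedWalk a P E X)
    {S₁ T S₂ y₁ y y₂ : ℝ} (hS₁ : 0 < S₁) (hT : T ∈ Set.Icc S₁ S₂) (hy : y ∈ Set.Icc y₁ y₂) :
    ∫ ω, |(numDiscovered X T ω : ℝ) - y| ∂P
      ≤ ∫ ω, |(numDiscovered X S₁ ω : ℝ) - y₁| ∂P + ∫ ω, |(numDiscovered X S₂ ω : ℝ) - y₂| ∂P
        + (y₂ - y₁) := by
  have hT0 : 0 < T := hS₁.trans_le hT.1
  have h₁ := integrable_abs_numDiscovered_sub hX hS₁ y₁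
  have h₂ := integrable_abs_numDiscovered_sub hX (hT0.trans_le hT.2) y₂
  refine (integral_mono (integrable_abs_numDiscovered_sub hX hT0 y)
    ((h₁.add h₂).add (integrable_const (y₂ - y₁))) fun ω => abs_sub_le_of_mem_Icc
      ⟨numDiscovered_mono hT.1 ω, numDiscovered_mono hT.2 ω⟩ hy).trans_eq ?_
  rw [integral_add' (h₁.add h₂) (integrable_const _), integral_add' h₁ h₂, integral_const,
    probReal_univ, one_smul]

-- Monotonicity in time sandwiches a general time between two consecutive multiples of a block.
lemma integral_abs_numDiscovered_mul_sub_le (hX : IsAnnealedWalk a P E X) (ha : 0 ≤ a)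
    (hN : 1 ≤ N) (w : ℕ) {g : ℕ} (hg : 2 * N ≤ g) {x : ℝ} (hx : 1 ≤ x) :
    ∫ ω, |(numDiscovered X (x * (w + g : ℕ)) ω : ℝ) - x * meanDiscovered P X w| ∂P
      ≤ 2 * annealedBlockError N a w g (2 * x) + meanDiscovered P X w := by
  have hm := meanDiscovered_nonneg P X w
  have hK : 1 ≤ ⌊x⌋₊ := Nat.le_floor (by exact_mod_cast hx)
  have hKx : (⌊x⌋₊ : ℝ) ≤ x := Nat.floor_le (by linarith)
  have hxK : x ≤ (⌊x⌋₊ + 1 : ℕ) := by push_cast; exact (Nat.lt_floor_add_one x).le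
  have hKx2 : ((⌊x⌋₊ + 1 : ℕ) : ℝ) ≤ 2 * x := by push_cast; linarith
  have hlow := integral_abs_numDiscovered_sub_le hX ha hN w hg hK
  have hup := integral_abs_numDiscovered_sub_le hX ha hN w hg (Nat.le_succ_of_le hK)
  have hS₁ : 0 < ((⌊x⌋₊ * (w + g) : ℕ) : ℝ) := by
    exact_mod_cast Nat.mul_pos hK (by omega)
  have hsandwich := integral_abs_numDiscovered_sub_le_of_mem_Icc hX hS₁
    (T := x * (w + g : ℕ)) (S₂ := ((⌊x⌋₊ + 1) * (w + g) : ℕ))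
    ⟨by rw [Nat.cast_mul]; gcongr, by rw [Nat.cast_mul]; gcongr⟩
    (y := x * meanDiscovered P X w) ⟨mul_le_mul_of_nonneg_right hKx hm,
      mul_le_mul_of_nonneg_right hxK hm⟩
  have hmono₁ := annealedBlockError_mono (N := N) (a := a) w g (Nat.cast_nonneg ⌊x⌋₊)
    (hKx.trans (by linarith : x ≤ 2 * x))
  have hmono₂ := annealedBlockError_mono (N := N) (a := a) w g (Nat.cast_nonneg (⌊x⌋₊ + 1)) hKx2
  refine hsandwich.trans ?_
  push_cast at hlow hup hmono₁ hmono₂ ⊢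
  linarith

end FixedDimension

/-! ### Exponential growth rates -/

section GrowthRate

/-- The sequence `u` is eventually positive and `u N = exp (β N + o(N))`. -/
structure HasGrowthRate (u : ℕ → ℝ) (β : ℝ) : Prop where
  eventually_pos : ∀ᶠ N in atTop, 0 < u N
  tendsto_log_div : Tendsto (fun N : ℕ => Real.log (u N) / N) atTop (𝓝 β)

lemma hasGrowthRate_iff_isEquivalent {u : ℕ → ℝ} {β : ℝ} (hβ : β ≠ 0)
    (hu : ∀ᶠ N in atTop, 0 < u N) :
    HasGrowthRate u β ↔ (fun N => Real.log (u N)) ~[atTop] fun N => β * (N : ℝ) := by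
  have hne : ∀ᶠ N : ℕ in atTop, β * (N : ℝ) ≠ 0 := by
    filter_upwards [eventually_ne_atTop 0] with N hN
    exact mul_ne_zero hβ (Nat.cast_ne_zero.2 hN)
  rw [isEquivalent_iff_tendsto_one hne]
  constructor
  · rintro ⟨-, h⟩
    refine ((div_self hβ ▸ h.div_const β)).congr fun N => ?_
    rw [Pi.div_apply, div_div, mul_comm]
  · refine fun h => ⟨hu, ((mul_one β ▸ h.const_mul β)).congr fun N => ?_⟩
    rw [Pi.div_apply]
    field_simp

namespace HasGrowthRate

variable {u v : ℕ → ℝ} {β γ : ℝ}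

lemma congr' (hu : HasGrowthRate u β) (h : u =ᶠ[atTop] v) : HasGrowthRate v β where
  eventually_pos := by
    filter_upwards [hu.eventually_pos, h] with N hN hNv
    exact hNv ▸ hN
  tendsto_log_div := hu.tendsto_log_div.congr' (h.mono fun N hN => by rw [hN])

lemma mul (hu : HasGrowthRate u β) (hv : HasGrowthRate v γ) :
    HasGrowthRate (fun N => u N * v N) (β + γ) where
  eventually_pos := by
    filter_upwards [hu.eventually_pos, hv.eventually_pos] with N using mul_pos
  tendsto_log_div := by
    refine (hu.tendsto_log_div.add hv.tendsto_log_div).congr' ?_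
    filter_upwards [hu.eventually_pos, hv.eventually_pos] with N huN hvN
    rw [Real.log_mul huN.ne' hvN.ne', add_div]

lemma inv (hu : HasGrowthRate u β) : HasGrowthRate (fun N => (u N)⁻¹) (-β) where
  eventually_pos := hu.eventually_pos.mono fun _ => inv_pos.2
  tendsto_log_div := hu.tendsto_log_div.neg.congr fun N => by rw [Real.log_inv, neg_div]

lemma div (hu : HasGrowthRate u β) (hv : HasGrowthRate v γ) :
    HasGrowthRate (fun N => u N / v N) (β - γ) := by
  simpa only [div_eq_mul_inv, sub_eq_add_neg] using hu.mul hv.inv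

lemma pow (hu : HasGrowthRate u β) (k : ℕ) : HasGrowthRate (fun N => u N ^ k) (k * β) where
  eventually_pos := hu.eventually_pos.mono fun _ h => pow_pos h k
  tendsto_log_div := (hu.tendsto_log_div.const_mul (k : ℝ)).congr fun N => by
    rw [Real.log_pow, mul_div_assoc]

lemma of_tendsto {b : ℝ} (hb : 0 < b) (h : Tendsto u atTop (𝓝 b)) : HasGrowthRate u 0 where
  eventually_pos := h.eventually_const_lt hb
  tendsto_log_div :=
    ((Real.continuousAt_log hb.ne').tendsto.comp h).div_atTop tendsto_natCast_atTop_atTop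

lemma const {b : ℝ} (hb : 0 < b) : HasGrowthRate (fun _ => b) 0 :=
  of_tendsto hb tendsto_const_nhds

lemma const_mul {b : ℝ} (hb : 0 < b) (hu : HasGrowthRate u β) :
    HasGrowthRate (fun N => b * u N) β := by
  simpa only [zero_add] using (const hb).mul hu

lemma const_pow {b : ℝ} (hb : 0 < b) : HasGrowthRate (fun N => b ^ N) (Real.log b) where
  eventually_pos := Eventually.of_forall fun N => pow_pos hb N
  tendsto_log_div := by
    refine tendsto_const_nhds.congr' ?_
    filter_upwards [eventually_ne_atTop 0] with N hN
    rw [Real.log_pow, mul_div_cancel_left₀ _ (Nat.cast_ne_zero.2 hN)]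

lemma natCast : HasGrowthRate (fun N => (N : ℝ)) 0 where
  eventually_pos := by
    filter_upwards [eventually_gt_atTop 0] with N hN
    exact Nat.cast_pos.2 hN
  tendsto_log_div :=
    (Real.isLittleO_log_id_atTop.comp_tendsto tendsto_natCast_atTop_atTop).tendsto_div_nhds_zero

lemma exp_of_isLittleO {f : ℕ → ℝ} (hf : f =o[atTop] fun N => (N : ℝ)) :
    HasGrowthRate (fun N => Real.exp (f N)) 0 where
  eventually_pos := Eventually.of_forall fun N => Real.exp_pos _
  tendsto_log_div := by simpa only [Real.log_exp] using hf.tendsto_div_nhds_zero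

lemma squeeze {w : ℕ → ℝ} (hu : HasGrowthRate u β) (hw : HasGrowthRate w β)
    (huv : ∀ᶠ N in atTop, u N ≤ v N) (hvw : ∀ᶠ N in atTop, v N ≤ w N) : HasGrowthRate v β where
  eventually_pos := by
    filter_upwards [hu.eventually_pos, huv] with N using lt_of_lt_of_le
  tendsto_log_div := by
    refine tendsto_of_tendsto_of_tendsto_of_le_of_le' hu.tendsto_log_div hw.tendsto_log_div ?_ ?_
    · filter_upwards [hu.eventually_pos, huv] with N hN h
      gcongr
    · filter_upwards [hu.eventually_pos, huv, hvw] with N hN h h'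
      have := hN.trans_le h
      gcongr

lemma tendsto_zero (hu : HasGrowthRate u β) (hβ : β < 0) : Tendsto u atTop (𝓝 0) := by
  have hlog : Tendsto (fun N : ℕ => Real.log (u N) / N * N) atTop atBot :=
    hu.tendsto_log_div.neg_mul_atTop hβ tendsto_natCast_atTop_atTop
  refine (Real.tendsto_exp_atBot.comp hlog).congr' ?_
  filter_upwards [hu.eventually_pos, eventually_ne_atTop 0] with N hN hN0
  rw [Function.comp_apply, div_mul_cancel₀ _ (Nat.cast_ne_zero.2 hN0), Real.exp_log hN]

lemma eventually_one_le (hu : HasGrowthRate u β) (hβ : 0 < β) : ∀ᶠ N in atTop, 1 ≤ u N := by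
  filter_upwards [(hu.inv.tendsto_zero (neg_lt_zero.2 hβ)).eventually_le_const one_pos,
    hu.eventually_pos] with N h hpos
  exact (inv_le_one₀ hpos).1 h

lemma max (hu : HasGrowthRate u β) (hv : HasGrowthRate v γ) :
    HasGrowthRate (fun N => max (u N) (v N)) (max β γ) where
  eventually_pos := hu.eventually_pos.mono fun _ => lt_max_of_lt_left
  tendsto_log_div := by
    refine (hu.tendsto_log_div.max hv.tendsto_log_div).congr' ?_
    filter_upwards [hu.eventually_pos, hv.eventually_pos] with N huN hvN
    rw [Real.strictMonoOn_log.monotoneOn.map_max huN hvN, max_div_div_right N.cast_nonneg]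

lemma add (hu : HasGrowthRate u β) (hv : HasGrowthRate v γ) :
    HasGrowthRate (fun N => u N + v N) (Max.max β γ) := by
  refine (hu.max hv).squeeze (const_mul two_pos (hu.max hv)) ?_ (Eventually.of_forall fun N => ?_)
  · filter_upwards [hu.eventually_pos, hv.eventually_pos] with N huN hvN
    exact max_le_add_of_nonneg huN.le hvN.le
  · linarith [le_max_left (u N) (v N), le_max_right (u N) (v N)]

lemma natCeil (hu : HasGrowthRate u β) (h : ∀ᶠ N in atTop, 1 ≤ u N) :
    HasGrowthRate (fun N => (⌈u N⌉₊ : ℝ)) β := by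
  refine hu.squeeze (const_mul two_pos hu) (Eventually.of_forall fun N => Nat.le_ceil _) ?_
  filter_upwards [h] with N hN
  linarith [Nat.ceil_lt_add_one (zero_le_one.trans hN)]

end HasGrowthRate

end GrowthRate

/-! ### From convergence in mean to convergence in probability -/

section ConvergenceInMean

variable {Ω : ℕ → Type*} [∀ N, MeasurableSpace (Ω N)] {P : ∀ N, Measure (Ω N)}
  [∀ N, IsProbabilityMeasure (P N)] {D : ∀ N, Ω N → ℝ} {d z : ℕ → ℝ}

lemma tendsto_integral_abs_sub_div (hD : ∀ᶠ N in atTop, Integrable (D N) (P N))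
    (hz : ∀ᶠ N in atTop, 0 < z N)
    (h : Tendsto (fun N => (∫ ω, |D N ω - z N| ∂P N) / z N) atTop (𝓝 0))
    (hd : Tendsto (fun N => d N / z N) atTop (𝓝 1)) :
    Tendsto (fun N => (∫ ω, |D N ω - d N| ∂P N) / z N) atTop (𝓝 0) := by
  have hdev : Tendsto (fun N => |1 - d N / z N|) atTop (𝓝 0) := by
    simpa using (hd.const_sub 1).abs
  have hsum := h.add hdev
  rw [add_zero] at hsum
  refine tendsto_of_tendsto_of_tendsto_of_le_of_le' tendsto_const_nhds hsum ?_ ?_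
  · filter_upwards [hz] with N hzN
    exact div_nonneg (integral_nonneg fun _ => abs_nonneg _) hzN.le
  · filter_upwards [hz, hD] with N hzN hDN
    have hint : Integrable (fun ω => |D N ω - z N|) (P N) :=
      (hDN.sub (integrable_const _)).abs
    have hcenter : |1 - d N / z N| = |z N - d N| / z N := by
      rw [one_sub_div hzN.ne', abs_div, abs_of_pos hzN]
    rw [hcenter, ← add_div]
    gcongr
    calc ∫ ω, |D N ω - d N| ∂P N
        ≤ ∫ ω, (|D N ω - z N| + |z N - d N|) ∂P N :=
          integral_mono (hDN.sub (integrable_const _)).abs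
            (hint.add (integrable_const _))
            fun ω => abs_sub_le _ _ _
      _ = ∫ ω, |D N ω - z N| ∂P N + |z N - d N| := by
          rw [integral_add hint (integrable_const _), integral_const, probReal_univ, one_smul]

lemma tendsto_integral_div (hD : ∀ᶠ N in atTop, Integrable (D N) (P N))
    (hz : ∀ᶠ N in atTop, 0 < z N)
    (h : Tendsto (fun N => (∫ ω, |D N ω - z N| ∂P N) / z N) atTop (𝓝 0)) :
    Tendsto (fun N => (∫ ω, D N ω ∂P N) / z N) atTop (𝓝 1) := by
  rw [tendsto_iff_norm_sub_tendsto_zero]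
  refine tendsto_of_tendsto_of_tendsto_of_le_of_le' tendsto_const_nhds h
    (Eventually.of_forall fun _ => norm_nonneg _) ?_
  filter_upwards [hz, hD] with N hzN hDN
  have hcenter : (∫ ω, D N ω ∂P N) - z N = ∫ ω, (D N ω - z N) ∂P N := by
    rw [integral_sub hDN (integrable_const _), integral_const, probReal_univ, one_smul]
  rw [div_sub_one hzN.ne', Real.norm_eq_abs, abs_div, abs_of_pos hzN, hcenter]
  gcongr
  exact abs_integral_le_integral_abs

lemma measure_le_abs_div_sub_one_le {Ω : Type*} [MeasurableSpace Ω] {P : Measure Ω}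
    [IsFiniteMeasure P] {D : Ω → ℝ} (hD : Integrable D P) {d ε : ℝ} (hd : 0 < d) (hε : 0 < ε) :
    P {ω | ε ≤ |D ω / d - 1|} ≤ ENNReal.ofReal ((∫ ω, |D ω - d| ∂P) / d / ε) := by
  have hset : {ω | ε ≤ |D ω / d - 1|} = {ω | ε * d ≤ |D ω - d|} := by
    ext ω
    simp only [Set.mem_ofPred_eq]
    rw [div_sub_one hd.ne', abs_div, abs_of_pos hd, le_div_iff₀ hd]
  have hmarkov := mul_meas_ge_le_integral_of_nonneg
    (Eventually.of_forall fun ω => abs_nonneg (D ω - d)) (hD.sub (integrable_const d)).abs (ε * d)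
  rw [hset, ← ofReal_measureReal]
  refine ENNReal.ofReal_le_ofReal ?_
  rw [div_div, le_div_iff₀ (mul_pos hd hε), mul_comm, mul_comm d]
  exact hmarkov

lemma tendsto_measure_le_abs_div_sub_one (hD : ∀ᶠ N in atTop, Integrable (D N) (P N))
    (hz : ∀ᶠ N in atTop, 0 < z N)
    (h : Tendsto (fun N => (∫ ω, |D N ω - z N| ∂P N) / z N) atTop (𝓝 0))
    (hd : Tendsto (fun N => d N / z N) atTop (𝓝 1)) {ε : ℝ} (hε : 0 < ε) :
    Tendsto (fun N => P N {ω | ε ≤ |D N ω / d N - 1|}) atTop (𝓝 0) := by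
  have hratio := ((tendsto_integral_abs_sub_div hD hz h hd).div hd one_ne_zero).div_const ε
  have hbound := ENNReal.tendsto_ofReal hratio
  simp only [zero_div, ENNReal.ofReal_zero] at hbound
  refine tendsto_of_tendsto_of_tendsto_of_le_of_le' tendsto_const_nhds hbound
    (Eventually.of_forall fun _ => zero_le) ?_
  filter_upwards [hD, hz, hd.eventually_const_lt zero_lt_one] with N hDN hzN hdN
  rw [Pi.div_apply, div_div_div_cancel_right₀ hzN.ne']
  exact measure_le_abs_div_sub_one_le hDN ((div_pos_iff_of_pos_right hzN).1 hdN) hε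

end ConvergenceInMean

/-! ### Subexponential blocks -/

section Blocks

/-- The number of gaps that fit into the active part of a block: large enough for the mean number
of sites discovered in a block to dominate the error made in each gap. -/
def gapCount (N : ℕ) (a : ℝ) : ℕ := ⌈((N : ℝ) + 1) ^ 2 * momentBound N a (2 * N)⌉₊

/-- The length of the active part of a block, which is followed by a gap of length `2 * N`. -/
def activeTime (N : ℕ) (a : ℝ) : ℕ := gapCount N a * (2 * N)

/-- The length of a block. -/
def blockTime (N : ℕ) (a : ℝ) : ℕ := activeTime N a + 2 * N

lemma eight_le_momentBound (N : ℕ) (a : ℝ) (τ : ℕ) : 8 ≤ momentBound N a τ :=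
  le_add_of_nonneg_right (by positivity)

lemma one_le_sq_mul_momentBound (N : ℕ) (a : ℝ) (τ : ℕ) :
    1 ≤ ((N : ℝ) + 1) ^ 2 * momentBound N a τ :=
  one_le_mul_of_one_le_of_one_le (one_le_pow₀ (by linarith [N.cast_nonneg (α := ℝ)]))
    (by linarith [eight_le_momentBound N a τ])

lemma annealedBlockError_two_mul_div (N : ℕ) (a : ℝ) (w g : ℕ) {x : ℝ} (hx : x ≠ 0) (m : ℝ) :
    annealedBlockError N a w g (2 * x) / (x * m)
      = 2 * (((N + 1) * momentBound N a g + 2) / m)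
        + ((N : ℝ) + 1) ^ 2 * momentBound N a w / m
          * (1 / x + 2 * ((2 : ℝ) ^ N)⁻¹ * (4 * x + (1 + ((N : ℝ) + 1) ^ 2))) := by
  rw [annealedBlockError, blockError]
  field_simp
  ring

variable {a : ℕ → ℝ}

lemma hasGrowthRate_natCast_add_one : HasGrowthRate (fun N => (N : ℝ) + 1) 0 := by
  simpa only [max_self] using HasGrowthRate.natCast.add (.const one_pos)

lemma hasGrowthRate_momentBound (ha : (fun N => a N ^ 2) =o[atTop] fun N => (N : ℝ)) {τ : ℕ → ℕ}
    (hτ : HasGrowthRate (fun N => (τ N : ℝ)) 0) :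
    HasGrowthRate (fun N => momentBound N (a N) (τ N)) 0 := by
  have hexp := HasGrowthRate.exp_of_isLittleO (ha.const_mul_left 32)
  have h := (HasGrowthRate.const (b := 8) (by norm_num)).add
    ((((hτ.pow 4).const_mul (b := 128) (by norm_num)).mul (HasGrowthRate.natCast.pow 4)).mul
      ((HasGrowthRate.const one_pos).add hexp))
  simpa only [momentBound, mul_zero, add_zero, max_self] using h

lemma hasGrowthRate_two_mul : HasGrowthRate (fun N : ℕ => ((2 * N : ℕ) : ℝ)) 0 := by
  simpa only [Nat.cast_mul, Nat.cast_ofNat] using HasGrowthRate.natCast.const_mul two_pos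

lemma hasGrowthRate_sq_mul_momentBound (ha : (fun N => a N ^ 2) =o[atTop] fun N => (N : ℝ))
    {τ : ℕ → ℕ} (hτ : HasGrowthRate (fun N => (τ N : ℝ)) 0) :
    HasGrowthRate (fun N => ((N : ℝ) + 1) ^ 2 * momentBound N (a N) (τ N)) 0 := by
  simpa only [mul_zero, add_zero] using
    (hasGrowthRate_natCast_add_one.pow 2).mul (hasGrowthRate_momentBound ha hτ)

lemma hasGrowthRate_gapCount (ha : (fun N => a N ^ 2) =o[atTop] fun N => (N : ℝ)) :
    HasGrowthRate (fun N => (gapCount N (a N) : ℝ)) 0 :=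
  (hasGrowthRate_sq_mul_momentBound ha hasGrowthRate_two_mul).natCeil
    (Eventually.of_forall fun N => one_le_sq_mul_momentBound N (a N) (2 * N))

lemma hasGrowthRate_activeTime (ha : (fun N => a N ^ 2) =o[atTop] fun N => (N : ℝ)) :
    HasGrowthRate (fun N => (activeTime N (a N) : ℝ)) 0 := by
  simpa only [activeTime, Nat.cast_mul, add_zero] using
    (hasGrowthRate_gapCount ha).mul hasGrowthRate_two_mul

lemma hasGrowthRate_blockTime (ha : (fun N => a N ^ 2) =o[atTop] fun N => (N : ℝ)) :
    HasGrowthRate (fun N => (blockTime N (a N) : ℝ)) 0 := by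
  simpa only [blockTime, Nat.cast_add, max_self] using
    (hasGrowthRate_activeTime ha).add hasGrowthRate_two_mul

variable {Ω : ℕ → Type*} [∀ N, MeasurableSpace (Ω N)] {P : ∀ N, Measure (Ω N)}
  [∀ N, IsProbabilityMeasure (P N)] {E : ∀ N, Ω N → V N → ℝ} {X : ∀ N, ℝ≥0 → Ω N → V N}

/-- The mean number of sites discovered during the active part of a block. -/
def blockMean {N : ℕ} {Ω : Type*} [MeasurableSpace Ω] (P : Measure Ω) (X : ℝ≥0 → Ω → V N)
    (a : ℝ) : ℝ :=
  meanDiscovered P X (activeTime N a)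

lemma eventually_le_blockMean (hX : ∀ N, IsAnnealedWalk (a N) (P N) (E N) (X N))
    (ha0 : ∀ᶠ N in atTop, 0 ≤ a N) (ha : (fun N => a N ^ 2) =o[atTop] fun N => (N : ℝ)) :
    ∀ᶠ N in atTop, ((gapCount N (a N) : ℝ) + 1) / 2 ≤ blockMean (P N) (X N) (a N) := by
  have hrate := ((hasGrowthRate_gapCount ha).add (.const one_pos)).mul
    (HasGrowthRate.const_pow two_pos).inv
  have hzero := hrate.tendsto_zero (by simpa using Real.log_pos one_lt_two)
  filter_upwards [hzero.eventually_le_const (show (0 : ℝ) < 1 / 4 by norm_num), ha0,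
    eventually_ge_atTop 1] with N hsmall haN hN
  have hsquare : 2 * ((gapCount N (a N) : ℝ) + 1) ^ 2 * ((2 : ℝ) ^ N)⁻¹
      ≤ ((gapCount N (a N) : ℝ) + 1) / 2 := by
    calc _ = 2 * ((gapCount N (a N) : ℝ) + 1) * (((gapCount N (a N) : ℝ) + 1) * ((2 : ℝ) ^ N)⁻¹)
        := by ring
      _ ≤ 2 * ((gapCount N (a N) : ℝ) + 1) * (1 / 4) := by gcongr
      _ = _ := by ring
  have hlow := le_meanDiscovered (hX N) haN hN le_rfl (gapCount N (a N))
  rw [blockMean, activeTime]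
  linarith

lemma hasGrowthRate_blockMean (hX : ∀ N, IsAnnealedWalk (a N) (P N) (E N) (X N))
    (ha0 : ∀ᶠ N in atTop, 0 ≤ a N) (ha : (fun N => a N ^ 2) =o[atTop] fun N => (N : ℝ)) :
    HasGrowthRate (fun N => blockMean (P N) (X N) (a N)) 0 := by
  have hlow : HasGrowthRate (fun N => ((gapCount N (a N) : ℝ) + 1) / 2) 0 := by
    simpa only [max_self, sub_zero] using
      ((hasGrowthRate_gapCount ha).add (.const one_pos)).div (.const two_pos)
  have hup : HasGrowthRate (fun N => ((N : ℝ) + 1) * momentBound N (a N) (activeTime N (a N))) 0 :=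
    by simpa only [add_zero] using
      hasGrowthRate_natCast_add_one.mul (hasGrowthRate_momentBound ha (hasGrowthRate_activeTime ha))
  refine hlow.squeeze hup (eventually_le_blockMean hX ha0 ha) ?_
  filter_upwards [eventually_ge_atTop 1] with N hN
  exact meanDiscovered_le (hX N) hN _

lemma tendsto_gapError_div_blockMean (hX : ∀ N, IsAnnealedWalk (a N) (P N) (E N) (X N))
    (ha0 : ∀ᶠ N in atTop, 0 ≤ a N) (ha : (fun N => a N ^ 2) =o[atTop] fun N => (N : ℝ)) :
    Tendsto (fun N : ℕ => (((N : ℝ) + 1) * momentBound N (a N) (2 * N) + 2)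
      / blockMean (P N) (X N) (a N)) atTop (𝓝 0) := by
  have hbound := (tendsto_one_div_add_atTop_nhds_zero_nat (𝕜 := ℝ)).const_mul 4
  rw [mul_zero] at hbound
  refine tendsto_of_tendsto_of_tendsto_of_le_of_le' tendsto_const_nhds hbound
    (Eventually.of_forall fun N => div_nonneg (add_nonneg (mul_nonneg (by positivity)
      (momentBound_nonneg _ _ _)) zero_le_two) (meanDiscovered_nonneg _ _ _)) ?_
  filter_upwards [eventually_le_blockMean hX ha0 ha] with N hm
  have hceil : ((N : ℝ) + 1) ^ 2 * momentBound N (a N) (2 * N) ≤ gapCount N (a N) := Nat.le_ceil _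
  have : ((N : ℝ) + 1) ^ 2 * momentBound N (a N) (2 * N) + 1
      ≤ 2 * blockMean (P N) (X N) (a N) := by linarith
  have hμ := eight_le_momentBound N (a N) (2 * N)
  have hNpos : (0 : ℝ) < N + 1 := by positivity
  have hmpos : 0 < blockMean (P N) (X N) (a N) := by
    linarith [mul_nonneg (sq_nonneg ((N : ℝ) + 1)) (momentBound_nonneg N (a N) (2 * N))]
  rw [mul_one_div, div_le_div_iff₀ hmpos hNpos]
  nlinarith [mul_le_mul_of_nonneg_left hμ (sq_nonneg ((N : ℝ) + 1))]

lemma tendsto_annealedBlockError_div (hX : ∀ N, IsAnnealedWalk (a N) (P N) (E N) (X N))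
    (ha0 : ∀ᶠ N in atTop, 0 ≤ a N) (ha : (fun N => a N ^ 2) =o[atTop] fun N => (N : ℝ))
    {x : ℕ → ℝ} {c : ℝ} (hx : HasGrowthRate x c) (hc : c ∈ Set.Ioo 0 (Real.log 2)) :
    Tendsto (fun N => annealedBlockError N (a N) (activeTime N (a N)) (2 * N) (2 * x N)
      / (x N * blockMean (P N) (X N) (a N))) atTop (𝓝 0) := by
  have hsq := hasGrowthRate_natCast_add_one.pow 2
  have hrate := ((hasGrowthRate_sq_mul_momentBound ha (hasGrowthRate_activeTime ha)).div
    (hasGrowthRate_blockMean hX ha0 ha)).mul (((HasGrowthRate.const one_pos).div hx).add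
      (((HasGrowthRate.const_pow two_pos).inv.const_mul two_pos).mul
        ((hx.const_mul four_pos).add ((HasGrowthRate.const one_pos).add hsq))))
  have hzero := hrate.tendsto_zero (by
    simp only [mul_zero, max_self, sub_zero, zero_add, max_eq_left hc.1.le, zero_sub]
    exact max_lt (by linarith [hc.1]) (by linarith [hc.2]))
  have hsum := ((tendsto_gapError_div_blockMean hX ha0 ha).const_mul 2).add hzero
  rw [mul_zero, add_zero] at hsum
  refine hsum.congr' ?_
  filter_upwards [hx.eventually_pos] with N hxN
  exact (annealedBlockError_two_mul_div N (a N) _ _ hxN.ne' _).symm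

lemma tendsto_integral_abs_numDiscovered_sub_div
    (hX : ∀ N, IsAnnealedWalk (a N) (P N) (E N) (X N))
    (ha0 : ∀ᶠ N in atTop, 0 ≤ a N) (ha : (fun N => a N ^ 2) =o[atTop] fun N => (N : ℝ))
    {T : ℕ → ℝ} {c : ℝ} (hT : HasGrowthRate T c) (hc : c ∈ Set.Ioo 0 (Real.log 2)) :
    Tendsto (fun N => (∫ ω, |(numDiscovered (X N) (T N) ω : ℝ)
        - T N / blockTime N (a N) * blockMean (P N) (X N) (a N)| ∂(P N))
      / (T N / blockTime N (a N) * blockMean (P N) (X N) (a N))) atTop (𝓝 0) := by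
  have hb := hasGrowthRate_blockTime ha
  have hx := hT.div hb
  rw [sub_zero] at hx
  have hm := hasGrowthRate_blockMean hX ha0 ha
  have hbound := ((tendsto_annealedBlockError_div hX ha0 ha hx hc).const_mul 2).add
    (hx.inv.tendsto_zero (neg_lt_zero.2 hc.1))
  rw [mul_zero, add_zero] at hbound
  refine tendsto_of_tendsto_of_tendsto_of_le_of_le' tendsto_const_nhds hbound ?_ ?_
  · filter_upwards [(hx.mul hm).eventually_pos] with N hpos
    exact div_nonneg (integral_nonneg fun _ => abs_nonneg _) hpos.le
  · filter_upwards [hx.eventually_one_le hc.1, hb.eventually_pos, hm.eventually_pos, ha0,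
      eventually_ge_atTop 1] with N hxN hbN hmN haN hN
    have h := integral_abs_numDiscovered_mul_sub_le (hX N) haN hN (activeTime N (a N)) le_rfl hxN
    change ∫ ω, |(numDiscovered (X N) (T N / blockTime N (a N) * blockTime N (a N)) ω : ℝ)
      - T N / blockTime N (a N) * blockMean (P N) (X N) (a N)| ∂(P N)
      ≤ _ + blockMean (P N) (X N) (a N) at h
    rw [div_mul_cancel₀ _ hbN.ne'] at h
    have hxpos : 0 < T N / blockTime N (a N) := one_pos.trans_le hxN
    rw [div_le_iff₀ (mul_pos hxpos hmN), add_mul, mul_assoc 2, div_mul_cancel₀ _ (by positivity),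
      inv_mul_cancel_left₀ hxpos.ne']
    exact h

lemma eventually_integrable_numDiscovered (hX : ∀ N, IsAnnealedWalk (a N) (P N) (E N) (X N))
    {T : ℕ → ℝ} {c : ℝ} (hT : HasGrowthRate T c) :
    ∀ᶠ N in atTop, Integrable (fun ω => (numDiscovered (X N) (T N) ω : ℝ)) (P N) :=
  hT.eventually_pos.mono fun N hTN => integrable_numDiscovered (hX N) hTN

lemma hasGrowthRate_div_blockTime_mul_blockMean
    (hX : ∀ N, IsAnnealedWalk (a N) (P N) (E N) (X N))
    (ha0 : ∀ᶠ N in atTop, 0 ≤ a N) (ha : (fun N => a N ^ 2) =o[atTop] fun N => (N : ℝ))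
    {T : ℕ → ℝ} {c : ℝ} (hT : HasGrowthRate T c) :
    HasGrowthRate (fun N => T N / blockTime N (a N) * blockMean (P N) (X N) (a N)) c := by
  simpa only [sub_zero, add_zero] using
    (hT.div (hasGrowthRate_blockTime ha)).mul (hasGrowthRate_blockMean hX ha0 ha)

lemma tendsto_meanDiscovered_div (hX : ∀ N, IsAnnealedWalk (a N) (P N) (E N) (X N))
    (ha0 : ∀ᶠ N in atTop, 0 ≤ a N) (ha : (fun N => a N ^ 2) =o[atTop] fun N => (N : ℝ))
    {T : ℕ → ℝ} {c : ℝ} (hT : HasGrowthRate T c) (hc : c ∈ Set.Ioo 0 (Real.log 2)) :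
    Tendsto (fun N => meanDiscovered (P N) (X N) (T N)
      / (T N / blockTime N (a N) * blockMean (P N) (X N) (a N))) atTop (𝓝 1) :=
  tendsto_integral_div (eventually_integrable_numDiscovered hX hT)
    (hasGrowthRate_div_blockTime_mul_blockMean hX ha0 ha hT).eventually_pos
    (tendsto_integral_abs_numDiscovered_sub_div hX ha0 ha hT hc)

lemma hasGrowthRate_meanDiscovered (hX : ∀ N, IsAnnealedWalk (a N) (P N) (E N) (X N))
    (ha0 : ∀ᶠ N in atTop, 0 ≤ a N) (ha : (fun N => a N ^ 2) =o[atTop] fun N => (N : ℝ))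
    {T : ℕ → ℝ} {c : ℝ} (hT : HasGrowthRate T c) (hc : c ∈ Set.Ioo 0 (Real.log 2)) :
    HasGrowthRate (fun N => meanDiscovered (P N) (X N) (T N)) c := by
  have hz := hasGrowthRate_div_blockTime_mul_blockMean hX ha0 ha hT
  have hd := HasGrowthRate.of_tendsto one_pos (tendsto_meanDiscovered_div hX ha0 ha hT hc)
  rw [← zero_add c]
  exact (hd.mul hz).congr' (hz.eventually_pos.mono fun N hN => div_mul_cancel₀ _ hN.ne')

lemma isLittleO_sq_of_le_mul_sqrt_log {b : ℝ}
    (ha : ∀ᶠ N : ℕ in atTop, 0 ≤ a N ∧ a N ≤ b * √(2 * Real.log N)) :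
    (fun N => a N ^ 2) =o[atTop] fun N => (N : ℝ) := by
  have hlog : (fun N : ℕ => b ^ 2 * (2 * Real.log N)) =o[atTop] fun N => (N : ℝ) :=
    ((Real.isLittleO_log_id_atTop.comp_tendsto
      tendsto_natCast_atTop_atTop).const_mul_left 2).const_mul_left (b ^ 2)
  refine (IsBigO.of_bound' ?_).trans_isLittleO hlog
  filter_upwards [ha, eventually_ge_atTop 1] with N ⟨h0, hle⟩ hN
  have : 0 ≤ Real.log N := Real.log_nonneg (by exact_mod_cast hN)
  rw [Real.norm_of_nonneg (by positivity), Real.norm_of_nonneg (by positivity)]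
  calc a N ^ 2 ≤ (b * √(2 * Real.log N)) ^ 2 := by gcongr
    _ = b ^ 2 * (2 * Real.log N) := by rw [mul_pow, Real.sq_sqrt (by positivity)]

end Blocks

end

end REM

theorem theoremt_general
    (a : ℕ → ℝ)
    (ha0 : ∀ᶠ N : ℕ in atTop, 0 ≤ a N)
    (ha : (fun N : ℕ => a N ^ 2) =o[atTop] fun N : ℕ => (N : ℝ))
    (cbar : ℝ) (hcbar : cbar ∈ Set.Ioo 0 (Real.log 2))
    (tt : ℕ → ℝ) (htt_pos : ∀ᶠ N : ℕ in atTop, 0 < tt N)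
    (htt : (fun N : ℕ => Real.log (tt N)) ~[atTop] (fun N : ℕ => cbar * (N : ℝ)))
    (Ω : ℕ → Type*) [∀ N, MeasurableSpace (Ω N)]
    (P : ∀ N, Measure (Ω N)) [∀ N, IsProbabilityMeasure (P N)]
    (E : ∀ N, Ω N → REM.V N → ℝ) (X : ∀ N, ℝ≥0 → Ω N → REM.V N)
    (hX : ∀ N, REM.IsAnnealedWalk (a N) (P N) (E N) (X N)) :
    (∀ t : ℝ, 0 < t → ∀ ε : ℝ, 0 < ε →
      Tendsto (fun N : ℕ => P N {ω |
          ε ≤ |(REM.numDiscovered (X N) (t * tt N) ω : ℝ)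
                / (t * REM.meanDiscovered (P N) (X N) (tt N)) - 1|})
        atTop (𝓝 0)) ∧
    (fun N : ℕ => Real.log (REM.meanDiscovered (P N) (X N) (tt N)))
      ~[atTop] (fun N : ℕ => cbar * (N : ℝ)) := by
  have hT := (REM.hasGrowthRate_iff_isEquivalent hcbar.1.ne' htt_pos).2 htt
  have hmean := REM.hasGrowthRate_meanDiscovered hX ha0 ha hT hcbar
  refine ⟨fun t ht ε hε => ?_,
    (REM.hasGrowthRate_iff_isEquivalent hcbar.1.ne' hmean.eventually_pos).1 hmean⟩
  have htT := hT.const_mul ht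
  refine REM.tendsto_measure_le_abs_div_sub_one (REM.eventually_integrable_numDiscovered hX htT)
    (REM.hasGrowthRate_div_blockTime_mul_blockMean hX ha0 ha htT).eventually_pos
    (REM.tendsto_integral_abs_numDiscovered_sub_div hX ha0 ha htT hcbar) ?_ hε
  refine (REM.tendsto_meanDiscovered_div hX ha0 ha hT hcbar).congr fun N => ?_
  rw [mul_div_assoc t (tt N), mul_assoc t, mul_div_mul_left _ _ ht.ne']

theorem theoremt
    (abar : ℝ) (habar : abar < 1 / 20)
    (a : ℕ → ℝ)
    (ha : ∀ᶠ N : ℕ in atTop, 1 ≤ a N ∧ a N ≤ abar * Real.sqrt (2 * Real.log N))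
    (cbar : ℝ) (hcbar : cbar ∈ Set.Ioo 0 (Real.log 2))
    (tt : ℕ → ℝ) (htt_pos : ∀ᶠ N : ℕ in atTop, 0 < tt N)
    (htt : (fun N : ℕ => Real.log (tt N)) ~[atTop] (fun N : ℕ => cbar * (N : ℝ)))
    (Ω : ℕ → Type*) [∀ N, MeasurableSpace (Ω N)]
    (P : ∀ N, Measure (Ω N)) [∀ N, IsProbabilityMeasure (P N)]
    (E : ∀ N, Ω N → REM.V N → ℝ) (X : ∀ N, ℝ≥0 → Ω N → REM.V N)
    (hX : ∀ N, REM.IsAnnealedWalk (a N) (P N) (E N) (X N)) :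
    (∀ t : ℝ, 0 < t → ∀ ε : ℝ, 0 < ε →
      Tendsto (fun N : ℕ => P N {ω |
          ε ≤ |(REM.numDiscovered (X N) (t * tt N) ω : ℝ)
                / (t * REM.meanDiscovered (P N) (X N) (tt N)) - 1|})
        atTop (𝓝 0)) ∧
    (fun N : ℕ => Real.log (REM.meanDiscovered (P N) (X N) (tt N)))
      ~[atTop] (fun N : ℕ => cbar * (N : ℝ)) := by
  have ha0 := ha.mono fun N h => (⟨zero_le_one.trans h.1, h.2⟩ : 0 ≤ a N ∧ _)
  exact theoremt_general a (ha0.mono fun _ h => h.1) (REM.isLittleO_sq_of_le_mul_sqrt_log ha0)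
    cbar hcbar tt htt_pos htt Ω P E X hX
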